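/- Let $n,m\ge 1$. For $j=1,\dots,m$ let $\Omega_j:\mathbb{R}^n\to\mathbb{C}$ (in particular, possibly real-valued) be odd, homogeneous of degree $0$ (that is, $\Omega_j(\lambda y)=\Omega_j(y)$ for all $\lambda>0$ and $y\in\mathbb{R}^n$), and Lipschitz continuous on $S^{n-1}$ in the sense that there are $0<\alpha\le 1$ and $C_0>0$ with $|\Omega_j(\xi)-\Omega_j(\eta)|\le C_0|\xi-\eta|^{\alpha}$ for all $\xi,\eta\in S^{n-1}$. Put $$\Omega(y_1,\dots,y_m)=\sin\Bigl(\prod_{j=1}^m\Omega_j(y_j)\Bigr),$$ and, with $B(0,t)=\{y\in\mathbb{R}^n:|y|\le t\}$, $$F_t(\vec f)(x)=\frac1{t^m}\int_{B(0,t)^m}\frac{\Omega(y_1,\dots,y_m)}{\prod_{j=1}^m|y_j|^{n-1}}\prod_{j=1}^m f_j(x-y_j)\,dy_1\cdots dy_m ,\qquad t>0,$$ $$\mu(\vec f)(x)=\Bigl(\int_0^\infty|F_t(\vec f)(x)|^2\,\frac{dt}{t}\Bigr)^{1/2}\in[0,\infty].$$ Let $1<p_1,\dots,p_m<\infty$ and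 $\frac1p=\frac1{p_1}+\cdots+\frac1{p_m}$ (so $p>0$, and $p<1$ is allowed). Then $\mu$ is bounded from $L^{p_1}(\mathbb{R}^n)\times\cdots\times L^{p_m}(\mathbb{R}^n)$ to $L^p(\mathbb{R}^n)$: there is a constant $C<\infty$, independent of $\vec f$, such that for all complex-valued $f_j\in L^{p_j}(\mathbb{R}^n)$, $j=1,\dots,m$, the integrals defining $F_t(\vec f)(x)$ converge absolutely for almost every $x$ and all $t>0$, $\mu(\vec f)$ is (Lebesgue) measurable, and $$\|\mu(\vec f)\|_{L^p(\mathbb{R}^n)}\le C\prod_{j=1}^m\|f_j\|_{L^{p_j}(\mathbb{R}^n)} .$$ -/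

import Mathlib

open MeasureTheory
open scoped NNReal ENNReal

namespace MultilinearMarcinkiewicz

/-- `ℝⁿ` with its Euclidean norm. -/
abbrev E (n : ℕ) : Type := EuclideanSpace ℝ (Fin n)

/-- Homogeneity of degree `0`: `ω (r y) = ω y` for every `r > 0`. -/
def HomogeneousDegreeZero {n : ℕ} (ω : E n → ℂ) : Prop :=
  ∀ r : ℝ, 0 < r → ∀ y : E n, ω (r • y) = ω y

/-- Lipschitz continuity on the unit sphere, of some order `α ∈ (0, 1]`
(`α = 1` is the usual Lipschitz condition). -/
def LipschitzOnSphere {n : ℕ} (ω : E n → ℂ) : Prop :=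
  ∃ α C : ℝ, 0 < α ∧ α ≤ 1 ∧ ∀ ξ η : E n, ‖ξ‖ = 1 → ‖η‖ = 1 →
    ‖ω ξ - ω η‖ ≤ C * ‖ξ - η‖ ^ α

/-- The integrand `Ω(y) / ∏ |y_j|^(n-1) * ∏ f_j (x - y_j)` (for `n ≥ 1`). -/
noncomputable def integrand {n m : ℕ} (Ω : (Fin m → E n) → ℂ) (f : Fin m → E n → ℂ)
    (x : E n) (y : Fin m → E n) : ℂ :=
  Ω y / ((∏ j, ‖y j‖ ^ (n - 1) : ℝ) : ℂ) * ∏ j, f j (x - y j)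

/-- The product `B(0,t)^m` of `m` closed balls in `ℝⁿ`. -/
def ballProd (n m : ℕ) (t : ℝ) : Set (Fin m → E n) :=
  {y | ∀ j, ‖y j‖ ≤ t}

/-- `F_t(f)(x) = t⁻ᵐ ∫_{B(0,t)^m} Ω(y) / ∏ |y_j|^(n-1) ∏ f_j (x - y_j) dy`. -/
noncomputable def F {n m : ℕ} (Ω : (Fin m → E n) → ℂ) (f : Fin m → E n → ℂ)
    (t : ℝ) (x : E n) : ℂ :=
  1 / (t : ℂ) ^ m * ∫ y in ballProd n m t, integrand Ω f x y

/-- The multilinear Marcinkiewicz integral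
`μ(f)(x) = (∫_0^∞ |F_t(f)(x)|² dt/t)^(1/2)`, with values in `[0, ∞]`. -/
noncomputable def marcinkiewicz {n m : ℕ} (Ω : (Fin m → E n) → ℂ) (f : Fin m → E n → ℂ)
    (x : E n) : ℝ≥0∞ :=
  (∫⁻ t in Set.Ioi (0 : ℝ), ‖F Ω f t x‖ₑ ^ 2 / ENNReal.ofReal t) ^ (1 / 2 : ℝ)

/-- The function `Ω(y) = sin (∏ Ω_j(y_j))`. -/
noncomputable def sinProd {n m : ℕ} (ω : Fin m → E n → ℂ) (y : Fin m → E n) : ℂ :=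
  Complex.sin (∏ j, ω j (y j))

end MultilinearMarcinkiewicz

/-! The kernel is bounded and, with y_2, ..., y_m frozen, it is odd and homogeneous of degree 0 in
y_1: the product is odd in y_1 and so is its sine. All cancellation is taken from y_1. In polar
coordinates, symmetrised under y_1 ↦ -y_1, the inner integral becomes half an average over
directions θ of a bounded factor times ∫_0^t (f_1(x - rθ) - f_1(x + rθ)) dr. This majorant does not
depend on the other variables, so those are integrated in absolute value, each giving t times an
average over θ of directional maximal functions. Minkowski's inequality in L²(dt/t) then gives the
pointwise bound `marcinkiewicz_sinProd_le`, a product of one `sphereSq` and m - 1 factors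
`sphereMax`, and Hölder's inequality, valid for every p > 0, finishes.

Slicing space into lines parallel to θ reduces both kinds of factor to the line. There the odd line
integral is, up to sign, the second difference F(s + t) + F(s - t) - 2F(s) of a primitive F of f_1,
so what is needed is Marcinkiewicz's theorem `lintegral_sqFn_rpow_le`, proved here by real-variable
means.

For 1 < p ≤ 2, let a and b be the difference quotients of F over [x, x + t] and [x - t, x]. Then |a
- b| is the second difference over t, while (a + b)/2 is the quotient over [x - t, x + t]. Uniform
convexity bounds |a - b|² by M^(2-p) times |a|^p + |b|^p - 2|(a + b)/2|^p. Integrated in x, this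
defect is a difference between scales t and 2t, so its dt/t integral telescopes; M is controlled by
the maximal function.

For p > 2, duality reduces the matter to ∫ S(F) w ≤ C ∫ g² Mw, where S is `sqFn` and g bounds the
increments of F. The parallelogram law telescopes in the same way when the weight at (t, x) is the
supremum of averages of w over intervals containing [x - t, x + t], since this decreases as the
interval grows. That weight need not dominate w(x). It does dominate averages of w, so second
differences are first bounded by sums of their averages at smaller dyadic scales
(`secondQuot_le_tsum`). -/

namespace MultilinearMarcinkiewicz

/-! ### The Hardy–Littlewood maximal theorem on the line. -/

open Classical in
/-- The supremum of the averages of `w` over the intervals with rational endpoints that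
contain `x` and `y`. For `x = y` this is the uncentred Hardy–Littlewood maximal function. -/
noncomputable def intervalMax (w : ℝ → ℝ≥0∞) (x y : ℝ) : ℝ≥0∞ :=
  ⨆ r : ℚ × ℚ, if (r.1 : ℝ) < r.2 ∧ (r.1 : ℝ) ≤ x ∧ y ≤ r.2 then
    (∫⁻ z in Set.Icc (r.1 : ℝ) r.2, w z) / ENNReal.ofReal (r.2 - r.1) else 0

lemma le_intervalMax (w : ℝ → ℝ≥0∞) {x y : ℝ} (a b : ℚ) (hab : (a : ℝ) < b) (ha : (a : ℝ) ≤ x)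
    (hb : y ≤ b) :
    (∫⁻ z in Set.Icc (a : ℝ) b, w z) / ENNReal.ofReal (b - a) ≤ intervalMax w x y := by
  refine le_trans ?_ (le_iSup _ ((a, b) : ℚ × ℚ))
  rw [if_pos ⟨hab, ha, hb⟩]

lemma intervalMax_le_iff {w : ℝ → ℝ≥0∞} {x y : ℝ} {c : ℝ≥0∞} :
    intervalMax w x y ≤ c ↔ ∀ a b : ℚ, (a : ℝ) < b → (a : ℝ) ≤ x → y ≤ b →
      (∫⁻ z in Set.Icc (a : ℝ) b, w z) / ENNReal.ofReal (b - a) ≤ c := by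
  constructor
  · intro h a b hab ha hb
    exact (le_intervalMax w a b hab ha hb).trans h
  · intro h
    refine iSup_le fun r => ?_
    split_ifs with hr
    · exact h r.1 r.2 hr.1 hr.2.1 hr.2.2
    · exact zero_le

lemma intervalMax_anti (w : ℝ → ℝ≥0∞) {x x' y y' : ℝ} (hx : x' ≤ x) (hy : y ≤ y') :
    intervalMax w x' y' ≤ intervalMax w x y :=
  intervalMax_le_iff.2 fun a b hab ha hb =>
    le_intervalMax w a b hab (ha.trans hx) (hy.trans hb)

/-- Rational endpoints make the supremum countable, so no regularity of `w` is needed. -/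
lemma measurable_intervalMax (w : ℝ → ℝ≥0∞) :
    Measurable fun q : ℝ × ℝ => intervalMax w q.1 q.2 := by
  refine Measurable.iSup fun r => ?_
  refine Measurable.ite ?_ measurable_const measurable_const
  by_cases h : (r.1 : ℝ) < r.2
  · simp only [h, true_and]
    exact (measurableSet_le measurable_const measurable_fst).inter
      (measurableSet_le measurable_snd measurable_const)
  · simp [h]

/-- Moving each endpoint outwards to a rational, by less than `d - c`, at most triples the length;
hence the 3. -/
lemma setLIntegral_Icc_le_intervalMax (w : ℝ → ℝ≥0∞) {c d x y : ℝ} (hcd : c < d) (hx : c ≤ x)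
    (hy : y ≤ d) :
    ∫⁻ z in Set.Icc c d, w z ≤ ENNReal.ofReal (3 * (d - c)) * intervalMax w x y := by
  obtain ⟨a, ha1, ha2⟩ := exists_rat_btwn (show c - (d - c) < c by linarith)
  obtain ⟨b, hb1, hb2⟩ := exists_rat_btwn (show d < d + (d - c) by linarith)
  have hab : (a : ℝ) < b := by linarith
  have h := le_intervalMax w a b hab (ha2.le.trans hx) (hy.trans hb1.le)
  have h0 : ENNReal.ofReal ((b : ℝ) - a) ≠ 0 := by simpa using hab
  rw [ENNReal.div_le_iff h0 ENNReal.ofReal_ne_top] at h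
  calc ∫⁻ z in Set.Icc c d, w z ≤ ∫⁻ z in Set.Icc (a : ℝ) b, w z :=
        lintegral_mono_set (Set.Icc_subset_Icc ha2.le hb1.le)
    _ ≤ _ := h
    _ ≤ _ := by
      rw [mul_comm]
      gcongr
      linarith

lemma intervalMax_le_add (w : ℝ → ℝ≥0∞) (x : ℝ) (l : ℝ≥0∞) :
    intervalMax w x x ≤ l + intervalMax ({y | l < w y}.indicator w) x x := by
  refine intervalMax_le_iff.2 fun a b hab ha hb => ?_
  have h0 : ENNReal.ofReal ((b : ℝ) - a) ≠ 0 := by simpa using hab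
  have hle := le_intervalMax ({y | l < w y}.indicator w) a b hab ha hb
  rw [ENNReal.div_le_iff h0 ENNReal.ofReal_ne_top] at hle ⊢
  calc ∫⁻ z in Set.Icc (a : ℝ) b, w z
      ≤ ∫⁻ z in Set.Icc (a : ℝ) b, (l + ({y | l < w y}.indicator w) z) := by
        refine lintegral_mono fun z => ?_
        by_cases hz : l < w z
        · simp [Set.indicator, hz]
        · rw [Set.indicator_of_notMem (by simpa using hz), add_zero]
          exact not_lt.1 hz
    _ = l * ENNReal.ofReal (b - a)
          + ∫⁻ z in Set.Icc (a : ℝ) b, ({y | l < w y}.indicator w) z := by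
        rw [lintegral_add_left measurable_const]
        simp
    _ ≤ _ := by
        rw [add_mul]
        gcongr

/-- Vitali covering of the rational intervals on which the average of `w` exceeds `l`. Their lengths
are bounded by ∫ w / l, and any enlargement factor above 3 would do; 4 is the constant that
survives. -/
lemma mul_volume_lt_intervalMax_le {w : ℝ → ℝ≥0∞} (l : ℝ≥0∞) :
    l * volume {x | l < intervalMax w x x} ≤ 4 * ∫⁻ x, w x := by
  rcases eq_or_ne l 0 with rfl | hl0
  · simp
  rcases eq_or_ne l ∞ with rfl | hltop
  · simp
  rcases eq_or_ne (∫⁻ x, w x) ∞ with hw | hw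
  · simp [hw]
  set t : Set (ℚ × ℚ) := {r | (r.1 : ℝ) < r.2 ∧
    l * ENNReal.ofReal (r.2 - r.1) < ∫⁻ z in Set.Icc (r.1 : ℝ) r.2, w z} with ht
  have hball : ∀ r : ℚ × ℚ, Metric.closedBall (((r.1 : ℝ) + r.2) / 2) (((r.2 : ℝ) - r.1) / 2)
      = Set.Icc (r.1 : ℝ) r.2 := by
    intro r
    rw [Real.closedBall_eq_Icc]
    congr 1 <;> ring
  obtain ⟨u, hut, hdisj, hcov⟩ := Vitali.exists_disjoint_subfamily_covering_enlargement_closedBall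
    t (fun r : ℚ × ℚ => ((r.1 : ℝ) + r.2) / 2) (fun r => ((r.2 : ℝ) - r.1) / 2)
    ((∫⁻ x, w x).toReal / l.toReal) (by
      intro r hr
      have h1 : l * ENNReal.ofReal (r.2 - r.1) ≤ ∫⁻ x, w x :=
        hr.2.le.trans (setLIntegral_le_lintegral _ _)
      have h2 := ENNReal.toReal_mono hw h1
      have hr1 := hr.1
      rw [ENNReal.toReal_mul, ENNReal.toReal_ofReal (by linarith)] at h2
      have hlpos : 0 < l.toReal := ENNReal.toReal_pos hl0 hltop
      rw [le_div_iff₀ hlpos]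
      nlinarith) 4 (by norm_num)
  have hsub : {x | l < intervalMax w x x} ⊆ ⋃ r ∈ u,
      Metric.closedBall (((r.1 : ℝ) + r.2) / 2) (4 * (((r.2 : ℝ) - r.1) / 2)) := by
    intro x hx
    have hx' : ¬ intervalMax w x x ≤ l := not_le.2 hx
    rw [intervalMax_le_iff] at hx'
    push Not at hx'
    obtain ⟨a, b, hab, ha, hb, hlt⟩ := hx'
    have h0 : ENNReal.ofReal ((b : ℝ) - a) ≠ 0 := by simpa using hab
    rw [ENNReal.lt_div_iff_mul_lt (Or.inl h0) (Or.inl ENNReal.ofReal_ne_top)] at hlt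
    obtain ⟨r, hr, hsub⟩ := hcov (a, b) ⟨hab, hlt⟩
    refine Set.mem_iUnion₂.2 ⟨r, hr, hsub ?_⟩
    rw [hball]
    exact ⟨ha, hb⟩
  have hvol : ∀ r : ℚ × ℚ, volume (Metric.closedBall (((r.1 : ℝ) + r.2) / 2)
      (4 * (((r.2 : ℝ) - r.1) / 2))) = 4 * ENNReal.ofReal (r.2 - r.1) := by
    intro r
    rw [Real.volume_closedBall, ← ENNReal.ofReal_ofNat, ← ENNReal.ofReal_mul (by norm_num)]
    congr 1
    ring
  calc l * volume {x | l < intervalMax w x x}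
      ≤ l * ∑' r : u, volume (Metric.closedBall (((r.1.1 : ℝ) + r.1.2) / 2)
          (4 * (((r.1.2 : ℝ) - r.1.1) / 2))) := by
        gcongr
        exact (measure_mono hsub).trans (measure_biUnion_le _ u.to_countable _)
    _ = 4 * ∑' r : u, l * ENNReal.ofReal (r.1.2 - r.1.1) := by
        simp_rw [hvol, ENNReal.tsum_mul_left]
        ring
    _ ≤ 4 * ∑' r : u, ∫⁻ z in Set.Icc (r.1.1 : ℝ) r.1.2, w z := by
        gcongr with r
        exact (hut r.2).2.le
    _ = 4 * ∫⁻ z in ⋃ r ∈ u, Set.Icc (r.1 : ℝ) r.2, w z := by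
        rw [lintegral_biUnion u.to_countable (fun r _ => measurableSet_Icc)]
        intro r hr s hs hrs
        have := hdisj hr hs hrs
        simpa only [Function.onFun, hball] using this
    _ ≤ 4 * ∫⁻ x, w x := by
        gcongr
        exact Measure.restrict_le_self

/-- Values of `w` below `l` contribute at most `l` to any average, so exceeding `2 * l` is due to
the part above `l` alone. This is the form that can be integrated over all levels. -/
lemma mul_volume_two_mul_lt_intervalMax_le (w : ℝ → ℝ≥0∞) (hw : Measurable w) (l : ℝ≥0∞)
    (hl : l ≠ ∞) :
    l * volume {x | 2 * l < intervalMax w x x} ≤ 4 * ∫⁻ x in {x | l < w x}, w x := by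
  rw [← lintegral_indicator (measurableSet_lt measurable_const hw)]
  refine le_trans ?_ (mul_volume_lt_intervalMax_le (w := {x | l < w x}.indicator w) l)
  refine mul_le_mul' le_rfl (measure_mono fun x hx => ?_)
  have h := lt_of_lt_of_le hx (intervalMax_le_add w x l)
  rw [two_mul] at h
  exact (ENNReal.add_lt_add_iff_left hl).1 h

lemma setLIntegral_Ioo_rpow {r : ℝ} (hr : -1 < r) {b : ℝ} (hb : 0 ≤ b) :
    ∫⁻ t in Set.Ioo 0 b, ENNReal.ofReal (t ^ r) = ENNReal.ofReal (b ^ (r + 1) / (r + 1)) := by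
  have hint := intervalIntegral.intervalIntegrable_rpow' (a := 0) (b := b) hr
  have h : ∫ t in Set.Ioo 0 b, t ^ r = b ^ (r + 1) / (r + 1) := by
    rw [← integral_Ioc_eq_integral_Ioo, ← intervalIntegral.integral_of_le hb,
      integral_rpow (Or.inl hr), Real.zero_rpow (by linarith), sub_zero]
  rw [← h, ofReal_integral_eq_lintegral_ofReal]
  · rw [intervalIntegrable_iff_integrableOn_Ioo_of_le hb] at hint
    exact hint
  · filter_upwards [ae_restrict_mem measurableSet_Ioo] with t ht
    exact Real.rpow_nonneg ht.1.le _

/-- Monotone convergence, to reduce to bounded functions. It serves the layer-cake formula, which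
wants real values, and the duality argument, which must divide by a finite quantity. -/
lemma lintegral_rpow_le_of_forall_min {α : Type*} [MeasurableSpace α] {μ : Measure α}
    {u : α → ℝ≥0∞} (hu : Measurable u) {p : ℝ} (hp : 0 < p) {C : ℝ≥0∞}
    (h : ∀ N : ℕ, ∫⁻ x, min (u x) N ^ p ∂μ ≤ C) : ∫⁻ x, u x ^ p ∂μ ≤ C := by
  have hlim : Filter.Tendsto (fun N : ℕ => ∫⁻ x, min (u x) N ^ p ∂μ) Filter.atTop
      (nhds (∫⁻ x, u x ^ p ∂μ)) := by
    have hmono : ∀ x, Monotone fun N : ℕ => min (u x) (N : ℝ≥0∞) := fun x m n hmn =>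
      min_le_min le_rfl (by exact_mod_cast hmn)
    refine lintegral_tendsto_of_tendsto_of_monotone
      (fun N => ((hu.min measurable_const).pow_const p).aemeasurable)
      (Filter.Eventually.of_forall fun x m n hmn =>
        ENNReal.rpow_le_rpow (hmono x hmn) hp.le)
      (Filter.Eventually.of_forall fun x => ?_)
    refine ((ENNReal.continuous_rpow_const (y := p)).tendsto (u x)).comp ?_
    have := tendsto_atTop_iSup (hmono x)
    have h2 : ⨆ N : ℕ, min (u x) (N : ℝ≥0∞) = u x := by
      have := inf_iSup_eq (u x) (fun N : ℕ => (N : ℝ≥0∞))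
      rw [ENNReal.iSup_natCast, inf_top_eq] at this
      exact this.symm
    rwa [h2] at this
  exact le_of_tendsto' hlim h

lemma mul_lintegral_Ioi_indicator_rpow_le {p : ℝ} (hp : 1 < p) (y : ℝ≥0∞) :
    y * ∫⁻ t in Set.Ioi (0 : ℝ), {t : ℝ | ENNReal.ofReal (t / 2) < y}.indicator
        (fun t => ENNReal.ofReal (t ^ (p - 2))) t
      ≤ ENNReal.ofReal (2 ^ (p - 1) / (p - 1)) * y ^ p := by
  have hp1 : 0 < p - 1 := by linarith
  rcases eq_or_ne y ∞ with rfl | hy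
  · rw [ENNReal.top_rpow_of_pos (by linarith), ENNReal.mul_top]
    · exact le_top
    · simp only [ne_eq, ENNReal.ofReal_eq_zero, not_le]
      positivity
  lift y to ℝ≥0 using hy
  have hset : ∫⁻ t in Set.Ioi (0 : ℝ), {t : ℝ | ENNReal.ofReal (t / 2) < y}.indicator
        (fun t => ENNReal.ofReal (t ^ (p - 2))) t
      ≤ ∫⁻ t in Set.Ioo (0 : ℝ) (2 * y), ENNReal.ofReal (t ^ (p - 2)) := by
    rw [← lintegral_indicator measurableSet_Ioi, ← lintegral_indicator measurableSet_Ioo]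
    refine lintegral_mono fun t => ?_
    by_cases h0 : 0 < t
    · by_cases h1 : ENNReal.ofReal (t / 2) < y
      · have h2 : t < 2 * y := by
          rw [ENNReal.ofReal_lt_coe_iff (by positivity)] at h1
          linarith
        simp [Set.indicator, h0, h1, h2]
      · simp [Set.indicator, h1]
    · simp [Set.indicator, h0]
  rw [setLIntegral_Ioo_rpow (by linarith) (by positivity)] at hset
  refine (mul_le_mul_right hset _).trans (le_of_eq ?_)
  rw [show p - 2 + 1 = p - 1 by ring, Real.mul_rpow (by norm_num) (by positivity),
    ← ENNReal.ofReal_coe_nnreal, ← ENNReal.ofReal_mul (by positivity),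
    ENNReal.ofReal_rpow_of_nonneg (by positivity) (by linarith),
    ← ENNReal.ofReal_mul (by positivity)]
  congr 1
  have : (y : ℝ) ^ p = y * (y : ℝ) ^ (p - 1) := by
    rw [show p = 1 + (p - 1) by ring, Real.rpow_add_of_nonneg (by positivity) (by norm_num) hp1.le,
      Real.rpow_one]
    ring_nf
  rw [this]
  ring

/-- The Hardy–Littlewood maximal theorem on the line. -/
theorem lintegral_intervalMax_rpow_le {p : ℝ} (hp : 1 < p) :
    ∃ C : ℝ≥0, ∀ w : ℝ → ℝ≥0∞, Measurable w →
      ∫⁻ x, intervalMax w x x ^ p ≤ C * ∫⁻ x, w x ^ p := by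
  refine ⟨p.toNNReal * (8 * (2 ^ (p - 1) / (p - 1)).toNNReal), fun w hw => ?_⟩
  have hM : Measurable fun x => intervalMax w x x :=
    (measurable_intervalMax w).comp (measurable_id.prodMk measurable_id)
  refine lintegral_rpow_le_of_forall_min hM (by linarith) fun N => ?_
  set f : ℝ → ℝ := fun x => (min (intervalMax w x x) N).toReal with hf
  have hne : ∀ x, min (intervalMax w x x) (N : ℝ≥0∞) ≠ ∞ := fun x =>
    ne_top_of_le_ne_top (ENNReal.natCast_ne_top N) (min_le_right _ _)
  have hfm : Measurable f := (hM.min measurable_const).ennreal_toReal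
  have h1 : ∫⁻ x, min (intervalMax w x x) N ^ p = ∫⁻ x, ENNReal.ofReal (f x ^ p) := by
    refine lintegral_congr fun x => ?_
    rw [← ENNReal.ofReal_rpow_of_nonneg ENNReal.toReal_nonneg (by linarith),
      ENNReal.ofReal_toReal (hne x)]
  rw [h1, lintegral_rpow_eq_lintegral_meas_lt_mul volume
    (Filter.Eventually.of_forall fun x => ENNReal.toReal_nonneg) hfm.aemeasurable (by linarith)]
  -- Split t^(p-1) as (t/2) · 2t^(p-2): the first factor is absorbed by the weak-type bound at level
  -- t/2, the second is left for Tonelli.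
  have h2 : ∀ t ∈ Set.Ioi (0 : ℝ), volume {x | t < f x} * ENNReal.ofReal (t ^ (p - 1)) ≤
      8 * ∫⁻ x, w x * {t : ℝ | ENNReal.ofReal (t / 2) < w x}.indicator
        (fun t => ENNReal.ofReal (t ^ (p - 2))) t := by
    intro t ht
    have ht' : (0 : ℝ) < t := ht
    have hsub : volume {x | t < f x} ≤
        volume {x | 2 * ENNReal.ofReal (t / 2) < intervalMax w x x} := by
      refine measure_mono fun x hx => ?_
      have hx' : t < (min (intervalMax w x x) N).toReal := hx
      rw [← ENNReal.ofReal_lt_iff_lt_toReal ht'.le (hne x)] at hx'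
      have : (2 : ℝ≥0∞) * ENNReal.ofReal (t / 2) = ENNReal.ofReal t := by
        rw [← ENNReal.ofReal_ofNat, ← ENNReal.ofReal_mul (by norm_num)]
        congr 1
        ring
      simpa [this] using hx'.trans_le (min_le_left _ _)
    have hpow : t ^ (p - 1) = (t / 2) * (2 * t ^ (p - 2)) := by
      rw [show p - 1 = 1 + (p - 2) by ring, Real.rpow_add ht', Real.rpow_one]
      ring
    calc volume {x | t < f x} * ENNReal.ofReal (t ^ (p - 1))
        ≤ volume {x | 2 * ENNReal.ofReal (t / 2) < intervalMax w x x}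
            * ENNReal.ofReal (t ^ (p - 1)) := by gcongr
      _ = (ENNReal.ofReal (t / 2)
            * volume {x | 2 * ENNReal.ofReal (t / 2) < intervalMax w x x})
            * (2 * ENNReal.ofReal (t ^ (p - 2))) := by
          rw [hpow, ENNReal.ofReal_mul (by positivity), ENNReal.ofReal_mul (by norm_num),
            ENNReal.ofReal_ofNat]
          ring
      _ ≤ (4 * ∫⁻ x in {x | ENNReal.ofReal (t / 2) < w x}, w x)
            * (2 * ENNReal.ofReal (t ^ (p - 2))) := by
          exact mul_le_mul' (mul_volume_two_mul_lt_intervalMax_le w hw _ ENNReal.ofReal_ne_top)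
            le_rfl
      _ = 8 * ((∫⁻ x in {x | ENNReal.ofReal (t / 2) < w x}, w x)
            * ENNReal.ofReal (t ^ (p - 2))) := by ring
      _ = _ := by
          rw [← lintegral_mul_const _ hw,
            ← lintegral_indicator (measurableSet_lt measurable_const hw)]
          congr 2
          ext x
          by_cases hx : ENNReal.ofReal (t / 2) < w x <;> simp [Set.indicator, hx]
  have hmeas : Measurable (Function.uncurry fun (t x : ℝ) =>
      w x * {t : ℝ | ENNReal.ofReal (t / 2) < w x}.indicator
        (fun t => ENNReal.ofReal (t ^ (p - 2))) t) := by
    refine (hw.comp measurable_snd).mul ?_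
    have : (fun q : ℝ × ℝ => {t : ℝ | ENNReal.ofReal (t / 2) < w q.2}.indicator
        (fun t => ENNReal.ofReal (t ^ (p - 2))) q.1) =
        {q : ℝ × ℝ | ENNReal.ofReal (q.1 / 2) < w q.2}.indicator
          (fun q => ENNReal.ofReal (q.1 ^ (p - 2))) := by
      ext q
      simp [Set.indicator]
    rw [this]
    refine Measurable.indicator (by fun_prop) (measurableSet_lt (by fun_prop) (by fun_prop))
  calc ENNReal.ofReal p * ∫⁻ t in Set.Ioi 0, volume {x | t < f x} * ENNReal.ofReal (t ^ (p - 1))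
      ≤ ENNReal.ofReal p * ∫⁻ t in Set.Ioi (0 : ℝ), 8 * ∫⁻ x, w x *
          {t : ℝ | ENNReal.ofReal (t / 2) < w x}.indicator
            (fun t => ENNReal.ofReal (t ^ (p - 2))) t := by
        gcongr ENNReal.ofReal p * ?_
        exact setLIntegral_mono' measurableSet_Ioi h2
    _ = ENNReal.ofReal p * (8 * ∫⁻ x, w x * ∫⁻ t in Set.Ioi (0 : ℝ),
          {t : ℝ | ENNReal.ofReal (t / 2) < w x}.indicator
            (fun t => ENNReal.ofReal (t ^ (p - 2))) t) := by
        rw [lintegral_const_mul' _ _ (by norm_num), lintegral_lintegral_swap hmeas.aemeasurable]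
        congr 3
        ext x
        rw [lintegral_const_mul]
        exact Measurable.indicator (by fun_prop)
          (measurableSet_lt (by fun_prop) measurable_const)
    _ ≤ ENNReal.ofReal p * (8 * ∫⁻ x, ENNReal.ofReal (2 ^ (p - 1) / (p - 1)) * w x ^ p) := by
        refine mul_le_mul' le_rfl (mul_le_mul' le_rfl (lintegral_mono fun x => ?_))
        exact mul_lintegral_Ioi_indicator_rpow_le hp (w x)
    _ = _ := by
        rw [lintegral_const_mul _ (hw.pow_const p)]
        simp only [ENNReal.ofReal, ENNReal.coe_mul, ENNReal.coe_ofNat]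
        ring

end MultilinearMarcinkiewicz

/-! ### Dilations and telescoping for dt/t; elementary integral inequalities. -/

namespace MultilinearMarcinkiewicz

lemma lintegral_comp_const_mul {c : ℝ} (hc : 0 < c) (g : ℝ → ℝ≥0∞) :
    ∫⁻ t, g (c * t) = ENNReal.ofReal c⁻¹ * ∫⁻ t, g t := by
  have h := lintegral_map_equiv (μ := (volume : Measure ℝ)) g
    (Homeomorph.mulLeft₀ c hc.ne').toMeasurableEquiv
  have h2 : Measure.map (Homeomorph.mulLeft₀ c hc.ne').toMeasurableEquiv (volume : Measure ℝ)
      = ENNReal.ofReal |c⁻¹| • volume := Real.map_volume_mul_left hc.ne'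
  rw [h2, lintegral_smul_measure, abs_of_pos (inv_pos.2 hc)] at h
  exact h.symm

lemma lintegral_Ioi_comp_const_mul_div {c : ℝ} (hc : 0 < c) (g : ℝ → ℝ≥0∞) :
    ∫⁻ t in Set.Ioi (0 : ℝ), g (c * t) / ENNReal.ofReal t
      = ∫⁻ t in Set.Ioi (0 : ℝ), g t / ENNReal.ofReal t := by
  rw [← lintegral_indicator measurableSet_Ioi, ← lintegral_indicator measurableSet_Ioi]
  have h := lintegral_comp_const_mul hc
    ((Set.Ioi (0 : ℝ)).indicator fun t => g t / ENNReal.ofReal t)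
  have hc0 : ENNReal.ofReal c ≠ 0 := by simpa using hc
  have h2 : ∀ t, (Set.Ioi (0 : ℝ)).indicator (fun t => g (c * t) / ENNReal.ofReal t) t
      = ENNReal.ofReal c * (Set.Ioi (0 : ℝ)).indicator
        (fun t => g t / ENNReal.ofReal t) (c * t) := by
    intro t
    by_cases ht : 0 < t
    · have : 0 < c * t := by positivity
      simp only [Set.indicator, Set.mem_Ioi, ht, this, if_true]
      rw [ENNReal.ofReal_mul hc.le, ← mul_div_assoc,
        ENNReal.mul_div_mul_left _ _ hc0 ENNReal.ofReal_ne_top]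
    · have : ¬ 0 < c * t := by
        rw [mul_pos_iff_of_pos_left hc]
        exact ht
      simp [Set.indicator, ht, this]
  simp_rw [h2]
  rw [lintegral_const_mul' _ _ ENNReal.ofReal_ne_top, h, ← mul_assoc,
    ← ENNReal.ofReal_mul hc.le, mul_inv_cancel₀ hc.ne', ENNReal.ofReal_one, one_mul]

lemma setLIntegral_Ioc_div_le {E : ℝ → ℝ≥0∞} {K : ℝ≥0∞} (hK : ∀ t, 0 < t → E t ≤ K) {a b : ℝ}
    (ha : 0 < a) :
    ∫⁻ t in Set.Ioc a b, E t / ENNReal.ofReal t ≤ K * ENNReal.ofReal ((b - a) / a) := by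
  calc ∫⁻ t in Set.Ioc a b, E t / ENNReal.ofReal t
      ≤ ∫⁻ _ in Set.Ioc a b, K / ENNReal.ofReal a :=
        setLIntegral_mono' measurableSet_Ioc fun t ht =>
          ENNReal.div_le_div (hK t (ha.trans ht.1)) (ENNReal.ofReal_le_ofReal ht.1.le)
    _ = _ := by
        rw [setLIntegral_const, Real.volume_Ioc, ENNReal.ofReal_div_of_pos ha, div_eq_mul_inv,
          div_eq_mul_inv]
        ring

/-- If `D t ≤ E t - E (2 t)` then `∫ D dt / t` telescopes. -/
lemma lintegral_Ioi_div_le_of_telescope {D E : ℝ → ℝ≥0∞} (hD : Measurable D) (hE : Measurable E)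
    {K : ℝ≥0∞} (h : ∀ t, 0 < t → D t + E (2 * t) ≤ E t) (hK : ∀ t, 0 < t → E t ≤ K) :
    ∫⁻ t in Set.Ioi (0 : ℝ), D t / ENNReal.ofReal t ≤ K := by
  rcases eq_or_ne K ∞ with rfl | hKtop
  · exact le_top
  -- Work on compact ranges of scales, where the integral of `E` is finite and can be subtracted.
  have hunion : ⋃ N : ℕ, Set.Ioc (1 / ((N : ℝ) + 1)) (N : ℝ) = Set.Ioi 0 := by
    ext t
    simp only [Set.mem_iUnion, Set.mem_Ioc, Set.mem_Ioi]
    constructor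
    · rintro ⟨N, h1, -⟩
      exact lt_trans (by positivity) h1
    · intro ht
      obtain ⟨N1, hN1⟩ := exists_nat_one_div_lt ht
      obtain ⟨N2, hN2⟩ := exists_nat_ge t
      refine ⟨max N1 N2, lt_of_le_of_lt ?_ hN1, hN2.trans (by exact_mod_cast le_max_right _ _)⟩
      gcongr
      exact le_max_left _ _
  rw [← hunion, setLIntegral_iUnion_of_directed]
  swap
  · refine Monotone.directed_le fun m n hmn => Set.Ioc_subset_Ioc ?_ ?_
    · gcongr
    · exact_mod_cast hmn
  refine iSup_le fun N => ?_
  set a : ℝ := 1 / ((N : ℝ) + 1) with ha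
  have hapos : 0 < a := by positivity
  set b : ℝ := (N : ℝ)
  have hmeas : Measurable fun t => E t / ENNReal.ofReal t := by fun_prop
  -- By dilation invariance of dt/t, the integral of E(2t) over (a, b] dominates that of `E` over
  -- (2a, b], so after subtraction only (a, 2a] remains.
  have hscale : ∫⁻ t in Set.Ioc (2 * a) b, E t / ENNReal.ofReal t
      ≤ ∫⁻ t in Set.Ioc a b, E (2 * t) / ENNReal.ofReal t := by
    have h1 := lintegral_Ioi_comp_const_mul_div (c := 2) (by norm_num)
      ((Set.Ioc (2 * a) b).indicator E)
    have key : ∀ (s : Set ℝ) (g : ℝ → ℝ≥0∞), MeasurableSet s → s ⊆ Set.Ioi 0 →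
        ∫⁻ t in s, g t / ENNReal.ofReal t
          = ∫⁻ t in Set.Ioi (0 : ℝ), s.indicator g t / ENNReal.ofReal t := by
      intro s g hs hs0
      rw [← lintegral_indicator hs, ← lintegral_indicator measurableSet_Ioi]
      congr 1
      ext t
      by_cases hts : t ∈ s
      · have := hs0 hts
        simp [Set.indicator, hts, Set.mem_Ioi.1 this]
      · simp [Set.indicator, hts]
    rw [key _ _ measurableSet_Ioc (fun t ht => lt_trans (by positivity : 0 < 2 * a) ht.1), ← h1,
      key _ (fun t => E (2 * t)) measurableSet_Ioc (fun t ht => hapos.trans ht.1)]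
    refine setLIntegral_mono' measurableSet_Ioi fun t ht => ?_
    have ht' : (0 : ℝ) < t := ht
    gcongr ?_ / _
    by_cases h2 : 2 * t ∈ Set.Ioc (2 * a) b
    · have : t ∈ Set.Ioc a b := ⟨by linarith [h2.1], by linarith [h2.2]⟩
      simp only [Set.indicator, h2, this, if_true]
      exact le_rfl
    · simp [Set.indicator, h2]
  have hfin : ∫⁻ t in Set.Ioc (2 * a) b, E t / ENNReal.ofReal t ≠ ∞ :=
    ne_top_of_le_ne_top (ENNReal.mul_ne_top hKtop ENNReal.ofReal_ne_top)
      (setLIntegral_Ioc_div_le hK (by positivity))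
  have hsplit : ∫⁻ t in Set.Ioc a b, E t / ENNReal.ofReal t
      ≤ (∫⁻ t in Set.Ioc a (2 * a), E t / ENNReal.ofReal t)
        + ∫⁻ t in Set.Ioc (2 * a) b, E t / ENNReal.ofReal t := by
    refine (lintegral_mono_set (t := Set.Ioc a (2 * a) ∪ Set.Ioc (2 * a) b) fun t ht => ?_).trans
      (lintegral_union_le _ _ _)
    rcases le_or_gt t (2 * a) with h1 | h1
    · exact Or.inl ⟨ht.1, h1⟩
    · exact Or.inr ⟨h1, ht.2⟩
  -- Replacing 1/t by 1/a on (a, 2a] costs exactly (2a - a)/a = 1, so the constant is `K` itself.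
  have hfirst : ∫⁻ t in Set.Ioc a (2 * a), E t / ENNReal.ofReal t ≤ K := by
    refine (setLIntegral_Ioc_div_le hK hapos).trans (le_of_eq ?_)
    rw [show (2 * a - a) / a = 1 by field_simp; ring]
    simp
  have hsum : (∫⁻ t in Set.Ioc a b, D t / ENNReal.ofReal t)
      + ∫⁻ t in Set.Ioc a b, E (2 * t) / ENNReal.ofReal t
      ≤ ∫⁻ t in Set.Ioc a b, E t / ENNReal.ofReal t := by
    rw [← lintegral_add_left (by fun_prop)]
    refine setLIntegral_mono' measurableSet_Ioc fun t ht => ?_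
    rw [← ENNReal.add_div]
    gcongr
    exact h t (hapos.trans ht.1)
  refine (ENNReal.add_le_add_iff_right hfin).1 ?_
  calc _ ≤ _ := add_le_add le_rfl hscale
    _ ≤ _ := hsum
    _ ≤ _ := hsplit
    _ ≤ _ := add_le_add hfirst le_rfl

/-- Hölder against the constant 1. The measure is general because it will be Lebesgue measure on an
interval, a geometric weight on ℕ, or the sphere measure. -/
lemma lintegral_rpow_le_measure_mul {α : Type*} [MeasurableSpace α] {μ : Measure α}
    {g : α → ℝ≥0∞} (hg : AEMeasurable g μ) {p : ℝ} (hp : 1 ≤ p) :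
    (∫⁻ x, g x ∂μ) ^ p ≤ μ Set.univ ^ (p - 1) * ∫⁻ x, g x ^ p ∂μ := by
  have hp0 : 0 < p := by linarith
  have h := ENNReal.lintegral_mul_norm_pow_le (hg.pow_const p)
    (aemeasurable_const (b := (1 : ℝ≥0∞))) (p := 1 / p) (q := 1 - 1 / p) (by positivity)
    (by rw [sub_nonneg, div_le_one hp0]; exact hp) (by ring)
  have h1 : ∀ x, (g x ^ p) ^ (1 / p) * (1 : ℝ≥0∞) ^ (1 - 1 / p) = g x := by
    intro x
    rw [← ENNReal.rpow_mul, mul_one_div_cancel hp0.ne', ENNReal.rpow_one, ENNReal.one_rpow, mul_one]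
  simp_rw [h1] at h
  rw [lintegral_const, one_mul] at h
  calc _ ≤ _ := ENNReal.rpow_le_rpow h hp0.le
    _ = _ := by
      rw [ENNReal.mul_rpow_of_nonneg _ _ hp0.le, ← ENNReal.rpow_mul, ← ENNReal.rpow_mul,
        one_div_mul_cancel hp0.ne', ENNReal.rpow_one, mul_comm]
      congr 2
      field_simp

lemma setLIntegral_Icc_rpow_le {g : ℝ → ℝ≥0∞} (hg : Measurable g) {p : ℝ} (hp : 1 ≤ p) {a b : ℝ} :
    (∫⁻ z in Set.Icc a b, g z) ^ p
      ≤ ENNReal.ofReal (b - a) ^ (p - 1) * ∫⁻ z in Set.Icc a b, g z ^ p := by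
  simpa using lintegral_rpow_le_measure_mul (μ := volume.restrict (Set.Icc a b))
    hg.aemeasurable hp

lemma lintegral_setLIntegral_Icc_mul {g v : ℝ → ℝ≥0∞} (hg : Measurable g) (hv : Measurable v)
    (a b : ℝ) :
    ∫⁻ x, (∫⁻ z in Set.Icc (x + a) (x + b), g z) * v x
      = ∫⁻ z, g z * ∫⁻ x in Set.Icc (z - b) (z - a), v x := by
  have hset : MeasurableSet {q : ℝ × ℝ | q.2 ∈ Set.Icc (q.1 + a) (q.1 + b)} :=
    (measurableSet_le (f := fun q : ℝ × ℝ => q.1 + a) (by fun_prop) measurable_snd).inter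
      (measurableSet_le (g := fun q : ℝ × ℝ => q.1 + b) measurable_snd (by fun_prop))
  have h1 : ∀ x, (∫⁻ z in Set.Icc (x + a) (x + b), g z) * v x
      = ∫⁻ z, {q : ℝ × ℝ | q.2 ∈ Set.Icc (q.1 + a) (q.1 + b)}.indicator
          (fun q => g q.2 * v q.1) (x, z) := by
    intro x
    rw [← lintegral_mul_const _ hg, ← lintegral_indicator measurableSet_Icc]
    rfl
  have h2 : ∀ z, g z * ∫⁻ x in Set.Icc (z - b) (z - a), v x
      = ∫⁻ x, {q : ℝ × ℝ | q.2 ∈ Set.Icc (q.1 + a) (q.1 + b)}.indicator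
          (fun q => g q.2 * v q.1) (x, z) := by
    intro z
    rw [← lintegral_const_mul _ hv, ← lintegral_indicator measurableSet_Icc]
    congr 1
    ext x
    have : x ∈ Set.Icc (z - b) (z - a) ↔ z ∈ Set.Icc (x + a) (x + b) := by
      simp only [Set.mem_Icc]
      constructor <;> rintro ⟨h, h'⟩ <;> constructor <;> linarith
    simp only [Set.indicator, this, Set.mem_ofPred_eq]
  simp_rw [h1, h2]
  rw [lintegral_lintegral_swap]
  refine Measurable.aemeasurable (Measurable.indicator ?_ hset)
  fun_prop

end MultilinearMarcinkiewicz

/-! ### Difference quotients, second differences and uniform convexity. -/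

namespace MultilinearMarcinkiewicz

/-- The symmetric second difference `F (x + t) + F (x - t) - 2 F x`. -/
def secondDiff (F : ℝ → ℂ) (t x : ℝ) : ℂ := F (x + t) + F (x - t) - 2 * F x

/-- The size of the difference quotient `(F (x + t) - F x) / t`. -/
noncomputable def diffQuot (F : ℝ → ℂ) (t x : ℝ) : ℝ≥0∞ := ‖F (x + t) - F x‖ₑ / ENNReal.ofReal t

/-- The size of `secondDiff F t x / t`. -/
noncomputable def secondQuot (F : ℝ → ℂ) (t x : ℝ) : ℝ≥0∞ := ‖secondDiff F t x‖ₑ / ENNReal.ofReal t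

/-- The square of Marcinkiewicz's function on the line,
`∫_0^∞ |F (x + t) + F (x - t) - 2 F x|² dt / t³`. -/
noncomputable def sqFn (F : ℝ → ℂ) (x : ℝ) : ℝ≥0∞ :=
  ∫⁻ t in Set.Ioi (0 : ℝ), secondQuot F t x ^ 2 / ENNReal.ofReal t

/-- `g` controls the increments of the continuous function `F`. -/
structure IncrementBound (F : ℝ → ℂ) (g : ℝ → ℝ≥0∞) : Prop where
  continuous : Continuous F
  measurable : Measurable g
  le : ∀ x y, x ≤ y → ‖F y - F x‖ₑ ≤ ∫⁻ z in Set.Icc x y, g z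

section Measurability

variable {F : ℝ → ℂ} {α : Type*} [MeasurableSpace α] {u v : α → ℝ}

lemma measurable_secondDiff (hF : Continuous F) (hu : Measurable u) (hv : Measurable v) :
    Measurable fun a => secondDiff F (u a) (v a) :=
  ((hF.measurable.comp (hv.add hu)).add (hF.measurable.comp (hv.sub hu))).sub
    ((hF.measurable.comp hv).const_mul 2)

lemma measurable_secondQuot (hF : Continuous F) (hu : Measurable u) (hv : Measurable v) :
    Measurable fun a => secondQuot F (u a) (v a) :=
  (measurable_secondDiff hF hu hv).enorm.div hu.ennreal_ofReal

lemma measurable_diffQuot (hF : Continuous F) (hu : Measurable u) (hv : Measurable v) :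
    Measurable fun a => diffQuot F (u a) (v a) :=
  ((hF.measurable.comp (hv.add hu)).sub (hF.measurable.comp hv)).enorm.div hu.ennreal_ofReal

lemma measurable_sqFn (hF : Continuous F) : Measurable (sqFn F) :=
  (((measurable_secondQuot hF measurable_snd measurable_fst).pow_const 2).div
    measurable_snd.ennreal_ofReal).lintegral_prod_right' (ν := volume.restrict (Set.Ioi (0 : ℝ)))

end Measurability

/-- The second derivative is p(p - 1)(r^(p-2) - M^(p-2)), nonnegative for r < M because p - 2 ≤ 0.
-/
lemma convexOn_rpow_sub_sq {p M : ℝ} (hp : 1 < p) (hp2 : p ≤ 2) :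
    ConvexOn ℝ (Set.Icc 0 M) (fun r : ℝ => r ^ p - p * (p - 1) / 2 * M ^ (p - 2) * r ^ 2) := by
  have hcont : ContinuousOn (fun r : ℝ => r ^ p - p * (p - 1) / 2 * M ^ (p - 2) * r ^ 2)
      (Set.Icc 0 M) :=
    ((Real.continuous_rpow_const (by linarith)).sub (by fun_prop)).continuousOn
  refine convexOn_of_hasDerivWithinAt2_nonneg (convex_Icc _ _) hcont
    (f' := fun r => p * r ^ (p - 1) - p * (p - 1) * M ^ (p - 2) * r)
    (f'' := fun r => p * ((p - 1) * r ^ (p - 2)) - p * (p - 1) * M ^ (p - 2)) ?_ ?_ ?_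
  · intro r hr
    rw [interior_Icc] at hr
    have h1 := Real.hasDerivAt_rpow_const (x := r) (p := p) (Or.inl hr.1.ne')
    have h2 := (hasDerivAt_pow 2 r).const_mul (p * (p - 1) / 2 * M ^ (p - 2))
    refine ((h1.sub h2).congr_deriv ?_).hasDerivWithinAt
    simp
    ring
  · intro r hr
    rw [interior_Icc] at hr
    have h1 := (Real.hasDerivAt_rpow_const (x := r) (p := p - 1) (Or.inl hr.1.ne')).const_mul p
    have h2 := (hasDerivAt_id r).const_mul (p * (p - 1) * M ^ (p - 2))
    refine ((h1.sub h2).congr_deriv ?_).hasDerivWithinAt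
    rw [show p - 1 - 1 = p - 2 by ring]
    ring
  · intro r hr
    rw [interior_Icc] at hr
    have : M ^ (p - 2) ≤ r ^ (p - 2) :=
      Real.rpow_le_rpow_of_nonpos hr.1 hr.2.le (by linarith)
    have h3 : 0 ≤ p * (p - 1) := by nlinarith
    nlinarith

/-- Needed besides convexity because the norm of a midpoint may be smaller than the mean of the
norms. The derivative is p·r·(r^(p-2) - (p - 1)M^(p-2)), and p - 1 ≤ 1. -/
lemma monotoneOn_rpow_sub_sq {p M : ℝ} (hp : 1 < p) (hp2 : p ≤ 2) :
    MonotoneOn (fun r : ℝ => r ^ p - p * (p - 1) / 2 * M ^ (p - 2) * r ^ 2) (Set.Icc 0 M) := by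
  have hcont : ContinuousOn (fun r : ℝ => r ^ p - p * (p - 1) / 2 * M ^ (p - 2) * r ^ 2)
      (Set.Icc 0 M) :=
    ((Real.continuous_rpow_const (by linarith)).sub (by fun_prop)).continuousOn
  refine monotoneOn_of_hasDerivWithinAt_nonneg (convex_Icc _ _) hcont
    (f' := fun r => p * r ^ (p - 1) - p * (p - 1) * M ^ (p - 2) * r) ?_ ?_
  · intro r hr
    rw [interior_Icc] at hr
    have h1 := Real.hasDerivAt_rpow_const (x := r) (p := p) (Or.inl hr.1.ne')
    have h2 := (hasDerivAt_pow 2 r).const_mul (p * (p - 1) / 2 * M ^ (p - 2))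
    refine ((h1.sub h2).congr_deriv ?_).hasDerivWithinAt
    simp
    ring
  · intro r hr
    rw [interior_Icc] at hr
    have h1 : M ^ (p - 2) ≤ r ^ (p - 2) :=
      Real.rpow_le_rpow_of_nonpos hr.1 hr.2.le (by linarith)
    have h2 : r ^ (p - 1) = r ^ (p - 2) * r := by
      rw [show p - 1 = (p - 2) + 1 by ring, Real.rpow_add hr.1, Real.rpow_one]
    have h3 : 0 ≤ M ^ (p - 2) := Real.rpow_nonneg (hr.1.le.trans hr.2.le) _
    have h4 : (p - 1) * M ^ (p - 2) ≤ r ^ (p - 2) := by nlinarith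
    rw [h2]
    have := mul_nonneg (mul_nonneg (by linarith : (0 : ℝ) ≤ p) hr.1.le) (sub_nonneg.2 h4)
    nlinarith

/-- Uniform convexity of `|z|^p` on the disc of radius `M`, for `1 < p ≤ 2`. -/
lemma sq_norm_sub_le_rpow_mul {p M : ℝ} (hp : 1 < p) (hp2 : p ≤ 2) (hM : 0 < M) {a b : ℂ}
    (ha : ‖a‖ ≤ M) (hb : ‖b‖ ≤ M) :
    p * (p - 1) / 4 * ‖a - b‖ ^ 2
      ≤ M ^ (2 - p) * (‖a‖ ^ p + ‖b‖ ^ p - 2 * ‖(a + b) / 2‖ ^ p) := by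
  have hcv := convexOn_rpow_sub_sq (M := M) hp hp2
  have hmo := monotoneOn_rpow_sub_sq (M := M) hp hp2
  have hmid : (1 / 2 : ℝ) * ‖a‖ + (1 / 2) * ‖b‖ ∈ Set.Icc 0 M :=
    ⟨by positivity, by linarith⟩
  have hnorm : ‖(a + b) / 2‖ ≤ (1 / 2 : ℝ) * ‖a‖ + (1 / 2) * ‖b‖ := by
    rw [norm_div]
    have := norm_add_le a b
    simp only [Complex.norm_ofNat]
    linarith
  have h1 := hmo (⟨by positivity, hnorm.trans hmid.2⟩ : ‖(a + b) / 2‖ ∈ Set.Icc 0 M) hmid hnorm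
  have h2 := hcv.2 (⟨by positivity, ha⟩ : ‖a‖ ∈ Set.Icc 0 M)
    (⟨by positivity, hb⟩ : ‖b‖ ∈ Set.Icc 0 M) (by norm_num : (0 : ℝ) ≤ 1 / 2)
    (by norm_num : (0 : ℝ) ≤ 1 / 2) (by norm_num)
  -- The parallelogram law gives |a|² + |b|² - 2|(a + b)/2|² = |a - b|²/2, which turns p(p - 1)/2
  -- into p(p - 1)/4.
  have hpar := parallelogram_law_with_norm ℝ a b
  have hmul : M ^ (2 - p) * M ^ (p - 2) = 1 := by
    rw [← Real.rpow_add hM]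
    simp
  have hsq : ‖(a + b) / 2‖ ^ 2 = ‖a + b‖ ^ 2 / 4 := by
    rw [norm_div]
    simp only [Complex.norm_ofNat]
    ring
  simp only [smul_eq_mul] at h1 h2
  rw [hsq] at h1
  have h3 : p * (p - 1) / 4 * M ^ (p - 2) * ‖a - b‖ ^ 2
      ≤ ‖a‖ ^ p + ‖b‖ ^ p - 2 * ‖(a + b) / 2‖ ^ p := by
    have h4 : ‖a + b‖ ^ 2 = 2 * ‖a‖ ^ 2 + 2 * ‖b‖ ^ 2 - ‖a - b‖ ^ 2 := by nlinarith
    rw [h4] at h1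
    nlinarith
  calc p * (p - 1) / 4 * ‖a - b‖ ^ 2
      = M ^ (2 - p) * (p * (p - 1) / 4 * M ^ (p - 2) * ‖a - b‖ ^ 2) := by
        linear_combination (-(p * (p - 1) / 4 * ‖a - b‖ ^ 2)) * hmul
    _ ≤ _ := mul_le_mul_of_nonneg_left h3 (by positivity)

variable {F : ℝ → ℂ} {g : ℝ → ℝ≥0∞}

lemma IncrementBound.diffQuot_le (h : IncrementBound F g) {t : ℝ} (ht : 0 < t) {x y : ℝ}
    (hxy : x ≤ y) (hyx : y ≤ x + t) : diffQuot F t x ≤ 3 * intervalMax g y y := by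
  have h0 : ENNReal.ofReal t ≠ 0 := by simpa using ht
  rw [diffQuot, ENNReal.div_le_iff h0 ENNReal.ofReal_ne_top]
  refine (h.le x (x + t) (by linarith)).trans
    ((setLIntegral_Icc_le_intervalMax g (by linarith) hxy hyx).trans (le_of_eq ?_))
  rw [show 3 * (x + t - x) = 3 * t by ring, ENNReal.ofReal_mul (by norm_num), ENNReal.ofReal_ofNat]
  ring

/-- Jensen on [x, x + t], then Tonelli: the weight is replaced by its average over the `x` whose
interval contains `z`. -/
lemma IncrementBound.lintegral_diffQuot_rpow_le (h : IncrementBound F g) {p : ℝ} (hp : 1 ≤ p)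
    {v : ℝ → ℝ≥0∞} (hv : Measurable v) {t : ℝ} (ht : 0 < t) :
    ∫⁻ x, diffQuot F t x ^ p * v x
      ≤ ∫⁻ z, g z ^ p * ((∫⁻ x in Set.Icc (z - t) z, v x) / ENNReal.ofReal t) := by
  have h0 : ENNReal.ofReal t ≠ 0 := by simpa using ht
  have hbound : ∀ x, diffQuot F t x ^ p
      ≤ (∫⁻ z in Set.Icc (x + 0) (x + t), g z ^ p) / ENNReal.ofReal t := by
    intro x
    rw [diffQuot, ENNReal.div_rpow_of_nonneg _ _ (by linarith)]
    have h1 := ENNReal.rpow_le_rpow (h.le x (x + t) (by linarith)) (by linarith : 0 ≤ p)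
    have h2 := h1.trans (setLIntegral_Icc_rpow_le h.measurable hp)
    rw [add_sub_cancel_left] at h2
    rw [add_zero]
    refine (ENNReal.div_le_div_right h2 _).trans (le_of_eq ?_)
    have h3 : ENNReal.ofReal t ^ p = ENNReal.ofReal t ^ (p - 1) * ENNReal.ofReal t := by
      conv_lhs => rw [show p = (p - 1) + 1 by ring]
      rw [ENNReal.rpow_add_of_nonneg _ _ (by linarith) (by norm_num), ENNReal.rpow_one]
    rw [h3, ENNReal.mul_div_mul_left]
    · exact (ENNReal.rpow_pos (pos_iff_ne_zero.2 h0) ENNReal.ofReal_ne_top).ne'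
    · exact ENNReal.rpow_ne_top_of_nonneg (by linarith) ENNReal.ofReal_ne_top
  calc ∫⁻ x, diffQuot F t x ^ p * v x
      ≤ ∫⁻ x, (∫⁻ z in Set.Icc (x + 0) (x + t), g z ^ p) * (v x / ENNReal.ofReal t) := by
        refine lintegral_mono fun x => ?_
        calc _ ≤ _ := mul_le_mul' (hbound x) le_rfl
          _ = _ := by
            rw [div_eq_mul_inv, div_eq_mul_inv]
            ring
    _ = _ := by
        rw [lintegral_setLIntegral_Icc_mul (h.measurable.pow_const p) (by fun_prop)]
        congr 1
        ext z
        rw [sub_zero]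
        simp_rw [div_eq_mul_inv]
        rw [lintegral_mul_const _ hv]

end MultilinearMarcinkiewicz

/-! ### Marcinkiewicz's theorem for 1 < p ≤ 2. -/

namespace MultilinearMarcinkiewicz

lemma enorm_div_ofReal (z : ℂ) {t : ℝ} (ht : 0 < t) :
    ‖z / (t : ℂ)‖ₑ = ‖z‖ₑ / ENNReal.ofReal t := by
  rw [← ofReal_norm, norm_div, Complex.norm_real, Real.norm_of_nonneg ht.le,
    ENNReal.ofReal_div_of_pos ht, ofReal_norm]

lemma diffQuot_eq (F : ℝ → ℂ) {t : ℝ} (ht : 0 < t) (x : ℝ) :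
    diffQuot F t x = ‖(F (x + t) - F x) / (t : ℂ)‖ₑ := (enorm_div_ofReal _ ht).symm

lemma secondQuot_eq (F : ℝ → ℂ) {t : ℝ} (ht : 0 < t) (x : ℝ) :
    secondQuot F t x
      = ‖(F (x + t) - F x) / (t : ℂ) - (F x - F (x - t)) / (t : ℂ)‖ₑ := by
  rw [secondQuot, ← enorm_div_ofReal _ ht, secondDiff]
  congr 1
  ring

/-- The defect in the convexity inequality for `|·|^p` at the difference quotients of `F` over
`[x, x + t]` and `[x - t, x]`. -/
noncomputable def convexityDefect (F : ℝ → ℂ) (p t x : ℝ) : ℝ≥0∞ :=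
  ENNReal.ofReal (‖(F (x + t) - F x) / (t : ℂ)‖ ^ p + ‖(F x - F (x - t)) / (t : ℂ)‖ ^ p
    - 2 * ‖((F (x + t) - F x) / (t : ℂ) + (F x - F (x - t)) / (t : ℂ)) / 2‖ ^ p)

lemma measurable_convexityDefect {F : ℝ → ℂ} (hF : Continuous F) (p : ℝ) {α : Type*}
    [MeasurableSpace α] {u v : α → ℝ} (hu : Measurable u) (hv : Measurable v) :
    Measurable fun a => convexityDefect F p (u a) (v a) := by
  have h1 : Measurable fun a => F (v a + u a) := hF.measurable.comp (hv.add hu)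
  have h2 : Measurable fun a => F (v a - u a) := hF.measurable.comp (hv.sub hu)
  have h3 : Measurable fun a => F (v a) := hF.measurable.comp hv
  unfold convexityDefect
  fun_prop

lemma diffQuot_sub (F : ℝ → ℂ) {t : ℝ} (ht : 0 < t) (x : ℝ) :
    diffQuot F t (x - t) = ‖(F x - F (x - t)) / (t : ℂ)‖ₑ := by
  rw [diffQuot_eq F ht, sub_add_cancel]

lemma diffQuot_two_mul (F : ℝ → ℂ) {t : ℝ} (ht : 0 < t) (x : ℝ) :
    diffQuot F (2 * t) (x - t)
      = ‖((F (x + t) - F x) / (t : ℂ) + (F x - F (x - t)) / (t : ℂ)) / 2‖ₑ := by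
  rw [diffQuot_eq F (by positivity), show x - t + 2 * t = x + t by ring]
  congr 1
  have : (t : ℂ) ≠ 0 := by exact_mod_cast ht.ne'
  push_cast
  field_simp
  ring

/-- The midpoint of the two quotients at scale t is the quotient at scale 2t; this is what makes the
defect telescope. -/
lemma convexityDefect_add {F : ℝ → ℂ} {p : ℝ} (hp : 1 < p) (hp2 : p ≤ 2) {t : ℝ} (ht : 0 < t)
    (x : ℝ) :
    convexityDefect F p t x + 2 * diffQuot F (2 * t) (x - t) ^ p
      = diffQuot F t x ^ p + diffQuot F t (x - t) ^ p := by
  have hp0 : 0 ≤ p := by linarith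
  rw [diffQuot_two_mul F ht, diffQuot_sub F ht, diffQuot_eq F ht, convexityDefect]
  set a := (F (x + t) - F x) / (t : ℂ)
  set b := (F x - F (x - t)) / (t : ℂ)
  have hM : 0 < ‖a‖ + ‖b‖ + 1 := by positivity
  have h := sq_norm_sub_le_rpow_mul hp hp2 hM (a := a) (b := b)
    (by linarith [norm_nonneg b]) (by linarith [norm_nonneg a])
  -- Nonnegativity of the defect ensures that `ENNReal.ofReal` truncates nothing, so equality holds.
  have h0 : 0 ≤ ‖a‖ ^ p + ‖b‖ ^ p - 2 * ‖(a + b) / 2‖ ^ p := by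
    refine nonneg_of_mul_nonneg_right (a := (‖a‖ + ‖b‖ + 1) ^ (2 - p)) (le_trans ?_ h) (by positivity)
    have : 0 ≤ p * (p - 1) := mul_nonneg hp0 (by linarith)
    positivity
  simp_rw [← ofReal_norm, ENNReal.ofReal_rpow_of_nonneg (norm_nonneg _) hp0]
  rw [← ENNReal.ofReal_ofNat, ← ENNReal.ofReal_mul (by norm_num),
    ← ENNReal.ofReal_add h0 (by positivity), ← ENNReal.ofReal_add (by positivity) (by positivity)]
  congr 1
  ring

lemma secondQuot_sq_le {F : ℝ → ℂ} {p : ℝ} (hp : 1 < p) (hp2 : p ≤ 2) {t : ℝ} (ht : 0 < t)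
    (x : ℝ) {M : ℝ≥0∞} (hM : M ≠ ∞) (ha : diffQuot F t x ≤ M) (hb : diffQuot F t (x - t) ≤ M) :
    secondQuot F t x ^ 2
      ≤ ENNReal.ofReal (4 / (p * (p - 1))) * M ^ (2 - p) * convexityDefect F p t x := by
  rw [diffQuot_sub F ht] at hb
  rw [diffQuot_eq F ht] at ha
  rw [secondQuot_eq F ht, convexityDefect]
  set a := (F (x + t) - F x) / (t : ℂ)
  set b := (F x - F (x - t)) / (t : ℂ)
  lift M to ℝ≥0 using hM
  rcases eq_or_ne M 0 with rfl | hM0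
  · simp only [ENNReal.coe_zero, nonpos_iff_eq_zero, enorm_eq_zero] at ha hb
    simp [ha, hb]
  have hMpos : (0 : ℝ) < M := by
    have := pos_iff_ne_zero.2 hM0
    exact_mod_cast this
  have ha' : ‖a‖ ≤ M := by exact_mod_cast enorm_le_coe.1 ha
  have hb' : ‖b‖ ≤ M := by exact_mod_cast enorm_le_coe.1 hb
  have h := sq_norm_sub_le_rpow_mul hp hp2 hMpos ha' hb'
  have hpp : 0 < p * (p - 1) := mul_pos (by linarith) (by linarith)
  rw [← ofReal_norm, ← ENNReal.ofReal_pow (norm_nonneg _), ← ENNReal.ofReal_coe_nnreal,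
    ENNReal.ofReal_rpow_of_pos hMpos, ← ENNReal.ofReal_mul (by positivity),
    ← ENNReal.ofReal_mul (by positivity)]
  apply ENNReal.ofReal_le_ofReal
  rw [div_mul_eq_mul_div, div_mul_eq_mul_div, le_div_iff₀ hpp]
  nlinarith

variable {F : ℝ → ℂ} {g : ℝ → ℝ≥0∞}

lemma IncrementBound.lintegral_diffQuot_rpow_le' (h : IncrementBound F g) {p : ℝ} (hp : 1 ≤ p)
    {t : ℝ} (ht : 0 < t) : ∫⁻ x, diffQuot F t x ^ p ≤ ∫⁻ z, g z ^ p := by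
  have h1 := h.lintegral_diffQuot_rpow_le hp (v := fun _ => 1) measurable_const ht
  have h0 : ENNReal.ofReal t ≠ 0 := by simpa using ht
  simpa [ENNReal.div_self h0 ENNReal.ofReal_ne_top] using h1

/-- By translation invariance both quotients at scale t have the same p-th power integral, so the
integrated defect is E(t) - E(2t) with E(t) twice that integral, and E is bounded by 2 ∫ g^p. -/
lemma IncrementBound.lintegral_convexityDefect_le (h : IncrementBound F g) {p : ℝ} (hp : 1 < p)
    (hp2 : p ≤ 2) :
    ∫⁻ x, ∫⁻ t in Set.Ioi (0 : ℝ), convexityDefect F p t x / ENNReal.ofReal t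
      ≤ 2 * ∫⁻ z, g z ^ p := by
  have hm : Measurable fun q : ℝ × ℝ => convexityDefect F p q.1 q.2 :=
    measurable_convexityDefect h.continuous p measurable_fst measurable_snd
  have hsw : Measurable fun q : ℝ × ℝ => convexityDefect F p q.2 q.1 :=
    measurable_convexityDefect h.continuous p measurable_snd measurable_fst
  have hmt : ∀ t, Measurable fun x => convexityDefect F p t x := fun t =>
    measurable_convexityDefect h.continuous p measurable_const measurable_id
  have hq : Measurable fun q : ℝ × ℝ => diffQuot F q.1 q.2 :=
    measurable_diffQuot h.continuous measurable_fst measurable_snd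
  have hqt : ∀ t s, Measurable fun x => diffQuot F t (x - s) := fun t s =>
    measurable_diffQuot h.continuous measurable_const (measurable_sub_const s)
  rw [lintegral_lintegral_swap (hsw.div measurable_snd.ennreal_ofReal).aemeasurable]
  have hD : Measurable fun t => ∫⁻ x, convexityDefect F p t x := hm.lintegral_prod_right'
  have hE : Measurable fun t => 2 * ∫⁻ x, diffQuot F t x ^ p :=
    ((hq.pow_const p).lintegral_prod_right').const_mul 2
  have hint : ∀ t, ∫⁻ x, convexityDefect F p t x / ENNReal.ofReal t
      = (∫⁻ x, convexityDefect F p t x) / ENNReal.ofReal t := by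
    intro t
    simp_rw [div_eq_mul_inv]
    exact lintegral_mul_const _ (hmt t)
  simp_rw [hint]
  refine lintegral_Ioi_div_le_of_telescope hD hE (fun t ht => le_of_eq ?_) (fun t ht => ?_)
  · have h2 : ∫⁻ x, diffQuot F (2 * t) x ^ p = ∫⁻ x, diffQuot F (2 * t) (x - t) ^ p :=
      (lintegral_sub_right_eq_self (fun x => diffQuot F (2 * t) x ^ p) t).symm
    have h3 : ∫⁻ x, diffQuot F t x ^ p = ∫⁻ x, diffQuot F t (x - t) ^ p :=
      (lintegral_sub_right_eq_self (fun x => diffQuot F t x ^ p) t).symm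
    have hme : Measurable fun x => diffQuot F (2 * t) (x - t) ^ p :=
      (hqt (2 * t) t).pow_const p
    rw [h2, ← lintegral_const_mul _ hme, ← lintegral_add_right _ (hme.const_mul 2)]
    simp_rw [convexityDefect_add hp hp2 ht]
    rw [lintegral_add_right _ ((hqt t t).pow_const p), ← h3, two_mul]
  · exact mul_le_mul' le_rfl (h.lintegral_diffQuot_rpow_le' hp.le ht)

/-- The `L^p` bound for Marcinkiewicz's function, `1 < p ≤ 2`. -/
theorem lintegral_sqFn_rpow_le_of_le_two {p : ℝ} (hp : 1 < p) (hp2 : p ≤ 2) :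
    ∃ C : ℝ≥0, ∀ (F : ℝ → ℂ) (g : ℝ → ℝ≥0∞), IncrementBound F g → ∫⁻ z, g z ^ p ≠ ∞ →
      ∫⁻ x, sqFn F x ^ (p / 2) ≤ C * ∫⁻ z, g z ^ p := by
  obtain ⟨C₁, hC₁⟩ := lintegral_intervalMax_rpow_le hp
  set c : ℝ≥0 := (4 / (p * (p - 1))).toNNReal * 3 ^ (2 - p) with hc
  refine ⟨c ^ (p / 2) * C₁ ^ (1 - p / 2) * 2 ^ (p / 2), fun F g h hfin => ?_⟩
  have hp0 : 0 < p := by linarith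
  have hM : Measurable fun x => intervalMax g x x :=
    (measurable_intervalMax g).comp (measurable_id.prodMk measurable_id)
  -- The radius M in the convexity inequality must be finite; this is where ∫ g^p < ∞ enters.
  have hae : ∀ᵐ x, intervalMax g x x ^ p < ∞ := by
    refine ae_lt_top (hM.pow_const p) (ne_top_of_le_ne_top ?_ (hC₁ g h.measurable))
    exact ENNReal.mul_ne_top ENNReal.coe_ne_top hfin
  set J : ℝ → ℝ≥0∞ := fun x =>
    ∫⁻ t in Set.Ioi (0 : ℝ), convexityDefect F p t x / ENNReal.ofReal t with hJ
  have hJm : Measurable J :=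
    ((measurable_convexityDefect h.continuous p measurable_snd measurable_fst).div
      measurable_snd.ennreal_ofReal).lintegral_prod_right'
        (ν := volume.restrict (Set.Ioi (0 : ℝ)))
  have hpt : ∀ᵐ x, sqFn F x ^ (p / 2)
      ≤ (c : ℝ≥0∞) ^ (p / 2) * ((intervalMax g x x ^ p) ^ (1 - p / 2) * J x ^ (p / 2)) := by
    filter_upwards [hae] with x hx
    have hxtop : intervalMax g x x ≠ ∞ := by
      intro h1
      rw [h1, ENNReal.top_rpow_of_pos hp0] at hx
      exact lt_irrefl _ hx
    have h1 : sqFn F x ≤ c * (intervalMax g x x ^ (2 - p) * J x) := by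
      rw [hJ, sqFn, ← mul_assoc, ← lintegral_const_mul']
      swap
      · exact ENNReal.mul_ne_top ENNReal.coe_ne_top
          (ENNReal.rpow_ne_top_of_nonneg (by linarith) hxtop)
      refine setLIntegral_mono' measurableSet_Ioi fun t ht => ?_
      have ht' : (0 : ℝ) < t := ht
      rw [← mul_div_assoc]
      gcongr ?_ / _
      -- Both [x, x + t] and [x - t, x] contain `x`, so one radius bounds both quotients for every
      -- t.
      refine (secondQuot_sq_le hp hp2 ht' x
        (M := 3 * intervalMax g x x) (ENNReal.mul_ne_top (by norm_num) hxtop)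
        (h.diffQuot_le ht' le_rfl (by linarith)) (h.diffQuot_le ht' (by linarith)
          (by linarith))).trans (le_of_eq ?_)
      rw [ENNReal.mul_rpow_of_nonneg _ _ (by linarith), hc, ENNReal.coe_mul,
        ENNReal.coe_rpow_of_nonneg _ (by linarith)]
      simp only [ENNReal.ofReal, ENNReal.coe_ofNat]
      ring
    refine (ENNReal.rpow_le_rpow h1 (by positivity)).trans (le_of_eq ?_)
    rw [ENNReal.mul_rpow_of_nonneg _ _ (by positivity),
      ENNReal.mul_rpow_of_nonneg _ _ (by positivity), ← ENNReal.rpow_mul, ← ENNReal.rpow_mul]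
    congr 3
    ring
  calc ∫⁻ x, sqFn F x ^ (p / 2)
      ≤ ∫⁻ x, (c : ℝ≥0∞) ^ (p / 2) * ((intervalMax g x x ^ p) ^ (1 - p / 2) * J x ^ (p / 2)) :=
        lintegral_mono_ae hpt
    _ = (c : ℝ≥0∞) ^ (p / 2) * ∫⁻ x, (intervalMax g x x ^ p) ^ (1 - p / 2) * J x ^ (p / 2) :=
        lintegral_const_mul _ (((hM.pow_const p).pow_const _).mul (hJm.pow_const _))
    _ ≤ (c : ℝ≥0∞) ^ (p / 2) * ((∫⁻ x, intervalMax g x x ^ p) ^ (1 - p / 2)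
          * (∫⁻ x, J x) ^ (p / 2)) := by
        -- Hölder with weights 1 - p/2 and p/2; the first is 0 when p = 2.
        refine mul_le_mul' le_rfl (ENNReal.lintegral_mul_norm_pow_le
          (hM.pow_const p).aemeasurable hJm.aemeasurable (by linarith) (by positivity) (by ring))
    _ ≤ (c : ℝ≥0∞) ^ (p / 2) * ((C₁ * ∫⁻ z, g z ^ p) ^ (1 - p / 2)
          * (2 * ∫⁻ z, g z ^ p) ^ (p / 2)) := by
        refine mul_le_mul' le_rfl (mul_le_mul'
          (ENNReal.rpow_le_rpow (hC₁ g h.measurable) (by linarith))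
          (ENNReal.rpow_le_rpow (h.lintegral_convexityDefect_le hp hp2) (by positivity)))
    _ = _ := by
        have h2 : (0 : ℝ) ≤ 1 - p / 2 := by linarith
        have h3 : (0 : ℝ) ≤ p / 2 := by positivity
        rw [ENNReal.mul_rpow_of_nonneg _ _ h2, ENNReal.mul_rpow_of_nonneg _ _ h3]
        have h4 : (∫⁻ z, g z ^ p) = (∫⁻ z, g z ^ p) ^ (1 - p / 2) * (∫⁻ z, g z ^ p) ^ (p / 2) := by
          rw [← ENNReal.rpow_add_of_nonneg _ _ h2 h3, sub_add_cancel, ENNReal.rpow_one]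
        conv_rhs => rw [h4]
        simp only [ENNReal.coe_mul, ENNReal.coe_rpow_of_nonneg _ h2,
          ENNReal.coe_rpow_of_nonneg _ h3, ENNReal.coe_ofNat]
        ring

end MultilinearMarcinkiewicz

/-! ### Second differences at a point from averages at smaller scales. -/

namespace MultilinearMarcinkiewicz

/-- The average of `F` over `[y - s, y + s]`. -/
noncomputable def symAvg (F : ℝ → ℂ) (s y : ℝ) : ℂ := (∫ r in (y - s)..(y + s), F r) / (2 * s : ℝ)

/-- The average over `[y - s, y + s]` of the sizes of the second differences at scale `s`. -/
noncomputable def avgSecondQuot (F : ℝ → ℂ) (s y : ℝ) : ℝ≥0∞ :=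
  (∫⁻ z in Set.Icc (y - s) (y + s), secondQuot F s z) / ENNReal.ofReal (2 * s)

lemma enorm_integral_secondDiff_le (F : ℝ → ℂ) {s : ℝ} (hs : 0 < s) (y : ℝ) :
    ‖∫ r in (y - s)..(y + s), secondDiff F s r‖ₑ
      ≤ ENNReal.ofReal (2 * s) * (ENNReal.ofReal s * avgSecondQuot F s y) := by
  have hs0 : ENNReal.ofReal s ≠ 0 := by simpa using hs
  have hs2 : ENNReal.ofReal (2 * s) ≠ 0 := by simpa using hs
  rw [intervalIntegral.integral_of_le (by linarith)]
  refine (enorm_integral_le_lintegral_enorm _).trans ?_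
  rw [mul_left_comm, avgSecondQuot, ENNReal.mul_div_cancel hs2 ENNReal.ofReal_ne_top,
    ← lintegral_const_mul' _ _ ENNReal.ofReal_ne_top]
  refine (lintegral_mono_set Set.Ioc_subset_Icc_self).trans (le_of_eq ?_)
  congr 1
  ext r
  rw [secondQuot, ENNReal.mul_div_cancel hs0 ENNReal.ofReal_ne_top]

lemma integral_secondDiff {F : ℝ → ℂ} (hF : Continuous F) (s a b : ℝ) :
    ∫ r in a..b, secondDiff F s r = (∫ r in (a + s)..(b + s), F r) + (∫ r in (a - s)..(b - s), F r)
      - 2 * ∫ r in a..b, F r := by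
  unfold secondDiff
  rw [intervalIntegral.integral_sub, intervalIntegral.integral_add,
    intervalIntegral.integral_comp_add_right, intervalIntegral.integral_comp_sub_right,
    intervalIntegral.integral_const_mul]
  all_goals exact Continuous.intervalIntegrable (by fun_prop) _ _

/-- The translates of [y - s, y + s] by ±s tile [y - 2s, y + 2s], so integrating the second
difference over [y - s, y + s] compares the two averages. -/
lemma symAvg_sub {F : ℝ → ℂ} (hF : Continuous F) {s : ℝ} (hs : 0 < s) (y : ℝ) :
    symAvg F s y - symAvg F (2 * s) y
      = -((∫ r in (y - s)..(y + s), secondDiff F s r) / (4 * s : ℝ)) := by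
  have hadd : (∫ r in (y - 2 * s)..y, F r) + ∫ r in y..(y + 2 * s), F r
      = ∫ r in (y - 2 * s)..(y + 2 * s), F r :=
    intervalIntegral.integral_add_adjacent_intervals (hF.intervalIntegrable _ _)
      (hF.intervalIntegrable _ _)
  rw [integral_secondDiff hF, symAvg, symAvg, show y - s + s = y by ring,
    show y + s + s = y + 2 * s by ring, show y - s - s = y - 2 * s by ring, add_sub_cancel_right,
    ← hadd]
  have : (s : ℂ) ≠ 0 := by exact_mod_cast hs.ne'
  push_cast
  field_simp
  ring

lemma enorm_symAvg_sub_le {F : ℝ → ℂ} (hF : Continuous F) {s : ℝ} (hs : 0 < s) (y : ℝ) :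
    ‖symAvg F s y - symAvg F (2 * s) y‖ₑ ≤ ENNReal.ofReal s * avgSecondQuot F s y / 2 := by
  have hs2 : ENNReal.ofReal (2 * s) ≠ 0 := by simpa using hs
  rw [symAvg_sub hF hs, enorm_neg, enorm_div_ofReal _ (by positivity)]
  refine (ENNReal.div_le_div_right (enorm_integral_secondDiff_le F hs y) _).trans (le_of_eq ?_)
  rw [show 4 * s = 2 * s * 2 by ring, ENNReal.ofReal_mul (p := 2 * s) (by positivity),
    ENNReal.ofReal_ofNat, ENNReal.mul_div_mul_left _ _ hs2 ENNReal.ofReal_ne_top]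

lemma secondDiff_symAvg {F : ℝ → ℂ} (hF : Continuous F) (s t x : ℝ) :
    secondDiff (symAvg F s) t x = (∫ r in (x - s)..(x + s), secondDiff F t r) / (2 * s : ℝ) := by
  rw [integral_secondDiff hF, secondDiff, symAvg, symAvg, symAvg, show x - s + t = x + t - s by ring,
    show x + s + t = x + t + s by ring, show x - s - t = x - t - s by ring,
    show x + s - t = x - t + s by ring]
  ring

lemma tendsto_symAvg {F : ℝ → ℂ} (hF : Continuous F) (y : ℝ) :
    Filter.Tendsto (fun s => symAvg F s y) (nhdsWithin 0 (Set.Ioi 0)) (nhds (F y)) := by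
  rw [Metric.tendsto_nhdsWithin_nhds]
  intro ε hε
  obtain ⟨δ, hδ, h⟩ := Metric.continuous_iff.1 hF y (ε / 2) (by positivity)
  refine ⟨δ, hδ, fun s hs hsδ => ?_⟩
  have hs0 : (0 : ℝ) < s := hs
  have hsδ' : s < δ := by
    rw [Real.dist_eq, sub_zero, abs_of_pos hs0] at hsδ
    exact hsδ
  have hsc : (s : ℂ) ≠ 0 := by exact_mod_cast hs0.ne'
  have heq : symAvg F s y - F y = (∫ r in (y - s)..(y + s), (F r - F y)) / (2 * s : ℝ) := by
    rw [intervalIntegral.integral_sub (hF.intervalIntegrable _ _) (by simp),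
      intervalIntegral.integral_const, symAvg, Complex.real_smul]
    push_cast
    field_simp
    ring
  have hb : ‖∫ r in (y - s)..(y + s), (F r - F y)‖ ≤ ε / 2 * |y + s - (y - s)| := by
    refine intervalIntegral.norm_integral_le_of_norm_le_const fun r hr => ?_
    rw [Set.uIoc_of_le (by linarith)] at hr
    rw [← dist_eq_norm]
    refine (h r ?_).le
    rw [Real.dist_eq, abs_lt]
    constructor <;> linarith [hr.1, hr.2]
  rw [show y + s - (y - s) = 2 * s by ring, abs_of_pos (by positivity)] at hb
  rw [dist_eq_norm, heq, norm_div, Complex.norm_real, Real.norm_of_nonneg (by positivity),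
    div_lt_iff₀ (by positivity)]
  nlinarith

/-- Telescope over the scales t/2^N; by continuity the averages tend to `F y`. -/
lemma enorm_sub_symAvg_le {F : ℝ → ℂ} (hF : Continuous F) {t : ℝ} (ht : 0 < t) (y : ℝ) :
    ‖F y - symAvg F t y‖ₑ
      ≤ ∑' i : ℕ, ENNReal.ofReal (t / 2 ^ (i + 1)) * avgSecondQuot F (t / 2 ^ (i + 1)) y / 2 := by
  set b : ℕ → ℝ≥0∞ := fun i =>
    ENNReal.ofReal (t / 2 ^ (i + 1)) * avgSecondQuot F (t / 2 ^ (i + 1)) y / 2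
  have hpart : ∀ N : ℕ, ‖symAvg F (t / 2 ^ N) y - symAvg F t y‖ₑ ≤ ∑ i ∈ Finset.range N, b i := by
    intro N
    induction N with
    | zero => simp
    | succ N ih =>
      rw [Finset.sum_range_succ, add_comm (Finset.sum _ _)]
      have h1 := enorm_symAvg_sub_le hF (s := t / 2 ^ (N + 1)) (by positivity) y
      rw [show 2 * (t / 2 ^ (N + 1)) = t / 2 ^ N by field_simp; ring] at h1
      refine le_trans ?_ (add_le_add h1 ih)
      refine le_trans (le_of_eq ?_) (enorm_add_le _ _)
      congr 1
      ring
  have hlim : Filter.Tendsto (fun N : ℕ => t / 2 ^ N) Filter.atTop (nhdsWithin 0 (Set.Ioi 0)) := by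
    refine tendsto_nhdsWithin_iff.2 ⟨?_, Filter.Eventually.of_forall fun N => by
      simp only [Set.mem_Ioi]; positivity⟩
    have := (tendsto_pow_atTop_nhds_zero_of_lt_one (r := (1 / 2 : ℝ)) (by norm_num)
      (by norm_num)).const_mul t
    simpa [div_eq_mul_inv] using this
  have h2 := (((tendsto_symAvg hF y).comp hlim).sub_const (symAvg F t y)).enorm
  refine le_of_tendsto h2 (Filter.Eventually.of_forall fun N => ?_)
  exact (hpart N).trans (ENNReal.sum_le_tsum _)

/-- The averaged second differences at scale `t / 2 ^ i` near the points `x`, `x + t`, `x - t`. -/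
noncomputable def avgTriple (F : ℝ → ℂ) (i : ℕ) (t x : ℝ) : ℝ≥0∞ :=
  avgSecondQuot F (t / 2 ^ i) (x + t) + avgSecondQuot F (t / 2 ^ i) (x - t)
    + avgSecondQuot F (t / 2 ^ i) x

/-- A second difference at a point is controlled by averages of second differences at smaller
scales. -/
lemma secondQuot_le_tsum {F : ℝ → ℂ} (hF : Continuous F) {t : ℝ} (ht : 0 < t) (x : ℝ) :
    secondQuot F t x ≤ ∑' i : ℕ, (2⁻¹ : ℝ≥0∞) ^ i * avgTriple F i t x := by
  have ht0 : ENNReal.ofReal t ≠ 0 := by simpa using ht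
  -- Averaging commutes with second differences, so the first term is an average at scale t; the
  -- three errors involve only scales t/2, t/4, ....
  have hsplit : secondDiff F t x = secondDiff (symAvg F t) t x + ((F (x + t) - symAvg F t (x + t))
      + (F (x - t) - symAvg F t (x - t)) + (-2) * (F x - symAvg F t x)) := by
    simp only [secondDiff]
    ring
  have h1 : ‖secondDiff (symAvg F t) t x‖ₑ ≤ ENNReal.ofReal t * avgSecondQuot F t x := by
    have h2 : ENNReal.ofReal (2 * t) ≠ 0 := by simpa using ht
    rw [secondDiff_symAvg hF, enorm_div_ofReal _ (by positivity),
      ENNReal.div_le_iff h2 ENNReal.ofReal_ne_top, mul_comm]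
    exact enorm_integral_secondDiff_le F ht x
  have hscale : ∀ i : ℕ, ENNReal.ofReal (t / 2 ^ i) = ENNReal.ofReal t * (2⁻¹ : ℝ≥0∞) ^ i := by
    intro i
    rw [ENNReal.ofReal_div_of_pos (by positivity), ENNReal.ofReal_pow (by norm_num),
      ENNReal.ofReal_ofNat, div_eq_mul_inv, ENNReal.inv_pow]
  have hrem : ∀ y, ‖F y - symAvg F t y‖ₑ ≤ ENNReal.ofReal t *
      ((∑' i : ℕ, (2⁻¹ : ℝ≥0∞) ^ (i + 1) * avgSecondQuot F (t / 2 ^ (i + 1)) y) / 2) := by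
    intro y
    refine (enorm_sub_symAvg_le hF ht y).trans (le_of_eq ?_)
    simp_rw [hscale, div_eq_mul_inv, mul_assoc]
    rw [ENNReal.tsum_mul_left]
    simp_rw [← mul_assoc]
    rw [ENNReal.tsum_mul_right, mul_assoc]
  set S : ℝ → ℝ≥0∞ := fun y =>
    ∑' i : ℕ, (2⁻¹ : ℝ≥0∞) ^ (i + 1) * avgSecondQuot F (t / 2 ^ (i + 1)) y
  have hmain : ‖secondDiff F t x‖ₑ ≤ ENNReal.ofReal t *
      (avgSecondQuot F t x + (S (x + t) / 2 + S (x - t) / 2 + 2 * (S x / 2))) := by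
    rw [hsplit, mul_add, mul_add, mul_add]
    refine (enorm_add_le _ _).trans (add_le_add h1 ?_)
    refine (enorm_add_le _ _).trans (add_le_add ?_ ?_)
    · exact (enorm_add_le _ _).trans (add_le_add (hrem _) (hrem _))
    · rw [enorm_mul, enorm_neg, mul_left_comm]
      refine mul_le_mul' (le_of_eq ?_) (hrem x)
      rw [← ofReal_norm]
      simp
  rw [secondQuot, ENNReal.div_le_iff ht0 ENNReal.ofReal_ne_top, mul_comm]
  refine hmain.trans (mul_le_mul' le_rfl ?_)
  rw [tsum_eq_zero_add' ENNReal.summable]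
  have htail : ∑' i : ℕ, (2⁻¹ : ℝ≥0∞) ^ (i + 1) * avgTriple F (i + 1) t x
      = S (x + t) + S (x - t) + S x := by
    simp only [avgTriple, mul_add, S]
    rw [ENNReal.tsum_add, ENNReal.tsum_add]
  rw [htail, ENNReal.mul_div_cancel two_ne_zero ENNReal.ofNat_ne_top]
  refine add_le_add ?_ ?_
  · simp [avgTriple]
  · gcongr <;> exact ENNReal.half_le_self

end MultilinearMarcinkiewicz

/-! ### The weighted L² inequality. -/

namespace MultilinearMarcinkiewicz

lemma ofReal_enorm_parallelogram (a b : ℂ) :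
    ‖a - b‖ₑ ^ 2 + 4 * ‖(a + b) / 2‖ₑ ^ 2 = 2 * ‖a‖ₑ ^ 2 + 2 * ‖b‖ₑ ^ 2 := by
  have h := parallelogram_law_with_norm ℝ a b
  have hsq : ‖(a + b) / 2‖ ^ 2 = ‖a + b‖ ^ 2 / 4 := by
    rw [norm_div]
    simp only [Complex.norm_ofNat]
    ring
  simp_rw [← ofReal_norm, ← ENNReal.ofReal_pow (norm_nonneg _)]
  rw [← ENNReal.ofReal_ofNat, ← ENNReal.ofReal_ofNat, ← ENNReal.ofReal_mul (by norm_num),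
    ← ENNReal.ofReal_mul (by norm_num), ← ENNReal.ofReal_mul (by norm_num),
    ← ENNReal.ofReal_add (by positivity) (by positivity),
    ← ENNReal.ofReal_add (by positivity) (by positivity), hsq]
  congr 1
  nlinarith

/-- The quadratic analogue of `convexityDefect_add`. Being pointwise in `x`, it can be multiplied by
a weight. -/
lemma secondQuot_sq_add (F : ℝ → ℂ) {t : ℝ} (ht : 0 < t) (x : ℝ) :
    secondQuot F t x ^ 2 + 4 * diffQuot F (2 * t) (x - t) ^ 2
      = 2 * diffQuot F t x ^ 2 + 2 * diffQuot F t (x - t) ^ 2 := by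
  rw [secondQuot_eq F ht, diffQuot_two_mul F ht, diffQuot_sub F ht, diffQuot_eq F ht,
    ofReal_enorm_parallelogram]

variable {F : ℝ → ℂ} {g w : ℝ → ℝ≥0∞}

lemma measurable_intervalMax_comp (w : ℝ → ℝ≥0∞) {α : Type*} [MeasurableSpace α] {u v : α → ℝ}
    (hu : Measurable u) (hv : Measurable v) : Measurable fun a => intervalMax w (u a) (v a) :=
  (measurable_intervalMax w).comp (hu.prodMk hv)

/-- After Tonelli `x` runs over [z - t, z], so [x, x + t] contains `z` and its weight is at most the
maximal function at `z`. -/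
lemma IncrementBound.lintegral_diffQuot_sq_mul_intervalMax_le (h : IncrementBound F g)
    (w : ℝ → ℝ≥0∞) {t : ℝ} (ht : 0 < t) :
    ∫⁻ x, diffQuot F t x ^ 2 * intervalMax w x (x + t) ≤ ∫⁻ z, g z ^ 2 * intervalMax w z z := by
  have h1 := h.lintegral_diffQuot_rpow_le (p := 2) (by norm_num)
    (measurable_intervalMax_comp w measurable_id (measurable_add_const t)) ht
  simp only [ENNReal.rpow_ofNat, id] at h1
  refine h1.trans (lintegral_mono fun z => mul_le_mul' le_rfl ?_)
  refine ENNReal.div_le_of_le_mul ?_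
  calc ∫⁻ x in Set.Icc (z - t) z, intervalMax w x (x + t)
      ≤ ∫⁻ _ in Set.Icc (z - t) z, intervalMax w z z :=
        setLIntegral_mono' measurableSet_Icc fun x hx =>
          intervalMax_anti w hx.2 (by linarith [hx.1])
    _ = _ := by simp

/-- The weighted `L²` inequality for second differences, the weight being an upward maximal
average over the interval `[x - t, x + t]`. -/
lemma IncrementBound.lintegral_secondQuot_sq_mul_intervalMax_le (h : IncrementBound F g)
    (w : ℝ → ℝ≥0∞) :
    ∫⁻ t in Set.Ioi (0 : ℝ),
        (∫⁻ x, secondQuot F t x ^ 2 * intervalMax w (x - t) (x + t)) / ENNReal.ofReal t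
      ≤ 4 * ∫⁻ z, g z ^ 2 * intervalMax w z z := by
  have hF := h.continuous
  have hD : Measurable fun t => ∫⁻ x, secondQuot F t x ^ 2 * intervalMax w (x - t) (x + t) :=
    Measurable.lintegral_prod_right' (f := fun q : ℝ × ℝ =>
      secondQuot F q.1 q.2 ^ 2 * intervalMax w (q.2 - q.1) (q.2 + q.1))
      (((measurable_secondQuot hF measurable_fst measurable_snd).pow_const 2).mul
        (measurable_intervalMax_comp w (by fun_prop) (by fun_prop)))
  have hE : Measurable fun t => 4 * ∫⁻ x, diffQuot F t x ^ 2 * intervalMax w x (x + t) :=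
    (Measurable.lintegral_prod_right' (f := fun q : ℝ × ℝ =>
      diffQuot F q.1 q.2 ^ 2 * intervalMax w q.2 (q.2 + q.1))
      (((measurable_diffQuot hF measurable_fst measurable_snd).pow_const 2).mul
        (measurable_intervalMax_comp w (by fun_prop) (by fun_prop)))).const_mul 4
  refine lintegral_Ioi_div_le_of_telescope hD hE (fun t ht => ?_) (fun t ht =>
    mul_le_mul' le_rfl (h.lintegral_diffQuot_sq_mul_intervalMax_le w ht))
  have hm : ∀ s r : ℝ, Measurable fun x => diffQuot F s (x - r) := fun s r =>
    measurable_diffQuot hF measurable_const (measurable_sub_const r)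
  have hm0 : Measurable fun x => diffQuot F t x :=
    measurable_diffQuot hF measurable_const measurable_id
  have hV : Measurable fun x => intervalMax w (x - t) (x + t) :=
    measurable_intervalMax_comp w (by fun_prop) (by fun_prop)
  have e1 : ∫⁻ x, diffQuot F (2 * t) x ^ 2 * intervalMax w x (x + 2 * t)
      = ∫⁻ x, diffQuot F (2 * t) (x - t) ^ 2 * intervalMax w (x - t) (x + t) := by
    rw [← lintegral_sub_right_eq_self
      (fun x => diffQuot F (2 * t) x ^ 2 * intervalMax w x (x + 2 * t)) t]
    simp_rw [show ∀ x : ℝ, x - t + 2 * t = x + t from fun x => by ring]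
  have e2 : ∫⁻ x, diffQuot F t x ^ 2 * intervalMax w x (x + t)
      = ∫⁻ x, diffQuot F t (x - t) ^ 2 * intervalMax w (x - t) x := by
    rw [← lintegral_sub_right_eq_self
      (fun x => diffQuot F t x ^ 2 * intervalMax w x (x + t)) t]
    simp_rw [sub_add_cancel]
  -- At scale 2t the shifted weight is exactly that of [x - t, x + t]; passing to either half of
  -- this interval only raises the weight.
  have hpt : ∀ x, secondQuot F t x ^ 2 * intervalMax w (x - t) (x + t)
      + 4 * (diffQuot F (2 * t) (x - t) ^ 2 * intervalMax w (x - t) (x + t))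
      ≤ 2 * (diffQuot F t x ^ 2 * intervalMax w x (x + t))
        + 2 * (diffQuot F t (x - t) ^ 2 * intervalMax w (x - t) x) := by
    intro x
    calc _ = (secondQuot F t x ^ 2 + 4 * diffQuot F (2 * t) (x - t) ^ 2)
          * intervalMax w (x - t) (x + t) := by ring
      _ = 2 * (diffQuot F t x ^ 2 * intervalMax w (x - t) (x + t))
          + 2 * (diffQuot F t (x - t) ^ 2 * intervalMax w (x - t) (x + t)) := by
          rw [secondQuot_sq_add F ht]
          ring
      _ ≤ _ := by
          gcongr 2 * (_ * ?_) + 2 * (_ * ?_)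
          · exact intervalMax_anti w (by linarith) le_rfl
          · exact intervalMax_anti w le_rfl (by linarith)
  have m1 : Measurable fun x => diffQuot F (2 * t) (x - t) ^ 2 * intervalMax w (x - t) (x + t) :=
    ((hm _ _).pow_const 2).mul hV
  rw [e1, ← lintegral_const_mul _ m1, ← lintegral_add_right _ (m1.const_mul 4)]
  refine (lintegral_mono hpt).trans (le_of_eq ?_)
  have hVt : Measurable fun x => intervalMax w x (x + t) :=
    measurable_intervalMax_comp w measurable_id (by fun_prop)
  have hVt' : Measurable fun x => intervalMax w (x - t) x :=
    measurable_intervalMax_comp w (by fun_prop) measurable_id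
  have m2 : Measurable fun x => diffQuot F t x ^ 2 * intervalMax w x (x + t) :=
    (hm0.pow_const 2).mul hVt
  have m3 : Measurable fun x => diffQuot F t (x - t) ^ 2 * intervalMax w (x - t) x :=
    ((hm _ _).pow_const 2).mul hVt'
  rw [lintegral_add_left (m2.const_mul 2), lintegral_const_mul _ m2, lintegral_const_mul _ m3,
    ← e2]
  ring

/-- Here `w` becomes a weight attached to intervals: Cauchy–Schwarz and Tonelli average `w` over a
window of length 2s, and enlarging that window to [z - (K + 1)s, z + (K + 1)s] makes it contain [z -
s, z + s]. The loss is linear in the relative shift K. -/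
lemma lintegral_avgSecondQuot_sq_mul_le (hF : Continuous F) (hw : Measurable w) {s c K : ℝ}
    (hs : 0 < s) (hc : |c| ≤ K * s) :
    ∫⁻ x, avgSecondQuot F s (x + c) ^ 2 * w x
      ≤ ENNReal.ofReal (3 * (K + 1)) * ∫⁻ z, secondQuot F s z ^ 2 * intervalMax w (z - s) (z + s) := by
  have hK : 0 ≤ K := nonneg_of_mul_nonneg_left ((abs_nonneg c).trans hc) hs
  have hs2 : ENNReal.ofReal (2 * s) ≠ 0 := by simpa using hs
  have hQ : Measurable fun z => secondQuot F s z :=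
    measurable_secondQuot hF measurable_const measurable_id
  have hb : ∀ x, avgSecondQuot F s (x + c) ^ 2
      ≤ (∫⁻ z in Set.Icc (x + (c - s)) (x + (c + s)), secondQuot F s z ^ 2)
        / ENNReal.ofReal (2 * s) := by
    intro x
    have h1 := setLIntegral_Icc_rpow_le hQ (p := 2) (by norm_num) (a := x + (c - s))
      (b := x + (c + s))
    simp only [ENNReal.rpow_ofNat] at h1
    rw [show (2 : ℝ) - 1 = 1 by norm_num, ENNReal.rpow_one,
      show x + (c + s) - (x + (c - s)) = 2 * s by ring] at h1
    rw [avgSecondQuot, div_eq_mul_inv, mul_pow, show x + c - s = x + (c - s) by ring,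
      show x + c + s = x + (c + s) by ring]
    refine (mul_le_mul' h1 le_rfl).trans (le_of_eq ?_)
    rw [div_eq_mul_inv, pow_two]
    calc _ = (ENNReal.ofReal (2 * s) * (ENNReal.ofReal (2 * s))⁻¹)
          * ((∫⁻ z in Set.Icc (x + (c - s)) (x + (c + s)), secondQuot F s z ^ 2)
            * (ENNReal.ofReal (2 * s))⁻¹) := by ring
      _ = _ := by rw [ENNReal.mul_inv_cancel hs2 ENNReal.ofReal_ne_top, one_mul]
  calc ∫⁻ x, avgSecondQuot F s (x + c) ^ 2 * w x
      ≤ ∫⁻ x, (∫⁻ z in Set.Icc (x + (c - s)) (x + (c + s)), secondQuot F s z ^ 2)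
          * (w x / ENNReal.ofReal (2 * s)) := by
        refine lintegral_mono fun x => (mul_le_mul' (hb x) le_rfl).trans (le_of_eq ?_)
        rw [div_eq_mul_inv, div_eq_mul_inv]
        ring
    _ = ∫⁻ z, secondQuot F s z ^ 2 * ∫⁻ x in Set.Icc (z - (c + s)) (z - (c - s)),
          w x / ENNReal.ofReal (2 * s) :=
        lintegral_setLIntegral_Icc_mul (hQ.pow_const 2) (hw.div_const _) _ _
    _ ≤ ∫⁻ z, ENNReal.ofReal (3 * (K + 1))
          * (secondQuot F s z ^ 2 * intervalMax w (z - s) (z + s)) := by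
        refine lintegral_mono fun z => ?_
        rw [mul_left_comm]
        refine mul_le_mul' le_rfl ?_
        simp_rw [div_eq_mul_inv]
        rw [lintegral_mul_const _ hw, ← div_eq_mul_inv]
        refine ENNReal.div_le_of_le_mul ?_
        have hcc := abs_le.1 hc
        calc ∫⁻ x in Set.Icc (z - (c + s)) (z - (c - s)), w x
            ≤ ∫⁻ x in Set.Icc (z - (K + 1) * s) (z + (K + 1) * s), w x :=
              lintegral_mono_set (Set.Icc_subset_Icc (by linarith) (by linarith))
          _ ≤ _ := setLIntegral_Icc_le_intervalMax (x := z - s) (y := z + s) w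
              (by nlinarith) (by nlinarith) (by nlinarith)
          _ = _ := by
              rw [show 3 * (z + (K + 1) * s - (z - (K + 1) * s)) = 3 * (K + 1) * (2 * s) by ring,
                ENNReal.ofReal_mul (by positivity)]
              ring
    _ = _ := lintegral_const_mul' _ _ ENNReal.ofReal_ne_top

lemma measurable_avgSecondQuot (hF : Continuous F) (s : ℝ) : Measurable (avgSecondQuot F s) := by
  have hset : MeasurableSet {q : ℝ × ℝ | q.2 ∈ Set.Icc (q.1 - s) (q.1 + s)} :=
    (measurableSet_le (f := fun q : ℝ × ℝ => q.1 - s) (by fun_prop) measurable_snd).inter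
      (measurableSet_le (g := fun q : ℝ × ℝ => q.1 + s) measurable_snd (by fun_prop))
  have h1 : ∀ y, ∫⁻ z in Set.Icc (y - s) (y + s), secondQuot F s z
      = ∫⁻ z, {q : ℝ × ℝ | q.2 ∈ Set.Icc (q.1 - s) (q.1 + s)}.indicator
          (fun q => secondQuot F s q.2) (y, z) := by
    intro y
    rw [← lintegral_indicator measurableSet_Icc]
    rfl
  unfold avgSecondQuot
  simp_rw [h1]
  exact (((measurable_secondQuot hF measurable_const measurable_snd).indicator
    hset).lintegral_prod_right').div_const _

lemma add_add_sq_le (a b c : ℝ≥0∞) : (a + b + c) ^ 2 ≤ 3 * (a ^ 2 + b ^ 2 + c ^ 2) := by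
  have h := ENNReal.inner_le_Lp_mul_Lq (Finset.univ : Finset (Fin 3)) (fun _ => 1) ![a, b, c]
    Real.HolderConjugate.two_two
  simp only [Fin.sum_univ_three, one_mul, Matrix.cons_val_zero,
    Matrix.cons_val_one, Matrix.cons_val, ENNReal.rpow_ofNat] at h
  have h2 := pow_le_pow_left' h 2
  refine h2.trans (le_of_eq ?_)
  rw [mul_pow, ← ENNReal.rpow_two, ← ENNReal.rpow_two ((a ^ 2 + b ^ 2 + c ^ 2) ^ (1 / 2 : ℝ)),
    ← ENNReal.rpow_mul, ← ENNReal.rpow_mul]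
  norm_num

/-- The points x ± t are 2^i units of the scale t/2^i away from `x`, whence the factor 2^i. The 54
comes from 3(2^i + 1) ≤ 6 · 2^i, three terms, and the 3 of `add_add_sq_le`. -/
lemma lintegral_avgTriple_sq_mul_le (hF : Continuous F) (hw : Measurable w) (i : ℕ) {t : ℝ}
    (ht : 0 < t) :
    ∫⁻ x, avgTriple F i t x ^ 2 * w x
      ≤ 54 * 2 ^ i * ∫⁻ z, secondQuot F (t / 2 ^ i) z ^ 2
        * intervalMax w (z - t / 2 ^ i) (z + t / 2 ^ i) := by
  set s := t / 2 ^ i with hs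
  have hspos : 0 < s := by positivity
  set P := ∫⁻ z, secondQuot F s z ^ 2 * intervalMax w (z - s) (z + s)
  have hts : t = 2 ^ i * s := by
    rw [hs]
    field_simp
  have hone : ENNReal.ofReal (3 * (2 ^ i + 1)) ≤ 6 * 2 ^ i := by
    have : (6 : ℝ≥0∞) * 2 ^ i = ENNReal.ofReal (6 * 2 ^ i) := by
      rw [ENNReal.ofReal_mul (by norm_num), ENNReal.ofReal_pow (by norm_num), ENNReal.ofReal_ofNat,
        ENNReal.ofReal_ofNat]
    rw [this]
    apply ENNReal.ofReal_le_ofReal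
    have : (1 : ℝ) ≤ 2 ^ i := one_le_pow₀ (by norm_num)
    linarith
  have key : ∀ c : ℝ, |c| ≤ 2 ^ i * s → ∫⁻ x, avgSecondQuot F s (x + c) ^ 2 * w x
      ≤ 6 * 2 ^ i * P := fun c hc =>
    (lintegral_avgSecondQuot_sq_mul_le hF hw hspos hc).trans (mul_le_mul' hone le_rfl)
  have hm : ∀ c : ℝ, Measurable fun x => avgSecondQuot F s (x + c) ^ 2 * w x := fun c =>
    (((measurable_avgSecondQuot hF s).comp (measurable_add_const c)).pow_const 2).mul hw
  calc ∫⁻ x, avgTriple F i t x ^ 2 * w x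
      ≤ ∫⁻ x, 3 * (avgSecondQuot F s (x + t) ^ 2 * w x + avgSecondQuot F s (x + -t) ^ 2 * w x
          + avgSecondQuot F s (x + 0) ^ 2 * w x) := by
        refine lintegral_mono fun x => ?_
        rw [← add_mul, ← add_mul, ← mul_assoc, avgTriple, add_zero, ← sub_eq_add_neg]
        exact mul_le_mul' (add_add_sq_le _ _ _) le_rfl
    _ = 3 * ((∫⁻ x, avgSecondQuot F s (x + t) ^ 2 * w x)
          + (∫⁻ x, avgSecondQuot F s (x + -t) ^ 2 * w x)
          + ∫⁻ x, avgSecondQuot F s (x + 0) ^ 2 * w x) := by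
        rw [lintegral_const_mul' _ _ (by norm_num), lintegral_add_right _ (hm _),
          lintegral_add_right _ (hm _)]
    _ ≤ 3 * (6 * 2 ^ i * P + 6 * 2 ^ i * P + 6 * 2 ^ i * P) := by
        refine mul_le_mul' le_rfl (add_le_add (add_le_add (key _ ?_) (key _ ?_)) (key _ ?_))
        · rw [abs_of_pos ht, hts]
        · rw [abs_neg, abs_of_pos ht, hts]
        · rw [abs_zero]
          positivity
    _ = _ := by ring

/-- Cauchy–Schwarz with weights (3/4)^i, of sum 4: 1/2 = (3/4)(2/3) and (3/4)(2/3)² = 1/3. The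
resulting ratio must be below 1/2, to beat the factor 2^i above. -/
lemma tsum_mul_sq_le (b : ℕ → ℝ≥0∞) :
    (∑' i, (2⁻¹ : ℝ≥0∞) ^ i * b i) ^ 2 ≤ 4 * ∑' i, (3⁻¹ : ℝ≥0∞) ^ i * b i ^ 2 := by
  set r : ℝ≥0∞ := 3 * 4⁻¹ with hr
  have hr1 : (1 - r)⁻¹ = 4 := by
    have h4 : (4 : ℝ≥0∞) * 4⁻¹ = 1 := ENNReal.mul_inv_cancel (by norm_num) (by norm_num)
    have : 1 - r = 4⁻¹ := by
      refine ENNReal.sub_eq_of_eq_add (ENNReal.mul_ne_top (by norm_num) (by norm_num)) ?_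
      rw [hr, ← h4]
      ring
    rw [this, inv_inv]
  have h := lintegral_rpow_le_measure_mul
    (μ := Measure.sum fun i : ℕ => r ^ i • Measure.dirac i)
    (g := fun i => (2 * 3⁻¹ : ℝ≥0∞) ^ i * b i) (measurable_of_countable _).aemeasurable
    (p := 2) (by norm_num)
  rw [show (2 : ℝ) - 1 = 1 by norm_num, ENNReal.rpow_one] at h
  simp only [lintegral_sum_measure, lintegral_smul_measure, lintegral_dirac, ENNReal.rpow_ofNat,
    smul_eq_mul, Measure.sum_apply _ MeasurableSet.univ, Measure.smul_apply, measure_univ,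
    mul_one, ENNReal.tsum_geometric, hr1] at h
  have h3 : (3 : ℝ≥0∞) * 3⁻¹ = 1 := ENNReal.mul_inv_cancel (by norm_num) (by norm_num)
  have h2 : (2 : ℝ≥0∞) * 2⁻¹ = 1 := ENNReal.mul_inv_cancel (by norm_num) (by norm_num)
  have h4 : (4⁻¹ : ℝ≥0∞) = 2⁻¹ * 2⁻¹ := by
    rw [← ENNReal.mul_inv (by norm_num) (by norm_num)]
    norm_num
  have e1 : r * (2 * 3⁻¹) = 2⁻¹ := by
    calc r * (2 * 3⁻¹) = (3 * 3⁻¹) * (2 * 2⁻¹) * 2⁻¹ := by rw [hr, h4]; ring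
      _ = 2⁻¹ := by rw [h3, h2, one_mul, one_mul]
  have e2 : r * ((2 * 3⁻¹) * (2 * 3⁻¹)) = 3⁻¹ := by
    calc r * ((2 * 3⁻¹) * (2 * 3⁻¹)) = (3 * 3⁻¹) * (2 * 2⁻¹) * (2 * 2⁻¹) * 3⁻¹ := by
          rw [hr, h4]; ring
      _ = 3⁻¹ := by rw [h3, h2, one_mul, one_mul, one_mul]
  refine le_trans (le_of_eq ?_) (h.trans (le_of_eq ?_))
  · congr 2
    ext i
    rw [← mul_assoc, ← mul_pow, e1]
  · congr 2
    ext i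
    have e3 : (3⁻¹ : ℝ≥0∞) ^ i = r ^ i * ((2 * 3⁻¹) ^ i * (2 * 3⁻¹) ^ i) := by
      rw [← mul_pow, ← mul_pow, e2]
    rw [e3]
    ring

/-- The weighted `L²` inequality for Marcinkiewicz's function. -/
theorem IncrementBound.lintegral_sqFn_mul_le (h : IncrementBound F g) (hw : Measurable w) :
    ∫⁻ x, sqFn F x * w x ≤ 2592 * ∫⁻ z, g z ^ 2 * intervalMax w z z := by
  have hF := h.continuous
  set P : ℝ → ℝ≥0∞ := fun s => ∫⁻ z, secondQuot F s z ^ 2 * intervalMax w (z - s) (z + s) with hP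
  have hPm : Measurable P :=
    Measurable.lintegral_prod_right' (f := fun q : ℝ × ℝ =>
      secondQuot F q.1 q.2 ^ 2 * intervalMax w (q.2 - q.1) (q.2 + q.1))
      (((measurable_secondQuot hF measurable_fst measurable_snd).pow_const 2).mul
        (measurable_intervalMax_comp w (by fun_prop) (by fun_prop)))
  have hQ : Measurable fun q : ℝ × ℝ => secondQuot F q.2 q.1 ^ 2 :=
    (measurable_secondQuot hF measurable_snd measurable_fst).pow_const 2
  have hQm : Measurable fun q : ℝ × ℝ => secondQuot F q.2 q.1 ^ 2 / ENNReal.ofReal q.2 :=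
    hQ.div measurable_snd.ennreal_ofReal
  have hBm : ∀ (i : ℕ) (t : ℝ), Measurable fun x => avgTriple F i t x := fun i t =>
    (((measurable_avgSecondQuot hF _).comp (measurable_add_const t)).add
      ((measurable_avgSecondQuot hF _).comp (measurable_sub_const t))).add
      (measurable_avgSecondQuot hF _)
  have hBwm : ∀ (i : ℕ) (t : ℝ), Measurable fun x => avgTriple F i t x ^ 2 * w x := fun i t =>
    ((hBm i t).pow_const 2).mul hw
  have hQx : ∀ x, Measurable fun t : ℝ => secondQuot F t x ^ 2 / ENNReal.ofReal t := fun x =>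
    ((measurable_secondQuot hF measurable_id measurable_const).pow_const 2).div
      ENNReal.measurable_ofReal
  have hQwm : Measurable fun q : ℝ × ℝ => secondQuot F q.2 q.1 ^ 2 / ENNReal.ofReal q.2 * w q.1 :=
    hQm.mul (hw.comp measurable_fst)
  -- 216 = 4 · 54, and the ratio 2/3 is the growth 2 against the decay 1/3.
  have hslice : ∀ t ∈ Set.Ioi (0 : ℝ), ∫⁻ x, secondQuot F t x ^ 2 / ENNReal.ofReal t * w x
      ≤ ∑' i : ℕ, 216 * (2 * 3⁻¹) ^ i * (P ((2 ^ i)⁻¹ * t) / ENNReal.ofReal t) := by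
    intro t ht
    have ht' : (0 : ℝ) < t := ht
    have h1 : ∫⁻ x, secondQuot F t x ^ 2 * w x
        ≤ ∑' i : ℕ, 216 * (2 * 3⁻¹) ^ i * P ((2 ^ i)⁻¹ * t) := by
      calc ∫⁻ x, secondQuot F t x ^ 2 * w x
          ≤ ∫⁻ x, 4 * ∑' i : ℕ, (3⁻¹ : ℝ≥0∞) ^ i * (avgTriple F i t x ^ 2 * w x) := by
            refine lintegral_mono fun x => ?_
            simp_rw [← mul_assoc]
            rw [ENNReal.tsum_mul_right, ← mul_assoc]
            refine mul_le_mul' (le_trans ?_ (tsum_mul_sq_le _)) le_rfl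
            exact pow_le_pow_left' (secondQuot_le_tsum hF ht' x) 2
        _ = 4 * ∑' i : ℕ, (3⁻¹ : ℝ≥0∞) ^ i * ∫⁻ x, avgTriple F i t x ^ 2 * w x := by
            rw [lintegral_const_mul' _ _ (by norm_num), lintegral_tsum]
            · congr 2
              ext i
              rw [lintegral_const_mul _ (hBwm i t)]
            · exact fun i => ((hBwm i t).const_mul _).aemeasurable
        _ ≤ 4 * ∑' i : ℕ, (3⁻¹ : ℝ≥0∞) ^ i * (54 * 2 ^ i * P (t / 2 ^ i)) := by
            refine mul_le_mul' le_rfl (ENNReal.tsum_le_tsum fun i => mul_le_mul' le_rfl ?_)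
            exact lintegral_avgTriple_sq_mul_le hF hw i ht'
        _ = _ := by
            rw [← ENNReal.tsum_mul_left]
            congr 1
            ext i
            rw [div_eq_mul_inv, mul_comm t, mul_pow]
            ring
    have h2 : ∫⁻ x, secondQuot F t x ^ 2 / ENNReal.ofReal t * w x
        = (∫⁻ x, secondQuot F t x ^ 2 * w x) / ENNReal.ofReal t := by
      have h3 : ENNReal.ofReal t ≠ 0 := by simpa using ht'
      simp_rw [div_eq_mul_inv]
      rw [← lintegral_mul_const' _ _ (ENNReal.inv_ne_top.2 h3)]
      congr 1
      ext x
      ring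
    rw [h2]
    refine (ENNReal.div_le_div_right h1 _).trans (le_of_eq ?_)
    simp_rw [div_eq_mul_inv]
    rw [← ENNReal.tsum_mul_right]
    simp_rw [mul_assoc]
  have hgeo : (1 - 2 * 3⁻¹ : ℝ≥0∞)⁻¹ = 3 := by
    have h4 : (3 : ℝ≥0∞) * 3⁻¹ = 1 := ENNReal.mul_inv_cancel (by norm_num) (by norm_num)
    have : (1 : ℝ≥0∞) - 2 * 3⁻¹ = 3⁻¹ := by
      refine ENNReal.sub_eq_of_eq_add (ENNReal.mul_ne_top (by norm_num) (by norm_num)) ?_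
      rw [← h4]
      ring
    rw [this, inv_inv]
  calc ∫⁻ x, sqFn F x * w x
      = ∫⁻ x, ∫⁻ t in Set.Ioi (0 : ℝ), secondQuot F t x ^ 2 / ENNReal.ofReal t * w x := by
        congr 1
        ext x
        rw [sqFn, lintegral_mul_const _ (hQx x)]
    _ = ∫⁻ t in Set.Ioi (0 : ℝ), ∫⁻ x, secondQuot F t x ^ 2 / ENNReal.ofReal t * w x :=
        lintegral_lintegral_swap hQwm.aemeasurable
    _ ≤ ∫⁻ t in Set.Ioi (0 : ℝ),
          ∑' i : ℕ, 216 * (2 * 3⁻¹) ^ i * (P ((2 ^ i)⁻¹ * t) / ENNReal.ofReal t) :=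
        setLIntegral_mono' measurableSet_Ioi hslice
    _ = ∑' i : ℕ, 216 * (2 * 3⁻¹) ^ i
          * ∫⁻ t in Set.Ioi (0 : ℝ), P ((2 ^ i)⁻¹ * t) / ENNReal.ofReal t := by
        have hm : ∀ i : ℕ, Measurable fun t : ℝ => P ((2 ^ i)⁻¹ * t) / ENNReal.ofReal t :=
          fun i => (hPm.comp (measurable_const_mul _)).div ENNReal.measurable_ofReal
        rw [lintegral_tsum fun i => ((hm i).const_mul _).aemeasurable]
        congr 1
        ext i
        rw [lintegral_const_mul _ (hm i)]
    -- By dilation invariance every `i` contributes the same integral; the geometric series sums to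
    -- 3.
    _ = 648 * ∫⁻ t in Set.Ioi (0 : ℝ), P t / ENNReal.ofReal t := by
        have : ∀ i : ℕ, ∫⁻ t in Set.Ioi (0 : ℝ), P ((2 ^ i)⁻¹ * t) / ENNReal.ofReal t
            = ∫⁻ t in Set.Ioi (0 : ℝ), P t / ENNReal.ofReal t := fun i =>
          lintegral_Ioi_comp_const_mul_div (by positivity) P
        simp_rw [this]
        rw [ENNReal.tsum_mul_right, ENNReal.tsum_mul_left, ENNReal.tsum_geometric, hgeo]
        norm_num
    _ ≤ 648 * (4 * ∫⁻ z, g z ^ 2 * intervalMax w z z) :=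
        mul_le_mul' le_rfl (h.lintegral_secondQuot_sq_mul_intervalMax_le w)
    _ = _ := by
        rw [← mul_assoc]
        norm_num

end MultilinearMarcinkiewicz

/-! ### Marcinkiewicz's theorem for p > 2, by duality. -/

namespace MultilinearMarcinkiewicz

lemma le_rpow_mul_of_le_mul_rpow {A K G : ℝ≥0∞} {q r : ℝ} (hq : 0 < q) (hqr : 1 / q + r = 1)
    (hr : 0 ≤ r) (hA : A ≠ ∞) (h : A ≤ K * (G ^ (1 / q) * A ^ r)) : A ≤ K ^ q * G := by
  rcases eq_or_ne A 0 with rfl | hA0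
  · exact zero_le
  have hAr0 : A ^ r ≠ 0 := (ENNReal.rpow_pos (pos_iff_ne_zero.2 hA0) hA).ne'
  have hArt : A ^ r ≠ ∞ := ENNReal.rpow_ne_top_of_nonneg hr hA
  have hsplit : A = A ^ (1 / q) * A ^ r := by
    rw [← ENNReal.rpow_add_of_nonneg _ _ (by positivity) hr, hqr, ENNReal.rpow_one]
  rw [← mul_assoc] at h
  nth_rewrite 1 [hsplit] at h
  have h2 := (ENNReal.mul_le_mul_iff_left hAr0 hArt).1 h
  have h3 := ENNReal.rpow_le_rpow h2 hq.le
  rwa [ENNReal.mul_rpow_of_nonneg _ _ hq.le, ← ENNReal.rpow_mul, ← ENNReal.rpow_mul,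
    one_div_mul_cancel hq.ne', ENNReal.rpow_one, ENNReal.rpow_one] at h3

/-- The `L^p` bound for Marcinkiewicz's function, `2 < p`. -/
theorem lintegral_sqFn_rpow_le_of_two_lt {p : ℝ} (hp : 2 < p) :
    ∃ C : ℝ≥0, ∀ (F : ℝ → ℂ) (g : ℝ → ℝ≥0∞), IncrementBound F g →
      ∫⁻ x, sqFn F x ^ (p / 2) ≤ C * ∫⁻ z, g z ^ p := by
  set q := p / 2 with hq
  have hq1 : 1 < q := by rw [hq]; linarith
  have hq0 : 0 < q := by linarith
  have hconj : q.HolderConjugate q.conjExponent := Real.HolderConjugate.conjExponent hq1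
  set r := q.conjExponent with hr
  have hr0 : 0 < r := hconj.symm.pos
  obtain ⟨C₁, hC₁⟩ := lintegral_intervalMax_rpow_le hconj.symm.lt
  refine ⟨(2592 * C₁ ^ (1 / r)) ^ q, fun F g h => ?_⟩
  have hu : Measurable (sqFn F) := measurable_sqFn h.continuous
  refine lintegral_rpow_le_of_forall_min hu hq0 fun N => ?_
  set m : ℝ → ℝ≥0∞ := fun x => min (sqFn F x) N
  have hm : Measurable m := hu.min measurable_const
  have hmtop : ∀ x, m x ≠ ∞ := fun x =>
    ne_top_of_le_ne_top (ENNReal.natCast_ne_top N) (min_le_right _ _)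
  -- Truncating in height by N and in space by M makes `A` finite, so that it can be absorbed; the
  -- constant depends on neither.
  have hunion : ⋃ M : ℕ, Set.Icc (-(M : ℝ)) M = Set.univ := by
    refine Set.eq_univ_of_forall fun x => ?_
    obtain ⟨M, hM⟩ := exists_nat_ge |x|
    exact Set.mem_iUnion.2 ⟨M, abs_le.1 hM⟩
  rw [← setLIntegral_univ, ← hunion, setLIntegral_iUnion_of_directed]
  swap
  · refine Monotone.directed_le fun a b hab => Set.Icc_subset_Icc ?_ ?_
    · exact neg_le_neg (by exact_mod_cast hab)
    · exact_mod_cast hab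
  refine iSup_le fun M => ?_
  set S := Set.Icc (-(M : ℝ)) M with hS
  have hSm : MeasurableSet S := measurableSet_Icc
  set A := ∫⁻ x in S, m x ^ q with hA
  have hAtop : A ≠ ∞ := by
    have h1 : A ≤ ∫⁻ _ in S, (N : ℝ≥0∞) ^ q :=
      lintegral_mono fun x => ENNReal.rpow_le_rpow (min_le_right _ _) hq0.le
    refine ne_top_of_le_ne_top ?_ h1
    rw [setLIntegral_const]
    exact ENNReal.mul_ne_top (ENNReal.rpow_ne_top_of_nonneg hq0.le (ENNReal.natCast_ne_top N))
      (by simp [hS])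
  -- The extremal function for duality: since r(q - 1) = q, its r-th power integrates to `A` again.
  set w : ℝ → ℝ≥0∞ := S.indicator fun x => m x ^ (q - 1) with hw
  have hwm : Measurable w := (hm.pow_const _).indicator hSm
  have hM : Measurable fun x => intervalMax w x x :=
    measurable_intervalMax_comp w measurable_id measurable_id
  have h1 : A ≤ ∫⁻ x, sqFn F x * w x := by
    rw [hA, ← lintegral_indicator hSm]
    refine lintegral_mono fun x => ?_
    by_cases hx : x ∈ S
    · simp only [hw, Set.indicator, hx, if_true]
      calc m x ^ q = m x ^ (1 : ℝ) * m x ^ (q - 1) := by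
            rw [← ENNReal.rpow_add_of_nonneg _ _ (by norm_num) (by linarith), add_sub_cancel]
        _ ≤ sqFn F x * m x ^ (q - 1) := by
            rw [ENNReal.rpow_one]
            exact mul_le_mul' (min_le_left _ _) le_rfl
    · simp [Set.indicator, hx]
  have h2 : ∫⁻ x, w x ^ r = A := by
    rw [hA, ← lintegral_indicator hSm]
    congr 1
    ext x
    by_cases hx : x ∈ S
    · simp only [hw, Set.indicator, hx, if_true]
      rw [← ENNReal.rpow_mul, hconj.sub_one_mul_conj]
    · simp [hw, Set.indicator, hx, hr0]
  have h3 : ∫⁻ z, g z ^ 2 * intervalMax w z z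
      ≤ (∫⁻ z, g z ^ p) ^ (1 / q) * (∫⁻ z, intervalMax w z z ^ r) ^ (1 / r) := by
    refine (ENNReal.lintegral_mul_le_Lp_mul_Lq volume hconj
      (h.measurable.pow_const 2).aemeasurable hM.aemeasurable).trans (le_of_eq ?_)
    congr 3
    ext z
    rw [← ENNReal.rpow_two, ← ENNReal.rpow_mul]
    congr 1
    rw [hq]
    ring
  have h4 : A ≤ (2592 * C₁ ^ (1 / r)) * ((∫⁻ z, g z ^ p) ^ (1 / q) * A ^ (1 / r)) := by
    calc A ≤ 2592 * ((∫⁻ z, g z ^ p) ^ (1 / q) * (∫⁻ z, intervalMax w z z ^ r) ^ (1 / r)) :=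
          h1.trans ((h.lintegral_sqFn_mul_le hwm).trans (mul_le_mul' le_rfl h3))
      _ ≤ 2592 * ((∫⁻ z, g z ^ p) ^ (1 / q) * (C₁ * A) ^ (1 / r)) := by
          refine mul_le_mul' le_rfl (mul_le_mul' le_rfl (ENNReal.rpow_le_rpow ?_ (by positivity)))
          rw [← h2]
          exact hC₁ w hwm
      _ = _ := by
          rw [ENNReal.mul_rpow_of_nonneg _ _ (by positivity)]
          ring
  have hinv : 1 / q + 1 / r = 1 := by simpa using hconj.inv_add_inv_eq_one
  refine (le_rpow_mul_of_le_mul_rpow hq0 hinv (by positivity) hAtop h4).trans (le_of_eq ?_)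
  rw [ENNReal.coe_rpow_of_nonneg _ hq0.le, ENNReal.coe_mul,
    ENNReal.coe_rpow_of_nonneg _ (by positivity : 0 ≤ 1 / r)]
  simp

/-- Marcinkiewicz's theorem: the `L^p` bound for `sqFn`, `1 < p < ∞`. -/
theorem lintegral_sqFn_rpow_le {p : ℝ} (hp : 1 < p) :
    ∃ C : ℝ≥0, ∀ (F : ℝ → ℂ) (g : ℝ → ℝ≥0∞), IncrementBound F g → ∫⁻ z, g z ^ p ≠ ∞ →
      ∫⁻ x, sqFn F x ^ (p / 2) ≤ C * ∫⁻ z, g z ^ p := by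
  rcases le_or_gt p 2 with hp2 | hp2
  · exact lintegral_sqFn_rpow_le_of_le_two hp hp2
  · obtain ⟨C, hC⟩ := lintegral_sqFn_rpow_le_of_two_lt hp2
    exact ⟨C, fun F g h _ => hC F g h⟩

end MultilinearMarcinkiewicz

/-! ### Directional operators, by slicing into lines. -/

namespace MultilinearMarcinkiewicz

/-- Tonelli along lines without coordinates: each line of direction θ meets the slab in a segment of
length 1, so the slab's indicator integrates to 1 along it. -/
lemma lintegral_eq_lintegral_line {n : ℕ} {θ : E n} (hθ : ‖θ‖ = 1) {Φ : E n → ℝ≥0∞}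
    (hΦ : Measurable Φ) :
    ∫⁻ x, Φ x = ∫⁻ x in {x : E n | inner ℝ θ x ∈ Set.Icc (0 : ℝ) 1}, ∫⁻ s : ℝ, Φ (x + s • θ) := by
  set S : Set (E n) := {x | inner ℝ θ x ∈ Set.Icc (0 : ℝ) 1} with hS
  have hin : Continuous fun x : E n => inner ℝ θ x := by fun_prop
  have hSm : MeasurableSet S := hin.measurable measurableSet_Icc
  have hψ : Measurable (S.indicator fun _ : E n => (1 : ℝ≥0∞)) := measurable_const.indicator hSm
  have hadd : Measurable fun q : E n × ℝ => q.1 + q.2 • θ := by fun_prop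
  have hsub : Measurable fun q : ℝ × E n => q.2 - q.1 • θ := by fun_prop
  have hslice : ∀ x, ∫⁻ s : ℝ, S.indicator (fun _ : E n => (1 : ℝ≥0∞)) (x - s • θ) = 1 := by
    intro x
    have : ∀ s : ℝ, S.indicator (fun _ : E n => (1 : ℝ≥0∞)) (x - s • θ)
        = (Set.Icc (inner ℝ θ x - 1) (inner ℝ θ x)).indicator (fun _ => (1 : ℝ≥0∞)) s := by
      intro s
      have h1 : inner ℝ θ (x - s • θ) = inner ℝ θ x - s := by
        rw [inner_sub_right, inner_smul_right, real_inner_self_eq_norm_sq, hθ]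
        ring
      have h2 : x - s • θ ∈ S ↔ s ∈ Set.Icc (inner ℝ θ x - 1) (inner ℝ θ x) := by
        rw [hS, Set.mem_ofPred_eq, h1, Set.mem_Icc, Set.mem_Icc]
        constructor <;> rintro ⟨h3, h4⟩ <;> constructor <;> linarith
      simp only [Set.indicator, h2]
    simp_rw [this]
    rw [lintegral_indicator measurableSet_Icc]
    simp
  symm
  calc ∫⁻ x in S, ∫⁻ s : ℝ, Φ (x + s • θ)
      = ∫⁻ x, ∫⁻ s : ℝ, S.indicator (fun _ => (1 : ℝ≥0∞)) x * Φ (x + s • θ) := by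
        rw [← lintegral_indicator hSm]
        congr 1
        ext x
        by_cases hx : x ∈ S <;> simp [Set.indicator, hx]
    _ = ∫⁻ s : ℝ, ∫⁻ x, S.indicator (fun _ => (1 : ℝ≥0∞)) x * Φ (x + s • θ) := by
        refine lintegral_lintegral_swap (Measurable.aemeasurable ?_)
        exact (hψ.comp measurable_fst).mul (hΦ.comp hadd)
    _ = ∫⁻ s : ℝ, ∫⁻ x, S.indicator (fun _ => (1 : ℝ≥0∞)) (x - s • θ) * Φ x := by
        congr 1
        ext s
        rw [← lintegral_sub_right_eq_self (fun x =>
          S.indicator (fun _ => (1 : ℝ≥0∞)) x * Φ (x + s • θ)) (s • θ)]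
        simp_rw [sub_add_cancel]
    _ = ∫⁻ x, ∫⁻ s : ℝ, S.indicator (fun _ => (1 : ℝ≥0∞)) (x - s • θ) * Φ x := by
        refine lintegral_lintegral_swap (Measurable.aemeasurable ?_)
        exact (hψ.comp hsub).mul (hΦ.comp measurable_snd)
    _ = ∫⁻ x, Φ x := by
        congr 1
        ext x
        rw [lintegral_mul_const, hslice, one_mul]
        exact hψ.comp (by fun_prop)

/-- The difference of the integrals of `f` over the two opposite segments of length `t` issuing
from `x` in the directions `-θ` and `θ`. -/
noncomputable def oddLineIntegral {n : ℕ} (f : E n → ℂ) (θ : E n) (t : ℝ) (x : E n) : ℂ :=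
  ∫ r in (0 : ℝ)..t, (f (x - r • θ) - f (x + r • θ))

/-- The square of Marcinkiewicz's function along the lines of direction `θ`. -/
noncomputable def dirSq {n : ℕ} (f : E n → ℂ) (θ x : E n) : ℝ≥0∞ :=
  ∫⁻ t in Set.Ioi (0 : ℝ), (‖oddLineIntegral f θ t x‖ₑ / ENNReal.ofReal t) ^ 2 / ENNReal.ofReal t

/-- The maximal function along the lines of direction `θ`. -/
noncomputable def dirMax {n : ℕ} (f : E n → ℂ) (θ x : E n) : ℝ≥0∞ :=
  intervalMax (fun s : ℝ => ‖f (x + s • θ)‖ₑ) 0 0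

section Measurability

variable {n : ℕ} {f : E n → ℂ}

lemma measurable_oddLineIntegral (hf : Measurable f) :
    Measurable fun q : (E n × E n) × ℝ => oddLineIntegral f q.1.1 q.2 q.1.2 := by
  have hG : StronglyMeasurable fun z : ((E n × E n) × ℝ) × ℝ =>
      f (z.1.1.2 - z.2 • z.1.1.1) - f (z.1.1.2 + z.2 • z.1.1.1) :=
    ((hf.comp (by fun_prop)).sub (hf.comp (by fun_prop))).stronglyMeasurable
  have h1 : MeasurableSet {z : ((E n × E n) × ℝ) × ℝ | z.2 ∈ Set.Ioc 0 z.1.2} :=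
    (measurableSet_lt measurable_const measurable_snd).inter
      (measurableSet_le measurable_snd (by fun_prop))
  have h2 : MeasurableSet {z : ((E n × E n) × ℝ) × ℝ | z.2 ∈ Set.Ioc z.1.2 0} :=
    (measurableSet_lt (by fun_prop) measurable_snd).inter
      (measurableSet_le measurable_snd measurable_const)
  have h3 := ((hG.indicator h1).integral_prod_right' (ν := volume)).sub
    ((hG.indicator h2).integral_prod_right' (ν := volume))
  convert h3.measurable using 1
  ext q
  simp only [oddLineIntegral, intervalIntegral, ← integral_indicator measurableSet_Ioc]
  rfl

lemma measurable_dirSq (hf : Measurable f) {α : Type*} [MeasurableSpace α] {u v : α → E n}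
    (hu : Measurable u) (hv : Measurable v) : Measurable fun a => dirSq f (u a) (v a) := by
  have h1 : Measurable fun z : α × ℝ => oddLineIntegral f (u z.1) z.2 (v z.1) :=
    (measurable_oddLineIntegral hf).comp
      (((hu.comp measurable_fst).prodMk (hv.comp measurable_fst)).prodMk measurable_snd)
  exact (((h1.enorm.div measurable_snd.ennreal_ofReal).pow_const 2).div
    measurable_snd.ennreal_ofReal).lintegral_prod_right' (ν := volume.restrict (Set.Ioi (0 : ℝ)))

lemma measurable_dirMax (hf : Measurable f) {α : Type*} [MeasurableSpace α] {u v : α → E n}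
    (hu : Measurable u) (hv : Measurable v) : Measurable fun a => dirMax f (u a) (v a) := by
  refine Measurable.iSup fun r => ?_
  refine Measurable.ite (MeasurableSet.const _) ?_ measurable_const
  refine Measurable.div_const ?_ _
  have : Measurable fun z : α × ℝ => ‖f (v z.1 + z.2 • u z.1)‖ₑ :=
    (hf.comp ((hv.comp measurable_fst).add
      (measurable_snd.smul (hu.comp measurable_fst)))).enorm
  exact this.lintegral_prod_right' (ν := volume.restrict (Set.Icc (r.1 : ℝ) r.2))

end Measurability

/-- Translation by a real `s` destroys the rationality of endpoints; the factor 3 pays for restoring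
it. -/
lemma intervalMax_comp_add_le (w : ℝ → ℝ≥0∞) (s : ℝ) :
    intervalMax (fun r => w (s + r)) 0 0 ≤ 3 * intervalMax w s s := by
  refine intervalMax_le_iff.2 fun a b hab ha hb => ?_
  refine ENNReal.div_le_of_le_mul ?_
  have h1 : ∫⁻ r in Set.Icc (a : ℝ) b, w (s + r) = ∫⁻ r in Set.Icc (s + a) (s + b), w r := by
    rw [← lintegral_indicator measurableSet_Icc, ← lintegral_indicator measurableSet_Icc,
      ← lintegral_add_left_eq_self ((Set.Icc (s + a) (s + b)).indicator w) s]
    congr 1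
    ext r
    simp [Set.indicator]
  rw [h1]
  refine (setLIntegral_Icc_le_intervalMax w (x := s) (y := s) (by linarith) (by linarith)
    (by linarith)).trans (le_of_eq ?_)
  rw [show 3 * (s + b - (s + a)) = 3 * ((b : ℝ) - a) by ring, ENNReal.ofReal_mul (by norm_num),
    ENNReal.ofReal_ofNat]
  ring

lemma incrementBound_primitive {h : ℝ → ℂ} (hm : Measurable h)
    (hint : ∀ a b, IntervalIntegrable h volume a b) :
    IncrementBound (fun x => ∫ r in (0 : ℝ)..x, h r) fun r => ‖h r‖ₑ where
  continuous := intervalIntegral.continuous_primitive hint 0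
  measurable := hm.enorm
  le x y hxy := by
    rw [intervalIntegral.integral_interval_sub_left (hint _ _) (hint _ _),
      intervalIntegral.integral_of_le hxy]
    exact (enorm_integral_le_lintegral_enorm _).trans
      (lintegral_mono_set Set.Ioc_subset_Icc_self)

/-- The link between the odd kernel and Marcinkiewicz's function of a primitive. -/
lemma integral_sub_comp_eq_secondDiff {h : ℝ → ℂ}
    (hint : ∀ a b, IntervalIntegrable h volume a b) (t s : ℝ) :
    ∫ r in (0 : ℝ)..t, (h (s - r) - h (s + r))
      = -secondDiff (fun x => ∫ r in (0 : ℝ)..x, h r) t s := by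
  have i1 : IntervalIntegrable (fun r => h (s - r)) volume 0 t := by
    simpa using (hint (s - 0) (s - t)).comp_sub_left s
  have i2 : IntervalIntegrable (fun r => h (s + r)) volume 0 t := by
    simpa using (hint (s + 0) (s + t)).comp_add_left s
  rw [intervalIntegral.integral_sub i1 i2, intervalIntegral.integral_comp_sub_left,
    intervalIntegral.integral_comp_add_left, secondDiff,
    ← intervalIntegral.integral_interval_sub_left (hint 0 (s - 0)) (hint 0 (s - t)),
    ← intervalIntegral.integral_interval_sub_left (hint 0 (s + t)) (hint 0 (s + 0))]
  simp only [sub_zero, add_zero]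
  ring

lemma intervalIntegrable_of_lintegral_rpow_ne_top {h : ℝ → ℂ} (hm : Measurable h) {p : ℝ}
    (hp : 1 ≤ p) (hfin : ∫⁻ r, ‖h r‖ₑ ^ p ≠ ∞) (a b : ℝ) : IntervalIntegrable h volume a b := by
  have key : ∀ a b : ℝ, IntegrableOn h (Set.Icc a b) := by
    intro a b
    refine ⟨hm.aestronglyMeasurable, ?_⟩
    have h1 := setLIntegral_Icc_rpow_le hm.enorm hp (a := a) (b := b)
    have h2 : ENNReal.ofReal (b - a) ^ (p - 1) * ∫⁻ r in Set.Icc a b, ‖h r‖ₑ ^ p ≠ ∞ :=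
      ENNReal.mul_ne_top (ENNReal.rpow_ne_top_of_nonneg (by linarith) ENNReal.ofReal_ne_top)
        (ne_top_of_le_ne_top hfin (setLIntegral_le_lintegral _ _))
    have h3 := ne_top_of_le_ne_top h2 h1
    rw [hasFiniteIntegral_iff_enorm, lt_top_iff_ne_top]
    intro h4
    rw [h4, ENNReal.top_rpow_of_pos (by linarith)] at h3
    exact h3 rfl
  rw [intervalIntegrable_iff]
  exact (key (min a b) (max a b)).mono_set Set.Ioc_subset_Icc_self

lemma dirSq_add_smul {n : ℕ} {f : E n → ℂ} (θ x : E n) (s : ℝ)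
    (hint : ∀ a b, IntervalIntegrable (fun r : ℝ => f (x + r • θ)) volume a b) :
    dirSq f θ (x + s • θ) = sqFn (fun y => ∫ r in (0 : ℝ)..y, f (x + r • θ)) s := by
  have h1 : ∀ t, ‖oddLineIntegral f θ t (x + s • θ)‖ₑ
      = ‖secondDiff (fun y => ∫ r in (0 : ℝ)..y, f (x + r • θ)) t s‖ₑ := by
    intro t
    have h2 := integral_sub_comp_eq_secondDiff hint t s
    rw [← enorm_neg (secondDiff _ _ _), ← h2, oddLineIntegral]
    congr 2
    ext r
    rw [show x + s • θ - r • θ = x + (s - r) • θ by rw [sub_smul]; abel,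
      show x + s • θ + r • θ = x + (s + r) • θ by rw [add_smul]; abel]
  simp only [dirSq, sqFn, secondQuot, h1]

/-- On almost every line `f` has a finite L^p integral, hence a primitive to which the
one-dimensional theorem applies. The constant is that of the line, the same for every θ. -/
theorem lintegral_dirSq_rpow_le (n : ℕ) {p : ℝ} (hp : 1 < p) :
    ∃ C : ℝ≥0, ∀ (f : E n → ℂ) (θ : E n), ‖θ‖ = 1 → Measurable f → ∫⁻ x, ‖f x‖ₑ ^ p ≠ ∞ →
      ∫⁻ x, dirSq f θ x ^ (p / 2) ≤ C * ∫⁻ x, ‖f x‖ₑ ^ p := by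
  obtain ⟨C, hC⟩ := lintegral_sqFn_rpow_le hp
  refine ⟨C, fun f θ hθ hf hfin => ?_⟩
  have hfm : Measurable fun x => ‖f x‖ₑ ^ p := hf.enorm.pow_const p
  have hsq : Measurable fun x => dirSq f θ x ^ (p / 2) :=
    (measurable_dirSq hf measurable_const measurable_id).pow_const _
  have hlm : Measurable fun q : E n × ℝ => ‖f (q.1 + q.2 • θ)‖ₑ ^ p :=
    hfm.comp (by fun_prop : Measurable fun q : E n × ℝ => q.1 + q.2 • θ)
  have hL : Measurable fun x => ∫⁻ s : ℝ, ‖f (x + s • θ)‖ₑ ^ p := hlm.lintegral_prod_right'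
  rw [lintegral_eq_lintegral_line hθ hfm] at hfin ⊢
  rw [lintegral_eq_lintegral_line hθ hsq, ← lintegral_const_mul _ hL]
  refine lintegral_mono_ae ?_
  filter_upwards [ae_lt_top hL hfin] with x hx
  have hm : Measurable fun s : ℝ => f (x + s • θ) := hf.comp (by fun_prop)
  have hint := intervalIntegrable_of_lintegral_rpow_ne_top hm hp.le hx.ne
  simp_rw [fun s => dirSq_add_smul (f := f) θ x s hint]
  exact hC _ _ (incrementBound_primitive hm hint) hx.ne

theorem lintegral_dirMax_rpow_le (n : ℕ) {p : ℝ} (hp : 1 < p) :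
    ∃ C : ℝ≥0, ∀ (f : E n → ℂ) (θ : E n), ‖θ‖ = 1 → Measurable f →
      ∫⁻ x, dirMax f θ x ^ p ≤ C * ∫⁻ x, ‖f x‖ₑ ^ p := by
  obtain ⟨C, hC⟩ := lintegral_intervalMax_rpow_le hp
  refine ⟨3 ^ p * C, fun f θ hθ hf => ?_⟩
  have hp0 : 0 ≤ p := by linarith
  have hfm : Measurable fun x => ‖f x‖ₑ ^ p := hf.enorm.pow_const p
  have hsq : Measurable fun x => dirMax f θ x ^ p :=
    (measurable_dirMax hf measurable_const measurable_id).pow_const _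
  have hlm : Measurable fun q : E n × ℝ => ‖f (q.1 + q.2 • θ)‖ₑ ^ p :=
    hfm.comp (by fun_prop : Measurable fun q : E n × ℝ => q.1 + q.2 • θ)
  have hL : Measurable fun x => ∫⁻ s : ℝ, ‖f (x + s • θ)‖ₑ ^ p := hlm.lintegral_prod_right'
  rw [lintegral_eq_lintegral_line hθ hfm, lintegral_eq_lintegral_line hθ hsq,
    ← lintegral_const_mul _ hL]
  refine lintegral_mono fun x => ?_
  have hm : Measurable fun s : ℝ => ‖f (x + s • θ)‖ₑ := (hf.comp (by fun_prop)).enorm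
  have hle : ∀ s : ℝ, dirMax f θ (x + s • θ)
      ≤ 3 * intervalMax (fun s : ℝ => ‖f (x + s • θ)‖ₑ) s s := by
    intro s
    refine le_trans (le_of_eq ?_) (intervalMax_comp_add_le _ s)
    simp only [dirMax, add_smul, add_assoc]
  calc ∫⁻ s : ℝ, dirMax f θ (x + s • θ) ^ p
      ≤ ∫⁻ s : ℝ, 3 ^ p * intervalMax (fun s : ℝ => ‖f (x + s • θ)‖ₑ) s s ^ p := by
        refine lintegral_mono fun s => ?_
        rw [← ENNReal.mul_rpow_of_nonneg _ _ hp0]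
        exact ENNReal.rpow_le_rpow (hle s) hp0
    _ = 3 ^ p * ∫⁻ s : ℝ, intervalMax (fun s : ℝ => ‖f (x + s • θ)‖ₑ) s s ^ p :=
        lintegral_const_mul' _ _ (ENNReal.rpow_ne_top_of_nonneg hp0 (by norm_num))
    _ ≤ 3 ^ p * (C * ∫⁻ s : ℝ, ‖f (x + s • θ)‖ₑ ^ p) := mul_le_mul' le_rfl (hC _ hm)
    _ = _ := by
        rw [ENNReal.coe_mul, ENNReal.coe_rpow_of_nonneg _ hp0, ENNReal.coe_ofNat, mul_assoc]

end MultilinearMarcinkiewicz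

/-! ### Minkowski's inequality and polar coordinates. -/

namespace MultilinearMarcinkiewicz

/-- Minkowski's integral inequality with exponent `2`. -/
lemma lintegral_sq_lintegral_le {α β : Type*} [MeasurableSpace α] [MeasurableSpace β]
    {μ : Measure α} {ν : Measure β} [SFinite μ] [SFinite ν] {h : α → β → ℝ≥0∞}
    (hh : Measurable (Function.uncurry h)) :
    ∫⁻ t, (∫⁻ a, h a t ∂μ) ^ 2 ∂ν ≤ (∫⁻ a, (∫⁻ t, h a t ^ 2 ∂ν) ^ (1 / 2 : ℝ) ∂μ) ^ 2 := by
  have hat : ∀ t, Measurable fun a => h a t := fun t => hh.comp measurable_prodMk_right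
  have hta : ∀ a, Measurable fun t => h a t := fun a => hh.comp measurable_prodMk_left
  have hN : Measurable fun a => (∫⁻ t, h a t ^ 2 ∂ν) ^ (1 / 2 : ℝ) :=
    ((hh.pow_const 2).lintegral_prod_right').pow_const _
  -- Write the square as a double integral over pairs (a, b); Cauchy–Schwarz in t is then applied to
  -- each pair.
  have sq_eq : ∀ u : α → ℝ≥0∞, Measurable u →
      (∫⁻ a, u a ∂μ) ^ 2 = ∫⁻ a, ∫⁻ b, u a * u b ∂μ ∂μ := by
    intro u hu
    have h1 : ∀ a, ∫⁻ b, u a * u b ∂μ = u a * ∫⁻ b, u b ∂μ := fun a => lintegral_const_mul _ hu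
    simp_rw [h1]
    rw [lintegral_mul_const _ hu, pow_two]
  rw [sq_eq _ hN]
  simp_rw [fun t => sq_eq _ (hat t)]
  have m1 : Measurable fun q : (β × α) × α => h q.1.2 q.1.1 * h q.2 q.1.1 :=
    (hh.comp (measurable_fst.snd.prodMk measurable_fst.fst)).mul
      (hh.comp (measurable_snd.prodMk measurable_fst.fst))
  rw [lintegral_lintegral_swap m1.lintegral_prod_right'.aemeasurable]
  refine lintegral_mono fun a => ?_
  have m2 : Measurable fun q : β × α => h a q.1 * h q.2 q.1 :=
    (hh.comp (measurable_const.prodMk measurable_fst)).mul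
      (hh.comp (measurable_snd.prodMk measurable_fst))
  rw [lintegral_lintegral_swap m2.aemeasurable]
  refine lintegral_mono fun b => ?_
  have := ENNReal.lintegral_mul_le_Lp_mul_Lq ν Real.HolderConjugate.two_two
    (hta a).aemeasurable (hta b).aemeasurable
  simpa only [Pi.mul_apply, ENNReal.rpow_ofNat] using this

open Metric in
lemma lintegral_eq_lintegral_sphere {n : ℕ} (hn : 1 ≤ n) {G : E n → ℝ≥0∞} (hG : Measurable G) :
    ∫⁻ y, G y = ∫⁻ θ : sphere (0 : E n) 1, (∫⁻ r in Set.Ioi (0 : ℝ),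
      ENNReal.ofReal (r ^ (n - 1)) * G (r • (θ : E n))) ∂(volume : Measure (E n)).toSphere := by
  have : Nontrivial (E n) := Module.nontrivial_of_finrank_pos (R := ℝ)
    (by rw [finrank_euclideanSpace_fin]; exact hn)
  have hGm : Measurable fun q : sphere (0 : E n) 1 × Set.Ioi (0 : ℝ) => G (q.2.1 • (q.1 : E n)) :=
    hG.comp (by fun_prop)
  calc ∫⁻ y, G y = ∫⁻ y : ({(0)}ᶜ : Set (E n)), G y ∂((volume : Measure (E n)).comap Subtype.val) := by
        rw [lintegral_subtype_comap (measurableSet_singleton _).compl, restrict_compl_singleton]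
    _ = ∫⁻ q : sphere (0 : E n) 1 × Set.Ioi (0 : ℝ), G (q.2.1 • (q.1 : E n))
          ∂((volume : Measure (E n)).toSphere.prod
            (.volumeIoiPow (Module.finrank ℝ (E n) - 1))) := by
        rw [← (volume : Measure (E n)).measurePreserving_homeomorphUnitSphereProd.lintegral_comp hGm]
        congr 1
        ext y
        simp only [homeomorphUnitSphereProd_apply_fst_coe, homeomorphUnitSphereProd_apply_snd_coe]
        rw [smul_inv_smul₀ (norm_ne_zero_iff.2 y.2)]
    _ = _ := by
        rw [lintegral_prod _ hGm.aemeasurable]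
        congr 1
        ext θ
        have hm : Measurable fun r : Set.Ioi (0 : ℝ) => G (r.1 • (θ : E n)) :=
          hG.comp (by fun_prop)
        rw [Measure.volumeIoiPow, lintegral_withDensity_eq_lintegral_mul _ (by fun_prop) hm,
          finrank_euclideanSpace_fin]
        exact lintegral_subtype_comap measurableSet_Ioi
          (fun r : ℝ => ENNReal.ofReal (r ^ (n - 1)) * G (r • (θ : E n)))

open Metric in
lemma integral_eq_integral_sphere {n : ℕ} (hn : 1 ≤ n) {G : E n → ℂ} (hG : Integrable G) :
    ∫ y, G y = ∫ θ : sphere (0 : E n) 1, (∫ r in Set.Ioi (0 : ℝ),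
      (r ^ (n - 1)) • G (r • (θ : E n))) ∂(volume : Measure (E n)).toSphere := by
  have : Nontrivial (E n) := Module.nontrivial_of_finrank_pos (R := ℝ)
    (by rw [finrank_euclideanSpace_fin]; exact hn)
  have hmp := (volume : Measure (E n)).measurePreserving_homeomorphUnitSphereProd
  have hemb := (homeomorphUnitSphereProd (E n)).measurableEmbedding
  have hcomp : ∀ y : ({(0)}ᶜ : Set (E n)), (fun q : sphere (0 : E n) 1 × Set.Ioi (0 : ℝ) =>
      G (q.2.1 • (q.1 : E n))) (homeomorphUnitSphereProd (E n) y) = G y := by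
    intro y
    simp only [homeomorphUnitSphereProd_apply_fst_coe, homeomorphUnitSphereProd_apply_snd_coe]
    rw [smul_inv_smul₀ (norm_ne_zero_iff.2 y.2)]
  have hint : Integrable (fun q : sphere (0 : E n) 1 × Set.Ioi (0 : ℝ) => G (q.2.1 • (q.1 : E n)))
      ((volume : Measure (E n)).toSphere.prod
        (.volumeIoiPow (Module.finrank ℝ (E n) - 1))) := by
    rw [← hmp.integrable_comp_emb hemb]
    have h1 : IntegrableOn G ({(0)}ᶜ : Set (E n)) := hG.integrableOn
    rw [integrableOn_iff_comap_subtypeVal (measurableSet_singleton _).compl] at h1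
    refine h1.congr (Filter.Eventually.of_forall fun y => ?_)
    exact (hcomp y).symm
  calc ∫ y, G y = ∫ y : ({(0)}ᶜ : Set (E n)), G y ∂((volume : Measure (E n)).comap Subtype.val) := by
        rw [integral_subtype_comap (measurableSet_singleton _).compl, restrict_compl_singleton]
    _ = ∫ q : sphere (0 : E n) 1 × Set.Ioi (0 : ℝ), G (q.2.1 • (q.1 : E n))
          ∂((volume : Measure (E n)).toSphere.prod
            (.volumeIoiPow (Module.finrank ℝ (E n) - 1))) := by
        rw [← hmp.integral_comp hemb]
        simp_rw [hcomp]
    _ = _ := by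
        rw [integral_prod _ hint]
        congr 1
        ext θ
        rw [Measure.volumeIoiPow, finrank_euclideanSpace_fin]
        simp only [ENNReal.ofReal]
        rw [integral_withDensity_eq_integral_smul (by fun_prop),
          integral_subtype_comap measurableSet_Ioi
            fun r : ℝ => Real.toNNReal (r ^ (n - 1)) • G (r • (θ : E n))]
        refine setIntegral_congr_fun measurableSet_Ioi fun r hr => ?_
        simp only [NNReal.smul_def, Real.coe_toNNReal _ (pow_nonneg (Set.mem_Ioi.1 hr).le _)]

end MultilinearMarcinkiewicz

/-! ### The method of rotations in one variable. -/

namespace MultilinearMarcinkiewicz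

open Metric

variable {n : ℕ} {f : E n → ℂ}

/-- The average over all directions of the directional maximal functions. -/
noncomputable def sphereMax (f : E n → ℂ) (x : E n) : ℝ≥0∞ :=
  ∫⁻ θ : sphere (0 : E n) 1, dirMax f θ x ∂(volume : Measure (E n)).toSphere

/-- The average over all directions of the directional Marcinkiewicz functions. -/
noncomputable def sphereSq (f : E n → ℂ) (x : E n) : ℝ≥0∞ :=
  ∫⁻ θ : sphere (0 : E n) 1, dirSq f θ x ^ (1 / 2 : ℝ) ∂(volume : Measure (E n)).toSphere

lemma measurable_dirMax_sphere (hf : Measurable f) :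
    Measurable fun q : E n × sphere (0 : E n) 1 => dirMax f q.2 q.1 :=
  measurable_dirMax hf (measurable_subtype_coe.comp measurable_snd) measurable_fst

lemma measurable_dirSq_sphere (hf : Measurable f) :
    Measurable fun q : E n × sphere (0 : E n) 1 => dirSq f q.2 q.1 :=
  measurable_dirSq hf (measurable_subtype_coe.comp measurable_snd) measurable_fst

lemma measurable_sphereMax (hf : Measurable f) : Measurable (sphereMax f) :=
  (measurable_dirMax_sphere hf).lintegral_prod_right'

lemma measurable_sphereSq (hf : Measurable f) : Measurable (sphereSq f) :=
  ((measurable_dirSq_sphere hf).pow_const _).lintegral_prod_right'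

lemma lintegral_rpow_lintegral_le {α β : Type*} [MeasurableSpace α] [MeasurableSpace β]
    {μ : Measure α} {ν : Measure β} [SFinite μ] [SFinite ν] {K : β → α → ℝ≥0∞}
    (hK : Measurable (Function.uncurry K)) {p : ℝ} (hp : 1 ≤ p) {A : ℝ≥0∞}
    (hA : ∀ a, ∫⁻ x, K x a ^ p ∂ν ≤ A) :
    ∫⁻ x, (∫⁻ a, K x a ∂μ) ^ p ∂ν ≤ μ Set.univ ^ p * A := by
  have hp1 : 0 ≤ p - 1 := by linarith
  have hKp : Measurable (Function.uncurry fun x a => K x a ^ p) := hK.pow_const p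
  calc ∫⁻ x, (∫⁻ a, K x a ∂μ) ^ p ∂ν
      ≤ ∫⁻ x, μ Set.univ ^ (p - 1) * ∫⁻ a, K x a ^ p ∂μ ∂ν :=
        lintegral_mono fun x => lintegral_rpow_le_measure_mul
          (hK.comp measurable_prodMk_left).aemeasurable hp
    _ = μ Set.univ ^ (p - 1) * ∫⁻ x, ∫⁻ a, K x a ^ p ∂μ ∂ν :=
        lintegral_const_mul _ hKp.lintegral_prod_right'
    _ ≤ μ Set.univ ^ (p - 1) * (A * μ Set.univ) := by
        refine mul_le_mul' le_rfl ?_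
        rw [lintegral_lintegral_swap hKp.aemeasurable, ← lintegral_const]
        exact lintegral_mono hA
    _ = _ := by
        rw [mul_left_comm, mul_comm A]
        congr 1
        conv_rhs => rw [show p = (p - 1) + 1 by ring]
        rw [ENNReal.rpow_add_of_nonneg _ _ hp1 (by norm_num), ENNReal.rpow_one]

theorem lintegral_sphereMax_rpow_le (n : ℕ) {p : ℝ} (hp : 1 < p) :
    ∃ C : ℝ≥0, ∀ f : E n → ℂ, Measurable f →
      ∫⁻ x, sphereMax f x ^ p ≤ C * ∫⁻ x, ‖f x‖ₑ ^ p := by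
  obtain ⟨C, hC⟩ := lintegral_dirMax_rpow_le n hp
  set σ := (volume : Measure (E n)).toSphere
  refine ⟨(σ Set.univ).toNNReal ^ p * C, fun f hf => ?_⟩
  refine (lintegral_rpow_lintegral_le (μ := σ) (measurable_dirMax_sphere hf) hp.le
    (fun θ => hC f θ (norm_eq_of_mem_sphere θ) hf)).trans (le_of_eq ?_)
  rw [ENNReal.coe_mul, ENNReal.coe_rpow_of_nonneg _ (by linarith),
    ENNReal.coe_toNNReal (measure_ne_top _ _), mul_assoc]

theorem lintegral_sphereSq_rpow_le (n : ℕ) {p : ℝ} (hp : 1 < p) :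
    ∃ C : ℝ≥0, ∀ f : E n → ℂ, Measurable f → ∫⁻ x, ‖f x‖ₑ ^ p ≠ ∞ →
      ∫⁻ x, sphereSq f x ^ p ≤ C * ∫⁻ x, ‖f x‖ₑ ^ p := by
  obtain ⟨C, hC⟩ := lintegral_dirSq_rpow_le n hp
  set σ := (volume : Measure (E n)).toSphere
  refine ⟨(σ Set.univ).toNNReal ^ p * C, fun f hf hfin => ?_⟩
  refine (lintegral_rpow_lintegral_le (μ := σ) ((measurable_dirSq_sphere hf).pow_const _) hp.le
    (A := C * ∫⁻ x, ‖f x‖ₑ ^ p) (fun θ => ?_)).trans (le_of_eq ?_)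
  · simp_rw [← ENNReal.rpow_mul, show 1 / 2 * p = p / 2 by ring]
    exact hC f θ (norm_eq_of_mem_sphere θ) hf hfin
  · rw [ENNReal.coe_mul, ENNReal.coe_rpow_of_nonneg _ (by linarith),
      ENNReal.coe_toNNReal (measure_ne_top _ _), mul_assoc]

/-- The function `f (x - y) / |y|^(n-1)` of `y`. -/
noncomputable def radialQuot (f : E n → ℂ) (x y : E n) : ℂ :=
  f (x - y) / ((‖y‖ ^ (n - 1) : ℝ) : ℂ)

lemma measurable_radialQuot (hf : Measurable f) (x : E n) : Measurable (radialQuot f x) := by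
  unfold radialQuot
  exact (hf.comp (by fun_prop)).div (by fun_prop)

lemma smul_radialQuot {θ : E n} (hθ : ‖θ‖ = 1) {r : ℝ} (hr : 0 < r) (f : E n → ℂ) (x : E n) :
    ((r ^ (n - 1) : ℝ) : ℂ) * radialQuot f x (r • θ) = f (x - r • θ) := by
  have : ((r ^ (n - 1) : ℝ) : ℂ) ≠ 0 := by exact_mod_cast (pow_pos hr _).ne'
  rw [radialQuot, norm_smul, hθ, mul_one, Real.norm_of_nonneg hr.le, mul_div_cancel₀ _ this]

lemma norm_smul_of_norm_eq_one {θ : E n} (hθ : ‖θ‖ = 1) {r : ℝ} (hr : 0 < r) : ‖r • θ‖ = r := by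
  rw [norm_smul, hθ, mul_one, Real.norm_of_nonneg hr.le]

lemma measurableSet_norm_le (t : ℝ) : MeasurableSet {y : E n | ‖y‖ ≤ t} :=
  measurableSet_le measurable_norm measurable_const

/-- The Jacobian r^(n-1) cancels the singularity, leaving for each θ the integral of |f| over a
segment of length t ending at `x`. -/
lemma lintegral_radialQuot_le (hn : 1 ≤ n) (hf : Measurable f) {t : ℝ} (ht : 0 < t) (x : E n) :
    ∫⁻ y in {y : E n | ‖y‖ ≤ t}, ‖radialQuot f x y‖ₑ ≤ ENNReal.ofReal (3 * t) * sphereMax f x := by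
  have hm : Measurable ({y : E n | ‖y‖ ≤ t}.indicator fun y => ‖radialQuot f x y‖ₑ) :=
    (measurable_radialQuot hf x).enorm.indicator (measurableSet_norm_le t)
  rw [← lintegral_indicator (measurableSet_norm_le t), lintegral_eq_lintegral_sphere hn hm,
    sphereMax, ← lintegral_const_mul' _ _ ENNReal.ofReal_ne_top]
  refine lintegral_mono fun θ => ?_
  have hθ : ‖(θ : E n)‖ = 1 := norm_eq_of_mem_sphere θ
  set w : ℝ → ℝ≥0∞ := fun s => ‖f (x + s • (θ : E n))‖ₑ
  calc ∫⁻ r in Set.Ioi (0 : ℝ), ENNReal.ofReal (r ^ (n - 1))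
        * {y : E n | ‖y‖ ≤ t}.indicator (fun y => ‖radialQuot f x y‖ₑ) (r • (θ : E n))
      = ∫⁻ r in Set.Ioi (0 : ℝ), (Set.Iic t).indicator (fun r => w (-r)) r := by
        refine setLIntegral_congr_fun measurableSet_Ioi fun r hr => ?_
        have hr' : (0 : ℝ) < r := hr
        simp only [Set.indicator, Set.mem_ofPred_eq, norm_smul_of_norm_eq_one hθ hr', Set.mem_Iic]
        split_ifs with h
        · simp only [w]
          rw [neg_smul, ← sub_eq_add_neg, ← smul_radialQuot hθ hr' f x, enorm_mul, ← ofReal_norm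
            (((r ^ (n - 1) : ℝ) : ℂ)), Complex.norm_real, Real.norm_of_nonneg (by positivity)]
        · rw [mul_zero]
    _ ≤ ∫⁻ s in Set.Icc (-t) 0, w s := by
        rw [← lintegral_indicator measurableSet_Ioi, ← lintegral_indicator measurableSet_Icc,
          ← lintegral_neg_eq_self]
        refine lintegral_mono fun r => ?_
        simp only [Set.indicator, Set.mem_Ioi, Set.mem_Iic, Set.mem_Icc, neg_neg]
        split_ifs with h1 h2 h3 h3
        · exact le_rfl
        · exact absurd ⟨by linarith, by linarith⟩ h3
        all_goals exact zero_le
    _ ≤ ENNReal.ofReal (3 * (0 - -t)) * intervalMax w 0 0 :=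
        setLIntegral_Icc_le_intervalMax w (by linarith) (by linarith) le_rfl
    _ = _ := by
        rw [zero_sub, neg_neg]
        rfl

/-- Pairing y with -y uses oddness, and homogeneity makes `k` constant on rays, so it leaves the
radial integral, which is then `oddLineIntegral`. The factor 1/2 from the pairing is discarded. -/
lemma enorm_integral_radialQuot_le (hn : 1 ≤ n) (hf : Measurable f) {t : ℝ} (ht : 0 < t) (x : E n)
    (hx : sphereMax f x ≠ ∞) {k : E n → ℂ} (hk : Measurable k) (hodd : Function.Odd k)
    (hhom : HomogeneousDegreeZero k) {B : ℝ≥0} (hB : ∀ y, ‖k y‖ₑ ≤ B) :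
    ‖∫ y in {y : E n | ‖y‖ ≤ t}, k y * radialQuot f x y‖ₑ
      ≤ B * ∫⁻ θ : sphere (0 : E n) 1, ‖oddLineIntegral f θ t x‖ₑ
        ∂(volume : Measure (E n)).toSphere := by
  set S : Set (E n) := {y : E n | ‖y‖ ≤ t} with hS
  have hSm : MeasurableSet S := measurableSet_norm_le t
  have hri : IntegrableOn (radialQuot f x) S :=
    ⟨(measurable_radialQuot hf x).aestronglyMeasurable, lt_of_le_of_lt
      (lintegral_radialQuot_le hn hf ht x) (ENNReal.mul_lt_top ENNReal.ofReal_lt_top hx.lt_top)⟩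
  have hint : IntegrableOn (fun y => k y * radialQuot f x y) S := by
    refine Integrable.bdd_mul (c := B) hri hk.aestronglyMeasurable
      (Filter.Eventually.of_forall fun y => ?_)
    exact enorm_le_coe.1 (hB y)
  set G : E n → ℂ := S.indicator fun y => k y * radialQuot f x y with hG
  have hGi : Integrable G := (integrable_indicator_iff hSm).2 hint
  have hGn : Integrable fun y => G (-y) := hGi.comp_neg
  have hsym : ∫ y in S, k y * radialQuot f x y = (1 / 2) * ∫ y, (G y + G (-y)) := by
    rw [integral_add hGi hGn, integral_neg_eq_self, ← integral_indicator hSm]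
    ring
  have hpolar : ∫ y, (G y + G (-y)) = ∫ θ : sphere (0 : E n) 1,
      k θ * oddLineIntegral f θ t x ∂(volume : Measure (E n)).toSphere := by
    refine (integral_eq_integral_sphere hn (hGi.add hGn)).trans ?_
    congr 1
    ext θ
    have hθ : ‖(θ : E n)‖ = 1 := norm_eq_of_mem_sphere θ
    have hpt : ∀ r ∈ Set.Ioi (0 : ℝ), (r ^ (n - 1)) • ((G + fun y => G (-y)) (r • (θ : E n)))
        = (Set.Ioc 0 t).indicator
          (fun r => k θ * (f (x - r • (θ : E n)) - f (x + r • (θ : E n)))) r := by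
      intro r hr
      have hr' : (0 : ℝ) < r := hr
      have h1 := smul_radialQuot hθ hr' f x
      have h2 := smul_radialQuot (θ := -(θ : E n)) (by rwa [norm_neg]) hr' f x
      have hk1 : k (r • (θ : E n)) = k θ := hhom r hr' θ
      simp only [hG, hS, Pi.add_apply, Set.indicator, Set.mem_ofPred_eq, norm_neg,
        norm_smul_of_norm_eq_one hθ hr', Set.mem_Ioc, hr', true_and]
      split_ifs with h
      · rw [hodd, hk1, ← smul_neg, Complex.real_smul, ← h1,
          show x + r • (θ : E n) = x - r • -(θ : E n) by rw [smul_neg, sub_neg_eq_add], ← h2]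
        ring
      · simp
    rw [setIntegral_congr_fun measurableSet_Ioi hpt, setIntegral_indicator measurableSet_Ioc,
      integral_const_mul, oddLineIntegral, intervalIntegral.integral_of_le ht.le]
    congr 3
    ext r
    simp only [Set.mem_inter_iff, Set.mem_Ioi, Set.mem_Ioc]
    tauto
  rw [hsym, hpolar, enorm_mul]
  have hhalf : ‖(1 / 2 : ℂ)‖ₑ ≤ 1 := by
    rw [← ofReal_norm]
    norm_num
  refine (mul_le_of_le_one_left' hhalf).trans ((enorm_integral_le_lintegral_enorm _).trans ?_)
  rw [← lintegral_const_mul' _ _ ENNReal.coe_ne_top]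
  refine lintegral_mono fun θ => ?_
  rw [enorm_mul]
  exact mul_le_mul' (hB _) le_rfl

end MultilinearMarcinkiewicz

/-! ### The sine kernel, product measures and the bound at fixed t. -/

namespace MultilinearMarcinkiewicz

section Kernel

variable {n m : ℕ} {ω : E n → ℂ}

lemma LipschitzOnSphere.continuousOn (h : LipschitzOnSphere ω) :
    ContinuousOn ω (Metric.sphere 0 1) := by
  obtain ⟨α, C, hα, -, hC⟩ := h
  intro ξ hξ
  rw [ContinuousWithinAt, tendsto_iff_norm_sub_tendsto_zero]
  have hlim : Filter.Tendsto (fun η => C * ‖η - ξ‖ ^ α) (nhdsWithin ξ (Metric.sphere 0 1))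
      (nhds 0) := by
    have hc : Continuous fun η : E n => C * ‖η - ξ‖ ^ α :=
      continuous_const.mul ((by fun_prop : Continuous fun η : E n => ‖η - ξ‖).rpow_const
        fun _ => Or.inr hα.le)
    have := (hc.tendsto ξ).mono_left (nhdsWithin_le_nhds (s := Metric.sphere 0 1))
    simpa [Real.zero_rpow hα.ne'] using this
  refine squeeze_zero' (Filter.Eventually.of_forall fun _ => norm_nonneg _) ?_ hlim
  filter_upwards [self_mem_nhdsWithin] with η hη
  exact hC η ξ (mem_sphere_zero_iff_norm.1 hη) (mem_sphere_zero_iff_norm.1 hξ)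

lemma inv_norm_smul_mem_sphere {y : E n} (hy : y ≠ 0) :
    ‖y‖⁻¹ • y ∈ Metric.sphere (0 : E n) 1 := by
  rw [mem_sphere_zero_iff_norm, norm_smul, norm_inv, norm_norm,
    inv_mul_cancel₀ (norm_ne_zero_iff.2 hy)]

lemma HomogeneousDegreeZero.apply_inv_norm_smul (h : HomogeneousDegreeZero ω) {y : E n}
    (hy : y ≠ 0) : ω (‖y‖⁻¹ • y) = ω y :=
  h _ (inv_pos.2 (norm_pos_iff.2 hy)) y

lemma HomogeneousDegreeZero.measurable (h : HomogeneousDegreeZero ω)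
    (hl : LipschitzOnSphere ω) : Measurable ω := by
  refine measurable_of_continuousOn_compl_singleton 0 ?_
  refine (hl.continuousOn.comp (f := fun y : E n => ‖y‖⁻¹ • y) (s := {0}ᶜ) ?_
    fun y hy => inv_norm_smul_mem_sphere hy).congr fun y hy => (h.apply_inv_norm_smul hy).symm
  exact (continuousOn_id.norm.inv₀ fun y hy => norm_ne_zero_iff.2 hy).smul continuousOn_id

lemma HomogeneousDegreeZero.exists_norm_le (h : HomogeneousDegreeZero ω)
    (hl : LipschitzOnSphere ω) : ∃ M : ℝ, ∀ y, ‖ω y‖ ≤ M := by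
  obtain ⟨M, hM⟩ := (isCompact_sphere (0 : E n) 1).exists_bound_of_continuousOn hl.continuousOn
  -- Homogeneity does not relate the value at the origin to the sphere, so it is bounded separately.
  refine ⟨max M ‖ω 0‖, fun y => ?_⟩
  rcases eq_or_ne y 0 with rfl | hy
  · exact le_max_right _ _
  · rw [← h.apply_inv_norm_smul hy]
    exact (hM _ (inv_norm_smul_mem_sphere hy)).trans (le_max_left _ _)

variable {ω : Fin m → E n → ℂ}

lemma measurable_sinProd (hhom : ∀ j, HomogeneousDegreeZero (ω j))
    (hlip : ∀ j, LipschitzOnSphere (ω j)) : Measurable (sinProd ω) :=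
  Complex.measurable_sin.comp <| Finset.measurable_prod _ fun j _ =>
    ((hhom j).measurable (hlip j)).comp (measurable_pi_apply j)

lemma exists_enorm_sinProd_le (hhom : ∀ j, HomogeneousDegreeZero (ω j))
    (hlip : ∀ j, LipschitzOnSphere (ω j)) : ∃ B : ℝ≥0, ∀ y, ‖sinProd ω y‖ₑ ≤ B := by
  choose M hM using fun j => (hhom j).exists_norm_le (hlip j)
  obtain ⟨B, hB⟩ := (isCompact_closedBall (0 : ℂ) (∏ j, M j)).exists_bound_of_continuousOn
    Complex.continuous_sin.continuousOn
  refine ⟨B.toNNReal, fun y => ?_⟩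
  rw [enorm_le_coe, ← NNReal.coe_le_coe, coe_nnnorm]
  refine (hB _ ?_).trans (Real.le_coe_toNNReal B)
  rw [mem_closedBall_zero_iff, norm_prod]
  exact Finset.prod_le_prod (fun _ _ => norm_nonneg _) fun j _ => hM j _

/-- The oddness of the sine is used here; elsewhere only its boundedness on discs and its
measurability matter. -/
lemma odd_sinProd_cons {ω : Fin (m + 1) → E n → ℂ} (hodd : Function.Odd (ω 0))
    (z : Fin m → E n) :
    Function.Odd fun a : E n => sinProd ω (Fin.cons a z) := fun a => by
  simp only [sinProd, Fin.prod_univ_succ, Fin.cons_zero, Fin.cons_succ]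
  rw [hodd a, neg_mul, Complex.sin_neg]

lemma homogeneousDegreeZero_sinProd_cons {ω : Fin (m + 1) → E n → ℂ}
    (hhom : HomogeneousDegreeZero (ω 0)) (z : Fin m → E n) :
    HomogeneousDegreeZero fun a : E n => sinProd ω (Fin.cons a z) := fun r hr a => by
  simp only [sinProd, Fin.prod_univ_succ, Fin.cons_zero, Fin.cons_succ, hhom r hr a]

end Kernel

section Pi

variable {X : Type*} [MeasurableSpace X]

lemma measurePreserving_cons (ν : Measure X) [SigmaFinite ν] (m : ℕ) :
    MeasurePreserving (fun q : X × (Fin m → X) => (Fin.cons q.1 q.2 : Fin (m + 1) → X))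
      (ν.prod (Measure.pi fun _ => ν)) (Measure.pi fun _ => ν) := by
  have := (measurePreserving_piFinSuccAbove (fun _ : Fin (m + 1) => ν) 0).symm
  convert this using 1
  ext q : 1
  simp [MeasurableEquiv.piFinSuccAbove, Fin.insertNthEquiv]

theorem lintegral_pi_prod (ν : Measure X) [SigmaFinite ν] {m : ℕ} {g : Fin m → X → ℝ≥0∞}
    (hg : ∀ j, Measurable (g j)) :
    ∫⁻ y, ∏ j, g j (y j) ∂(Measure.pi fun _ : Fin m => ν) = ∏ j, ∫⁻ a, g j a ∂ν := by
  induction m with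
  | zero => simp
  | succ m ih =>
    have hm : Measurable fun y : Fin (m + 1) → X => ∏ j, g j (y j) :=
      Finset.measurable_prod _ fun j _ => (hg j).comp (measurable_pi_apply j)
    have hm' : Measurable fun z : Fin m → X => ∏ j, g j.succ (z j) :=
      Finset.measurable_prod _ fun j _ => (hg _).comp (measurable_pi_apply j)
    rw [← (measurePreserving_cons ν m).lintegral_comp hm, Fin.prod_univ_succ,
      ← ih fun j => hg j.succ]
    simp only [Fin.prod_univ_succ, Fin.cons_zero, Fin.cons_succ]
    exact lintegral_prod_mul (hg 0).aemeasurable hm'.aemeasurable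

end Pi

section Pointwise

variable {n m : ℕ}

lemma enorm_prod {ι : Type*} (s : Finset ι) (z : ι → ℂ) : ‖∏ j ∈ s, z j‖ₑ = ∏ j ∈ s, ‖z j‖ₑ := by
  simp only [enorm, nnnorm_prod, ENNReal.ofNNReal_finsetProd]

lemma ballProd_eq_pi (n m : ℕ) (t : ℝ) :
    ballProd n m t = Set.univ.pi fun _ => {y : E n | ‖y‖ ≤ t} := by
  ext y; simp [ballProd]

lemma volume_restrict_ballProd (n m : ℕ) (t : ℝ) :
    (volume : Measure (Fin m → E n)).restrict (ballProd n m t)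
      = Measure.pi fun _ => (volume : Measure (E n)).restrict {y : E n | ‖y‖ ≤ t} := by
  rw [ballProd_eq_pi, volume_pi, Measure.restrict_pi_pi]

lemma integrand_eq (Ω : (Fin m → E n) → ℂ) (f : Fin m → E n → ℂ) (x : E n) (y : Fin m → E n) :
    integrand Ω f x y = Ω y * ∏ j, radialQuot (f j) x (y j) := by
  simp only [integrand, radialQuot, Finset.prod_div_distrib, Complex.ofReal_prod]
  ring

lemma measurable_integrand {Ω : (Fin m → E n) → ℂ} (hΩ : Measurable Ω) {f : Fin m → E n → ℂ}
    (hf : ∀ j, Measurable (f j)) :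
    Measurable fun q : E n × (Fin m → E n) => integrand Ω f q.1 q.2 := by
  unfold integrand
  refine ((hΩ.comp measurable_snd).div ?_).mul (Finset.measurable_prod _ fun j _ =>
    (hf j).comp (by fun_prop))
  fun_prop

lemma lintegral_prod_radialQuot_le (hn : 1 ≤ n) {f : Fin m → E n → ℂ}
    (hf : ∀ j, Measurable (f j)) (x : E n) {t : ℝ} (ht : 0 < t) :
    ∫⁻ y in ballProd n m t, ∏ j, ‖radialQuot (f j) x (y j)‖ₑ
      ≤ ∏ j, (ENNReal.ofReal (3 * t) * sphereMax (f j) x) := by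
  rw [volume_restrict_ballProd, lintegral_pi_prod _ (g := fun j a => ‖radialQuot (f j) x a‖ₑ)
    fun j => (measurable_radialQuot (hf j) x).enorm]
  exact Finset.prod_le_prod' fun j _ => lintegral_radialQuot_le hn (hf j) ht x

lemma measurable_integrand_right {Ω : (Fin m → E n) → ℂ} (hΩ : Measurable Ω)
    {f : Fin m → E n → ℂ} (hf : ∀ j, Measurable (f j)) (x : E n) :
    Measurable (integrand Ω f x) :=
  (measurable_integrand hΩ hf).comp measurable_prodMk_left

lemma measurable_prod_radialQuot {f : Fin m → E n → ℂ} (hf : ∀ j, Measurable (f j)) (x : E n) :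
    Measurable fun z : Fin m → E n => ∏ j, ‖radialQuot (f j) x (z j)‖ₑ :=
  Finset.measurable_prod _ fun j _ =>
    ((measurable_radialQuot (hf j) x).comp (measurable_pi_apply j)).enorm

theorem integrableOn_integrand (hn : 1 ≤ n) {Ω : (Fin m → E n) → ℂ} (hΩ : Measurable Ω)
    {B : ℝ≥0} (hB : ∀ y, ‖Ω y‖ₑ ≤ B) {f : Fin m → E n → ℂ} (hf : ∀ j, Measurable (f j)) {x : E n}
    (hx : ∀ j, sphereMax (f j) x ≠ ∞) {t : ℝ} (ht : 0 < t) :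
    IntegrableOn (integrand Ω f x) (ballProd n m t) := by
  refine ⟨(measurable_integrand_right hΩ hf x).aestronglyMeasurable, ?_⟩
  calc ∫⁻ y in ballProd n m t, ‖integrand Ω f x y‖ₑ
      ≤ ∫⁻ y in ballProd n m t, B * ∏ j, ‖radialQuot (f j) x (y j)‖ₑ := by
        refine lintegral_mono fun y => ?_
        rw [integrand_eq, enorm_mul, enorm_prod]
        exact mul_le_mul' (hB y) le_rfl
    _ ≤ B * ∏ j, (ENNReal.ofReal (3 * t) * sphereMax (f j) x) := by
        rw [lintegral_const_mul' _ _ ENNReal.coe_ne_top]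
        exact mul_le_mul' le_rfl (lintegral_prod_radialQuot_le hn hf x ht)
    _ < ∞ := ENNReal.mul_lt_top ENNReal.coe_lt_top <| ENNReal.prod_lt_top fun j _ =>
        ENNReal.mul_lt_top ENNReal.ofReal_lt_top (hx j).lt_top

lemma integral_ballProd_succ {t : ℝ} {G : (Fin (m + 1) → E n) → ℂ} (hG : Measurable G)
    (hint : IntegrableOn G (ballProd n (m + 1) t)) :
    ∫ y in ballProd n (m + 1) t, G y
      = ∫ z in ballProd n m t, ∫ a in {a : E n | ‖a‖ ≤ t}, G (Fin.cons a z) := by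
  have hmp := measurePreserving_cons ((volume : Measure (E n)).restrict {a : E n | ‖a‖ ≤ t}) m
  rw [IntegrableOn, volume_restrict_ballProd, ← hmp.integrable_comp hG.aestronglyMeasurable]
    at hint
  rw [volume_restrict_ballProd, ← hmp.map_eq,
    integral_map hmp.measurable.aemeasurable hG.aestronglyMeasurable, volume_restrict_ballProd]
  exact integral_prod_symm _ hint

lemma integrand_cons (Ω : (Fin (m + 1) → E n) → ℂ) (f : Fin (m + 1) → E n → ℂ) (x a : E n)
    (z : Fin m → E n) :
    integrand Ω f x (Fin.cons a z)
      = Ω (Fin.cons a z) * radialQuot (f 0) x a * ∏ j : Fin m, radialQuot (f j.succ) x (z j) := by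
  rw [integrand_eq, Fin.prod_univ_succ]
  simp only [Fin.cons_zero, Fin.cons_succ, mul_assoc]

lemma measurable_cons_left (z : Fin m → E n) :
    Measurable fun a : E n => (Fin.cons a z : Fin (m + 1) → E n) :=
  measurable_pi_lambda _ fun j => by
    refine Fin.cases ?_ (fun i => ?_) j
    · simpa only [Fin.cons_zero] using measurable_id'
    · simp

/-- The bound for the integral in the first variable is uniform in the remaining ones, although the
kernel does not factor; hence it comes out and the rest splits as a product. -/
theorem enorm_integral_integrand_le (hn : 1 ≤ n) {ω : Fin (m + 1) → E n → ℂ}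
    (hodd : Function.Odd (ω 0)) (hhom : ∀ j, HomogeneousDegreeZero (ω j))
    (hlip : ∀ j, LipschitzOnSphere (ω j)) {B : ℝ≥0} (hB : ∀ y, ‖sinProd ω y‖ₑ ≤ B)
    {f : Fin (m + 1) → E n → ℂ} (hf : ∀ j, Measurable (f j)) {x : E n}
    (hx : ∀ j, sphereMax (f j) x ≠ ∞) {t : ℝ} (ht : 0 < t) :
    ‖∫ y in ballProd n (m + 1) t, integrand (sinProd ω) f x y‖ₑ
      ≤ B * (∫⁻ θ : Metric.sphere (0 : E n) 1, ‖oddLineIntegral (f 0) θ t x‖ₑ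
          ∂(volume : Measure (E n)).toSphere)
        * ∏ j : Fin m, (ENNReal.ofReal (3 * t) * sphereMax (f j.succ) x) := by
  have hS := measurable_sinProd hhom hlip
  rw [integral_ballProd_succ (measurable_integrand_right hS hf x)
    (integrableOn_integrand hn hS hB hf hx ht)]
  refine (enorm_integral_le_lintegral_enorm _).trans ?_
  have key : ∀ z : Fin m → E n,
      ‖∫ a in {a : E n | ‖a‖ ≤ t}, integrand (sinProd ω) f x (Fin.cons a z)‖ₑ
        ≤ (B * ∫⁻ θ : Metric.sphere (0 : E n) 1, ‖oddLineIntegral (f 0) θ t x‖ₑ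
          ∂(volume : Measure (E n)).toSphere) * ∏ j : Fin m, ‖radialQuot (f j.succ) x (z j)‖ₑ := by
    intro z
    simp_rw [integrand_cons]
    rw [integral_mul_const, enorm_mul, enorm_prod]
    have h := enorm_integral_radialQuot_le hn (hf 0) ht x (hx 0)
      (hS.comp (measurable_cons_left z)) (odd_sinProd_cons hodd z)
      (homogeneousDegreeZero_sinProd_cons (hhom 0) z) fun a => hB _
    exact mul_le_mul' h le_rfl
  refine (lintegral_mono key).trans ?_
  rw [lintegral_const_mul _ (measurable_prod_radialQuot (fun j => hf j.succ) x)]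
  exact mul_le_mul' le_rfl (lintegral_prod_radialQuot_le hn (fun j => hf j.succ) x ht)

end Pointwise

end MultilinearMarcinkiewicz

/-! ### The pointwise bound, measurability and Hölder's inequality. -/

namespace MultilinearMarcinkiewicz

section Bound

variable {n m : ℕ}

/-- Of the m + 1 factors 1/t, m cancel against the maximal bounds and one normalises the odd line
integral. -/
lemma ofReal_inv_pow_mul_prod {t : ℝ} (ht : 0 < t) (B D : ℝ≥0∞) (M : Fin m → ℝ≥0∞) :
    (ENNReal.ofReal t)⁻¹ ^ (m + 1) * (B * D * ∏ j, (ENNReal.ofReal (3 * t) * M j))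
      = B * 3 ^ m * (∏ j, M j) * (D / ENNReal.ofReal t) := by
  have h1 : (ENNReal.ofReal t)⁻¹ ^ m * ENNReal.ofReal t ^ m = 1 := by
    rw [← mul_pow, ENNReal.inv_mul_cancel (ENNReal.ofReal_pos.2 ht).ne' ENNReal.ofReal_ne_top,
      one_pow]
  rw [Finset.prod_mul_distrib, Finset.prod_const, Finset.card_univ, Fintype.card_fin,
    ENNReal.ofReal_mul (by norm_num), mul_pow, ENNReal.ofReal_ofNat, div_eq_mul_inv, pow_succ]
  calc _ = ((ENNReal.ofReal t)⁻¹ ^ m * ENNReal.ofReal t ^ m)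
        * (B * 3 ^ m * (∏ j, M j) * (D * (ENNReal.ofReal t)⁻¹)) := by ring
    _ = _ := by rw [h1, one_mul]

lemma enorm_F_eq (Ω : (Fin m → E n) → ℂ) (f : Fin m → E n → ℂ) {t : ℝ} (ht : 0 < t) (x : E n) :
    ‖F Ω f t x‖ₑ
      = (ENNReal.ofReal t)⁻¹ ^ m * ‖∫ y in ballProd n m t, integrand Ω f x y‖ₑ := by
  rw [F, enorm_mul, one_div, ← inv_pow, enorm_pow, ← one_div, enorm_div_ofReal _ ht, enorm_one,
    one_div]

lemma measurable_enorm_oddLineIntegral_div {f : E n → ℂ} (hf : Measurable f) {α : Type*}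
    [MeasurableSpace α] {u v : α → E n} {w : α → ℝ} (hu : Measurable u) (hv : Measurable v)
    (hw : Measurable w) :
    Measurable fun a => ‖oddLineIntegral f (u a) (w a) (v a)‖ₑ / ENNReal.ofReal (w a) :=
  ((measurable_oddLineIntegral hf).comp ((hu.prodMk hv).prodMk hw)).enorm.div hw.ennreal_ofReal

lemma lintegral_sq_lintegral_div_le {α : Type*} [MeasurableSpace α] {μ : Measure α} [SFinite μ]
    {h : α → ℝ → ℝ≥0∞} (hh : Measurable (Function.uncurry h)) :
    ∫⁻ t in Set.Ioi (0 : ℝ), (∫⁻ a, h a t ∂μ) ^ 2 / ENNReal.ofReal t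
      ≤ (∫⁻ a, (∫⁻ t in Set.Ioi (0 : ℝ), h a t ^ 2 / ENNReal.ofReal t) ^ (1 / 2 : ℝ) ∂μ) ^ 2 := by
  set ν : Measure ℝ := (volume.restrict (Set.Ioi (0 : ℝ))).withDensity
    fun t => (ENNReal.ofReal t)⁻¹ with hν
  have hw : Measurable fun t : ℝ => (ENNReal.ofReal t)⁻¹ := by fun_prop
  have e1 : ∀ u : ℝ → ℝ≥0∞, Measurable u →
      ∫⁻ t in Set.Ioi (0 : ℝ), u t / ENNReal.ofReal t = ∫⁻ t, u t ∂ν := fun u hu => by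
    rw [hν, lintegral_withDensity_eq_lintegral_mul _ hw hu]
    simp only [Pi.mul_apply, div_eq_mul_inv, mul_comm]
  have hsec : ∀ a, Measurable fun t => h a t ^ 2 := fun a =>
    (hh.comp measurable_prodMk_left).pow_const 2
  have hint : Measurable fun t => (∫⁻ a, h a t ∂μ) ^ 2 := (hh.lintegral_prod_left').pow_const 2
  rw [e1 _ hint]
  simp_rw [fun a => e1 _ (hsec a)]
  exact lintegral_sq_lintegral_le hh

lemma lintegral_sq_oddLineIntegral_le {f : E n → ℂ} (hf : Measurable f) (x : E n) :
    ∫⁻ t in Set.Ioi (0 : ℝ), ((∫⁻ θ : Metric.sphere (0 : E n) 1, ‖oddLineIntegral f θ t x‖ₑ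
        ∂(volume : Measure (E n)).toSphere) / ENNReal.ofReal t) ^ 2 / ENNReal.ofReal t
      ≤ sphereSq f x ^ 2 := by
  have hh : Measurable (Function.uncurry fun (θ : Metric.sphere (0 : E n) 1) (t : ℝ) =>
      ‖oddLineIntegral f θ t x‖ₑ / ENNReal.ofReal t) :=
    measurable_enorm_oddLineIntegral_div hf (measurable_subtype_coe.comp measurable_fst)
      measurable_const measurable_snd
  refine le_trans (setLIntegral_mono' measurableSet_Ioi fun t ht => ?_)
    (lintegral_sq_lintegral_div_le hh)
  have ht0 : (ENNReal.ofReal t)⁻¹ ≠ ∞ :=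
    ENNReal.inv_ne_top.2 (ENNReal.ofReal_pos.2 (Set.mem_Ioi.1 ht)).ne'
  simp only [div_eq_mul_inv]
  rw [lintegral_mul_const' _ _ ht0]

/-- The pointwise bound by directional operators. -/
theorem marcinkiewicz_sinProd_le (hn : 1 ≤ n) {ω : Fin (m + 1) → E n → ℂ}
    (hodd : Function.Odd (ω 0)) (hhom : ∀ j, HomogeneousDegreeZero (ω j))
    (hlip : ∀ j, LipschitzOnSphere (ω j)) {B : ℝ≥0} (hB : ∀ y, ‖sinProd ω y‖ₑ ≤ B)
    {f : Fin (m + 1) → E n → ℂ} (hf : ∀ j, Measurable (f j)) {x : E n}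
    (hx : ∀ j, sphereMax (f j) x ≠ ∞) :
    marcinkiewicz (sinProd ω) f x
      ≤ B * 3 ^ m * (∏ j : Fin m, sphereMax (f j.succ) x) * sphereSq (f 0) x := by
  set K : ℝ≥0∞ := B * 3 ^ m * ∏ j : Fin m, sphereMax (f j.succ) x
  have hK : K ≠ ∞ := ENNReal.mul_ne_top
    (ENNReal.mul_ne_top ENNReal.coe_ne_top (ENNReal.pow_ne_top (by norm_num)))
    (ENNReal.prod_ne_top fun j _ => hx _)
  have key : ∫⁻ t in Set.Ioi (0 : ℝ), ‖F (sinProd ω) f t x‖ₑ ^ 2 / ENNReal.ofReal t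
      ≤ (K * sphereSq (f 0) x) ^ 2 := by
    rw [mul_pow]
    refine le_trans ?_ (mul_le_mul' le_rfl (lintegral_sq_oddLineIntegral_le (hf 0) x))
    rw [← lintegral_const_mul' _ _ (ENNReal.pow_ne_top hK)]
    refine setLIntegral_mono' measurableSet_Ioi fun t ht => ?_
    rw [← mul_div_assoc, ← mul_pow]
    refine ENNReal.div_le_div_right (pow_le_pow_left' ?_ 2) _
    rw [enorm_F_eq _ _ ht, ← ofReal_inv_pow_mul_prod ht]
    exact mul_le_mul' le_rfl (enorm_integral_integrand_le hn hodd hhom hlip hB hf hx ht)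
  refine (ENNReal.rpow_le_rpow key (by norm_num)).trans (le_of_eq ?_)
  rw [← ENNReal.rpow_natCast, ← ENNReal.rpow_mul]
  norm_num

end Bound

section Measurability

variable {n m : ℕ}

lemma measurable_F {Ω : (Fin m → E n) → ℂ} (hΩ : Measurable Ω) {f : Fin m → E n → ℂ}
    (hf : ∀ j, Measurable (f j)) : Measurable fun q : E n × ℝ => F Ω f q.2 q.1 := by
  have hS : MeasurableSet {r : (E n × ℝ) × (Fin m → E n) | r.2 ∈ ballProd n m r.1.2} := by
    have : {r : (E n × ℝ) × (Fin m → E n) | r.2 ∈ ballProd n m r.1.2}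
        = ⋂ j, {r : (E n × ℝ) × (Fin m → E n) | ‖r.2 j‖ ≤ r.1.2} := by
      ext r; simp [ballProd]
    rw [this]
    exact MeasurableSet.iInter fun j => measurableSet_le (by fun_prop) (by fun_prop)
  have hI : Measurable fun r : (E n × ℝ) × (Fin m → E n) => integrand Ω f r.1.1 r.2 :=
    (measurable_integrand hΩ hf).comp (measurable_fst.fst.prodMk measurable_snd)
  have h := (hI.indicator hS).stronglyMeasurable.integral_prod_right' (ν := volume)
  have hB : ∀ t, MeasurableSet (ballProd n m t) := fun t => by
    rw [ballProd_eq_pi]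
    exact MeasurableSet.univ_pi fun _ => measurableSet_norm_le t
  have e : ∀ q : E n × ℝ, ∫ y in ballProd n m q.2, integrand Ω f q.1 y
      = ∫ y, {r : (E n × ℝ) × (Fin m → E n) | r.2 ∈ ballProd n m r.1.2}.indicator
        (fun r => integrand Ω f r.1.1 r.2) (q, y) := fun q => by
    rw [← integral_indicator (hB _)]
    rfl
  unfold F
  simp_rw [e]
  exact Measurable.mul (by fun_prop) h.measurable

lemma measurable_marcinkiewicz {Ω : (Fin m → E n) → ℂ} (hΩ : Measurable Ω)
    {f : Fin m → E n → ℂ} (hf : ∀ j, Measurable (f j)) : Measurable (marcinkiewicz Ω f) := by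
  have h : Measurable fun q : E n × ℝ => ‖F Ω f q.2 q.1‖ₑ ^ 2 / ENNReal.ofReal q.2 :=
    ((measurable_F hΩ hf).enorm.pow_const 2).div (by fun_prop)
  exact (h.lintegral_prod_right').pow_const _

lemma integrand_ae_eq (Ω : (Fin m → E n) → ℂ) {f g : Fin m → E n → ℂ}
    (h : ∀ j, f j =ᵐ[volume] g j) (x : E n) :
    integrand Ω f x =ᵐ[volume] integrand Ω g x := by
  have h1 : ∀ j, ∀ᵐ y : Fin m → E n, f j (x - y j) = g j (x - y j) := fun j =>
    ((Measure.measurePreserving_sub_left volume x).quasiMeasurePreserving.comp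
      (Measure.quasiMeasurePreserving_eval (fun _ => (volume : Measure (E n))) j)).ae (h j)
  filter_upwards [ae_all_iff.2 h1] with y hy
  simp only [integrand, hy]

/-- Equality holds at every point, because y ↦ x - y_j pulls null sets back to null sets for each
fixed x. -/
lemma marcinkiewicz_congr_ae (Ω : (Fin m → E n) → ℂ) {f g : Fin m → E n → ℂ}
    (h : ∀ j, f j =ᵐ[volume] g j) : marcinkiewicz Ω f = marcinkiewicz Ω g := by
  have hF : ∀ t x, F Ω f t x = F Ω g t x := fun t x => by
    rw [F, F, integral_congr_ae (ae_restrict_of_ae (integrand_ae_eq Ω h x))]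
  funext x
  simp only [marcinkiewicz, hF]

end Measurability

/-- Hölder's inequality for finitely many functions, with an arbitrary positive exponent of the
product. -/
lemma lintegral_prod_rpow_le {α ι : Type*} [MeasurableSpace α] {μ : Measure α} [Fintype ι]
    {u : ι → α → ℝ≥0∞} (hu : ∀ j, Measurable (u j)) {p : ℝ} (hp : 0 < p) {q : ι → ℝ}
    (hq : ∀ j, 0 < q j) (hpq : 1 / p = ∑ j, 1 / q j) :
    (∫⁻ x, (∏ j, u j x) ^ p ∂μ) ^ (1 / p) ≤ ∏ j, (∫⁻ x, u j x ^ q j ∂μ) ^ (1 / q j) := by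
  have hsum : ∑ j, p / q j = 1 := by
    simp_rw [div_eq_mul_one_div p (q _), ← Finset.mul_sum, ← hpq]
    exact mul_one_div_cancel hp.ne'
  have h := ENNReal.lintegral_prod_norm_pow_le (μ := μ) Finset.univ
    (f := fun j x => u j x ^ q j) (fun j _ => ((hu j).pow_const _).aemeasurable) hsum
    fun j _ => (div_pos hp (hq j)).le
  have e : ∀ x, ∏ j, (u j x ^ q j) ^ (p / q j) = (∏ j, u j x) ^ p := fun x => by
    rw [← ENNReal.prod_rpow_of_nonneg hp.le]
    refine Finset.prod_congr rfl fun j _ => ?_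
    rw [← ENNReal.rpow_mul, mul_div_cancel₀ _ (hq j).ne']
  simp_rw [e] at h
  refine (ENNReal.rpow_le_rpow h (one_div_pos.2 hp).le).trans (le_of_eq ?_)
  rw [← ENNReal.prod_rpow_of_nonneg (one_div_pos.2 hp).le]
  refine Finset.prod_congr rfl fun j _ => ?_
  rw [← ENNReal.rpow_mul]
  congr 1
  field_simp

lemma eLpNorm_ofReal {α ε : Type*} [MeasurableSpace α] [ENorm ε] {μ : Measure α} {q : ℝ}
    (hq : 0 < q) (f : α → ε) :
    eLpNorm f (ENNReal.ofReal q) μ = (∫⁻ x, ‖f x‖ₑ ^ q ∂μ) ^ (1 / q) := by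
  rw [eLpNorm_eq_lintegral_rpow_enorm_toReal (ENNReal.ofReal_pos.2 hq).ne' ENNReal.ofReal_ne_top,
    ENNReal.toReal_ofReal hq.le]

end MultilinearMarcinkiewicz

/-! ### Assembly of the L^p bound. -/

namespace MultilinearMarcinkiewicz

section Final

variable {n m : ℕ}

lemma ae_sphereMax_ne_top {q : ℝ} (hq : 1 < q) {f : E n → ℂ} (hf : Measurable f)
    (hfin : ∫⁻ x, ‖f x‖ₑ ^ q ≠ ∞) : ∀ᵐ x, sphereMax f x ≠ ∞ := by
  obtain ⟨C, hC⟩ := lintegral_sphereMax_rpow_le n hq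
  have h : ∫⁻ x, sphereMax f x ^ q ≠ ∞ :=
    ne_top_of_le_ne_top (ENNReal.mul_ne_top ENNReal.coe_ne_top hfin) (hC f hf)
  filter_upwards [ae_lt_top ((measurable_sphereMax hf).pow_const q) h] with x hx
  rintro hx'
  rw [hx', ENNReal.top_rpow_of_pos (by linarith)] at hx
  exact lt_irrefl _ hx

theorem eLpNorm_marcinkiewicz_le (hn : 1 ≤ n) {ω : Fin (m + 1) → E n → ℂ}
    (hodd : Function.Odd (ω 0)) (hhom : ∀ j, HomogeneousDegreeZero (ω j))
    (hlip : ∀ j, LipschitzOnSphere (ω j)) {p : ℝ} {q : Fin (m + 1) → ℝ} (hq : ∀ j, 1 < q j)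
    (hpq : 1 / p = ∑ j, 1 / q j) :
    ∃ C : ℝ≥0, ∀ f : Fin (m + 1) → E n → ℂ, (∀ j, Measurable (f j)) →
      (∀ j, ∫⁻ x, ‖f j x‖ₑ ^ q j ≠ ∞) →
      eLpNorm (marcinkiewicz (sinProd ω) f) (ENNReal.ofReal p) volume
        ≤ C * ∏ j, eLpNorm (f j) (ENNReal.ofReal (q j)) volume := by
  have hq0 : ∀ j, 0 < q j := fun j => one_pos.trans (hq j)
  have hp : 0 < p := by
    rw [← one_div_pos, hpq]
    exact Finset.sum_pos (fun j _ => one_div_pos.2 (hq0 j)) Finset.univ_nonempty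
  obtain ⟨B, hB⟩ := exists_enorm_sinProd_le hhom hlip
  obtain ⟨C₀, hC₀⟩ := lintegral_sphereSq_rpow_le n (hq 0)
  choose M hM using fun j => lintegral_sphereMax_rpow_le n (hq j)
  set K : Fin (m + 1) → ℝ≥0 := Fin.cons C₀ fun j => M j.succ with hK
  refine ⟨B * 3 ^ m * ∏ j, K j ^ (1 / q j), fun f hf hfin => ?_⟩
  -- Slot 0 carries the square function, the others the maximal functions; `K` holds the matching
  -- constants.
  set u : Fin (m + 1) → E n → ℝ≥0∞ := Fin.cons (sphereSq (f 0)) fun j => sphereMax (f j.succ)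
    with hu
  have hum : ∀ j, Measurable (u j) := by
    refine Fin.cases ?_ fun j => ?_
    · exact measurable_sphereSq (hf 0)
    · exact measurable_sphereMax (hf j.succ)
  have huK : ∀ j, ∫⁻ x, u j x ^ q j ≤ K j * ∫⁻ x, ‖f j x‖ₑ ^ q j := by
    refine Fin.cases ?_ fun j => ?_
    · exact hC₀ _ (hf 0) (hfin 0)
    · exact hM _ _ (hf _)
  have hpt : ∀ᵐ x, marcinkiewicz (sinProd ω) f x ≤ (B * 3 ^ m : ℝ≥0∞) * ∏ j, u j x := by
    filter_upwards [ae_all_iff.2 fun j => ae_sphereMax_ne_top (hq j) (hf j) (hfin j)] with x hx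
    refine (marcinkiewicz_sinProd_le hn hodd hhom hlip hB hf hx).trans (le_of_eq ?_)
    rw [Fin.prod_univ_succ, mul_assoc, mul_comm (∏ j, _)]
    rfl
  have hc : (B * 3 ^ m : ℝ≥0∞) ≠ ∞ :=
    ENNReal.mul_ne_top ENNReal.coe_ne_top (ENNReal.pow_ne_top (by norm_num))
  simp_rw [fun j => eLpNorm_ofReal (μ := volume) (hq0 j) (f j)]
  rw [eLpNorm_ofReal hp]
  simp only [enorm_eq_self]
  calc (∫⁻ x, marcinkiewicz (sinProd ω) f x ^ p) ^ (1 / p)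
      ≤ (∫⁻ x, (B * 3 ^ m : ℝ≥0∞) ^ p * (∏ j, u j x) ^ p) ^ (1 / p) := by
        refine ENNReal.rpow_le_rpow (lintegral_mono_ae ?_) (one_div_pos.2 hp).le
        filter_upwards [hpt] with x hx
        rw [← ENNReal.mul_rpow_of_nonneg _ _ hp.le]
        exact ENNReal.rpow_le_rpow hx hp.le
    _ = (B * 3 ^ m : ℝ≥0∞) * (∫⁻ x, (∏ j, u j x) ^ p) ^ (1 / p) := by
        rw [lintegral_const_mul' _ _ (ENNReal.rpow_ne_top_of_nonneg hp.le hc),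
          ENNReal.mul_rpow_of_nonneg _ _ (one_div_pos.2 hp).le, ← ENNReal.rpow_mul,
          mul_one_div_cancel hp.ne', ENNReal.rpow_one]
    _ ≤ (B * 3 ^ m : ℝ≥0∞) * ∏ j, (K j * ∫⁻ x, ‖f j x‖ₑ ^ q j) ^ (1 / q j) := by
        refine mul_le_mul' le_rfl ((lintegral_prod_rpow_le hum hp hq0 hpq).trans ?_)
        exact Finset.prod_le_prod' fun j _ =>
          ENNReal.rpow_le_rpow (huK j) (one_div_pos.2 (hq0 j)).le
    _ = _ := by
        have e : ∀ j, (K j * ∫⁻ x, ‖f j x‖ₑ ^ q j) ^ (1 / q j)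
            = ((K j ^ (1 / q j) : ℝ≥0) : ℝ≥0∞) * (∫⁻ x, ‖f j x‖ₑ ^ q j) ^ (1 / q j) := fun j => by
          rw [ENNReal.mul_rpow_of_nonneg _ _ (one_div_pos.2 (hq0 j)).le,
            ENNReal.coe_rpow_of_nonneg _ (one_div_pos.2 (hq0 j)).le]
        simp_rw [e]
        rw [Finset.prod_mul_distrib, ← mul_assoc]
        push_cast
        rfl

end Final

end MultilinearMarcinkiewicz

theorem claim1 (n m : ℕ) (hn : 1 ≤ n) (hm : 1 ≤ m)
    (ω : Fin m → MultilinearMarcinkiewicz.E n → ℂ)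
    (hodd : ∀ j, Function.Odd (ω j))
    (hhom : ∀ j, MultilinearMarcinkiewicz.HomogeneousDegreeZero (ω j))
    (hlip : ∀ j, MultilinearMarcinkiewicz.LipschitzOnSphere (ω j))
    (p : ℝ) (q : Fin m → ℝ) (hq : ∀ j, 1 < q j) (hpq : 1 / p = ∑ j, 1 / q j) :
    ∃ C : ℝ≥0, ∀ f : Fin m → MultilinearMarcinkiewicz.E n → ℂ,
      (∀ j, MemLp (f j) (ENNReal.ofReal (q j)) volume) →
        (∀ᵐ x ∂(volume : Measure (MultilinearMarcinkiewicz.E n)), ∀ t : ℝ, 0 < t →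
          IntegrableOn
            (MultilinearMarcinkiewicz.integrand (MultilinearMarcinkiewicz.sinProd ω) f x)
            (MultilinearMarcinkiewicz.ballProd n m t) volume) ∧
        AEMeasurable
          (MultilinearMarcinkiewicz.marcinkiewicz (MultilinearMarcinkiewicz.sinProd ω) f)
          volume ∧
        eLpNorm (MultilinearMarcinkiewicz.marcinkiewicz (MultilinearMarcinkiewicz.sinProd ω) f)
            (ENNReal.ofReal p) volume
          ≤ C * ∏ j, eLpNorm (f j) (ENNReal.ofReal (q j)) volume := by
  obtain ⟨m, rfl⟩ : ∃ k, m = k + 1 := ⟨m - 1, by omega⟩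
  have hq0 : ∀ j, 0 < q j := fun j => one_pos.trans (hq j)
  obtain ⟨B, hB⟩ := MultilinearMarcinkiewicz.exists_enorm_sinProd_le hhom hlip
  have hS := MultilinearMarcinkiewicz.measurable_sinProd hhom hlip
  obtain ⟨C, hC⟩ :=
    MultilinearMarcinkiewicz.eLpNorm_marcinkiewicz_le hn (hodd 0) hhom hlip hq hpq
  refine ⟨C, fun f hf => ?_⟩
  -- Pass to measurable representatives; neither the integrals nor the norms change.
  choose g hg hfg using fun j => (hf j).aestronglyMeasurable
  have hgm : ∀ j, Measurable (g j) := fun j => (hg j).measurable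
  have hgfin : ∀ j, ∫⁻ x, ‖g j x‖ₑ ^ q j ≠ ∞ := fun j => by
    have h := ((memLp_congr_ae (hfg j)).1 (hf j)).2
    rw [MultilinearMarcinkiewicz.eLpNorm_ofReal (hq0 j)] at h
    intro h'
    rw [h', ENNReal.top_rpow_of_pos (one_div_pos.2 (hq0 j))] at h
    exact lt_irrefl _ h
  have hμ := MultilinearMarcinkiewicz.marcinkiewicz_congr_ae
    (MultilinearMarcinkiewicz.sinProd ω) hfg
  refine ⟨?_, ?_, ?_⟩
  · filter_upwards [ae_all_iff.2 fun j => MultilinearMarcinkiewicz.ae_sphereMax_ne_top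
      (hq j) (hgm j) (hgfin j)] with x hx t ht
    exact (MultilinearMarcinkiewicz.integrableOn_integrand hn hS hB hgm hx ht).congr_fun_ae
      (ae_restrict_of_ae (MultilinearMarcinkiewicz.integrand_ae_eq _ hfg x).symm)
  · rw [hμ]
    exact (MultilinearMarcinkiewicz.measurable_marcinkiewicz hS hgm).aemeasurable
  · rw [hμ, Finset.prod_congr rfl fun j _ => eLpNorm_congr_ae (hfg j)]
    exact hC g hgm hgfin
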